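/- **Theorem 1.1.** Let $p\ge1$, $q\ge0$, and let $\{\varepsilon_t\}_{t\in\mathbb Z}$ be i.i.d. with $E\varepsilon_0=0$ and $E\varepsilon_0^2=1$. Fix $0<\underline u<\bar u$ and $0<\rho_0<1$ with $q\underline u<\rho_0$, and let $\Theta$ be the set of $\mathbf u=(s_0,\dots,s_p,t_1,\dots,t_q)\in\mathbb R^{p+q+1}$ all of whose coordinates lie in $[\underline u,\bar u]$ and for which $t_1+\dots+t_q\le\rho_0$. Let $\boldsymbol\theta=(\alpha_0,\dots,\alpha_p,\beta_1,\dots,\beta_q)$ be in the interior of $\Theta$. Assume that the top Lyapunov exponent $\gamma=\inf_{n\ge1}\frac1n E\log\|A(\varepsilon_n)\cdots A(\varepsilon_1)\|$ is negative, where $A(e)$ is the matrix for which the recursion below takes the form $Y_t=A(\varepsilon_t)Y_{t-1}+B_t$ with $Y_t=(X_t^2,\dots,X_{t-p+1}^2,\sigma_t^2,\dots,\sigma_{t-q+1}^2)$ and $B_t$ depending only on $\alpha_0$ and $\varepsilon_t$. Let $(X_t,\sigma_t)_{t\in\mathbb Z}$, $\sigma_t\ge0$, be the strictly stationary solution of the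 GARCH$(p,q)$ equations $$X_t=\sigma_t\varepsilon_t,\qquad \sigma_t^2=\alpha_0+\sum_{i=1}^p\alpha_iX_{t-i}^2+\sum_{j=1}^q\beta_j\sigma_{t-j}^2 .$$ For $\mathbf u=(s_0,\dots,s_p,t_1,\dots,t_q)$ put $c_0(\mathbf u)=s_0/(1-t_1-\dots-t_q)$ and, for $i\ge1$, $c_i(\mathbf u)=s_i+\sum_{j=1}^{\min(q,i-1)}t_jc_{i-j}(\mathbf u)$, with $s_i=0$ for $i>p$. Let $$\partial\log\sigma_t^2(\mathbf u)=\frac{\partial c_0(\mathbf u)+\sum_{i\ge1}\partial c_i(\mathbf u)X_{t-i}^2}{c_0(\mathbf u)+\sum_{i\ge1}c_i(\mathbf u)X_{t-i}^2},\qquad \psi(\boldsymbol\theta)=E\,\partial\log\sigma_0^2(\boldsymbol\theta),$$ where $\partial$ is the gradient in $\mathbf u$. For each $n$ let $\hat{\boldsymbol\theta}_n$ be a (measurable) function of $X_0,\dots,X_n$, and suppose $\sqrt n\,|\hat{\boldsymbol\theta}_n-\boldsymbol\theta|=O_P(1)$, where $|\cdot|$ is the maximum norm. For $1\le t\le n$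 let $$\hat\sigma_t^2=c_0(\hat{\boldsymbol\theta}_n)+\sum_{i=1}^tc_i(\hat{\boldsymbol\theta}_n)X_{t-i}^2,\qquad \hat\varepsilon_t=X_t/\hat\sigma_t,$$ and let, for $0\le u\le1$ and an integer $k\ge1$, $$\hat S_n^{(k)}(u)=\sum_{t=1}^{\lfloor nu\rfloor}\hat\varepsilon_t^{\,k},\qquad S_n^{(k)}(u)=\sum_{t=1}^{\lfloor nu\rfloor}\varepsilon_t^{k}.$$ Suppose that $\lim_{x\downarrow0}x^{-\zeta}P\{|\varepsilon_0|\le x\}=0$ for some $\zeta>0$ and that $E|\varepsilon_0|^k<\infty$; put $\mu_k=E\varepsilon_0^k$. Then $\psi(\boldsymbol\theta)$ exists (the series defining $\partial\log\sigma_0^2(\boldsymbol\theta)$ converge almost surely and its coordinates are integrable), and $$\sup_{0\le u\le1}\left|\frac1{\sqrt n}\bigl(\hat S_n^{(k)}(u)-S_n^{(k)}(u)\bigr)+\frac{k\,u\,\mu_k}{2}\bigl\langle\psi(\boldsymbol\theta),\sqrt n(\hat{\boldsymbol\theta}_n-\boldsymbol\theta)\bigr\rangle\right|=o_P(1).$$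 In particular, $\sup_{0\le u\le1}n^{-1/2}|\hat S_n^{(k)}(u)-S_n^{(k)}(u)|=o_P(1)$ if and only if $\mu_k=0$ or $\langle\psi(\boldsymbol\theta),\sqrt n(\hat{\boldsymbol\theta}_n-\boldsymbol\theta)\rangle=o_P(1)$. -/

import Mathlib

namespace GARCH

open MeasureTheory ProbabilityTheory Filter

noncomputable section

/-- The parameter vectors `u = (s, t)` in `ℝ^(p+q+1)`: the coordinates `Sum.inl 0, …, Sum.inl p`
are `s_0, …, s_p` and `Sum.inr 0, …, Sum.inr (q-1)` are `t_1, …, t_q`. The norm of this type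
is the maximum norm. -/
abbrev Param (p q : ℕ) : Type := Fin (p + 1) ⊕ Fin q → ℝ

/-- The parameter space `Θ`. -/
def paramSpace (p q : ℕ) (ρ₀ uLow uHigh : ℝ) : Set (Param p q) :=
  {u | ∑ j : Fin q, u (Sum.inr j) ≤ ρ₀ ∧ ∀ i, uLow ≤ u i ∧ u i ≤ uHigh}

/-- The coefficients `c_i(u)`:
`c_0 = s_0 / (1 - (t_1 + ⋯ + t_q))` and, for `i ≥ 1`,
`c_i = s_i + ∑ t_j c_{i-j}` over `1 ≤ j ≤ min (q, i-1)`, with `s_i = 0` for `i > p`.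
In the code `t_{j+1}` is `u (Sum.inr j)`, and it multiplies `c_{(i+1)-(j+1)}`. -/
def coef {p q : ℕ} (u : Param p q) : ℕ → ℝ
  | 0 => u (Sum.inl 0) / (1 - ∑ j : Fin q, u (Sum.inr j))
  | i + 1 => (if h : i + 1 < p + 1 then u (Sum.inl ⟨i + 1, h⟩) else 0) +
      ∑ j : Fin q, if j.val < i then u (Sum.inr j) * coef u (i - j.val) else 0
  termination_by i => i
  decreasing_by omega

/-- The partial derivative of `c_i` at `u` in the coordinate `j`. -/
def coefDeriv {p q : ℕ} (u : Param p q) (i : ℕ) (j : Fin (p + 1) ⊕ Fin q) : ℝ :=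
  deriv (fun x : ℝ => coef (Function.update u j x) i) (u j)

/-- `σ_t²(u) = c_0(u) + ∑_{i ≥ 1} c_i(u) X_{t-i}²`, for one trajectory `x` of the process `X`. -/
def volSq {p q : ℕ} (x : ℤ → ℝ) (u : Param p q) (t : ℤ) : ℝ :=
  coef u 0 + ∑' i : ℕ, coef u (i + 1) * x (t - ((i : ℤ) + 1)) ^ 2

/-- The coordinates of `∂ log σ_t²(u) = (∂c_0 + ∑_{i ≥ 1} ∂c_i X_{t-i}²) / σ_t²(u)`. -/
def dLogVolSq {p q : ℕ} (x : ℤ → ℝ) (u : Param p q) (t : ℤ) (j : Fin (p + 1) ⊕ Fin q) : ℝ :=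
  (coefDeriv u 0 j + ∑' i : ℕ, coefDeriv u (i + 1) j * x (t - ((i : ℤ) + 1)) ^ 2) /
    volSq x u t

/-- `ψ(θ) = E (∂ log σ_0²(θ))`. -/
def psi {Ω : Type*} [MeasurableSpace Ω] (μ : Measure Ω) {p q : ℕ} (X : ℤ → Ω → ℝ)
    (θ : Param p q) : Param p q :=
  fun j => ∫ ω, dLogVolSq (fun t => X t ω) θ 0 j ∂μ

/-- `ψ(θ)` exists: almost surely the series for `σ_0²(θ)` and its derivatives converge, and the
coordinates of `∂ log σ_0²(θ)` are integrable. -/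
def PsiExists {Ω : Type*} [MeasurableSpace Ω] (μ : Measure Ω) {p q : ℕ} (X : ℤ → Ω → ℝ)
    (θ : Param p q) : Prop :=
  (∀ᵐ ω ∂μ, Summable fun i : ℕ => coef θ (i + 1) * X (0 - ((i : ℤ) + 1)) ω ^ 2) ∧
  (∀ j, ∀ᵐ ω ∂μ, Summable fun i : ℕ => coefDeriv θ (i + 1) j * X (0 - ((i : ℤ) + 1)) ω ^ 2) ∧
  ∀ j, Integrable (fun ω => dLogVolSq (fun t => X t ω) θ 0 j) μ

/-- The innovations: i.i.d. with mean `0` and variance `1`. -/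
structure IsInnovation {Ω : Type*} [MeasurableSpace Ω] (μ : Measure Ω) (ε : ℤ → Ω → ℝ) :
    Prop where
  measurable : ∀ t, Measurable (ε t)
  indep : iIndepFun ε μ
  identDistrib : ∀ t, IdentDistrib (ε t) (ε 0) μ μ
  memLp : MemLp (ε 0) 2 μ
  mean_zero : ∫ ω, ε 0 ω ∂μ = 0
  var_one : ∫ ω, ε 0 ω ^ 2 ∂μ = 1

/-- `(X, σ)` is a strictly stationary solution of the GARCH(p, q) equations with parameter
`θ = (α_0, …, α_p, β_1, …, β_q)` driven by `ε`. -/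
structure IsStationarySolution {Ω : Type*} [MeasurableSpace Ω] (μ : Measure Ω) {p q : ℕ}
    (θ : Param p q) (ε X σ : ℤ → Ω → ℝ) : Prop where
  measurable_X : ∀ t, Measurable (X t)
  measurable_vol : ∀ t, Measurable (σ t)
  vol_nonneg : ∀ t, ∀ᵐ ω ∂μ, 0 ≤ σ t ω
  obs_eq : ∀ t, ∀ᵐ ω ∂μ, X t ω = σ t ω * ε t ω
  vol_eq : ∀ t : ℤ, ∀ᵐ ω ∂μ, σ t ω ^ 2 = θ (Sum.inl 0) +
    ∑ i : Fin p, θ (Sum.inl i.succ) * X (t - ((i.val : ℤ) + 1)) ω ^ 2 +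
    ∑ j : Fin q, θ (Sum.inr j) * σ (t - ((j.val : ℤ) + 1)) ω ^ 2
  stationary : ∀ h : ℤ, IdentDistrib (fun ω (t : ℤ) => (X (t + h) ω, σ (t + h) ω))
    (fun ω (t : ℤ) => (X t ω, σ t ω)) μ μ

/-- The coefficients `(α_1, …, α_p, β_1, …, β_q)`. -/
def lagCoef {p q : ℕ} (θ : Param p q) : Fin p ⊕ Fin q → ℝ
  | Sum.inl i => θ (Sum.inl i.succ)
  | Sum.inr j => θ (Sum.inr j)

/-- The matrix `A(e)` of the GARCH recursion in Markovian form: if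
`Y_t = (X_t², …, X_{t-p+1}², σ_t², …, σ_{t-q+1}²)`, then `Y_t = A(ε_t) Y_{t-1} + B_t`, where
`B_t` depends on `α_0` and `ε_t` only. -/
def recMatrix {p q : ℕ} (θ : Param p q) (e : ℝ) :
    Matrix (Fin p ⊕ Fin q) (Fin p ⊕ Fin q) ℝ
  | Sum.inl i, Sum.inl j =>
      if i.val = 0 then e ^ 2 * lagCoef θ (Sum.inl j) else if i.val = j.val + 1 then 1 else 0
  | Sum.inl i, Sum.inr j => if i.val = 0 then e ^ 2 * lagCoef θ (Sum.inr j) else 0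
  | Sum.inr i, Sum.inl j => if i.val = 0 then lagCoef θ (Sum.inl j) else 0
  | Sum.inr i, Sum.inr j =>
      if i.val = 0 then lagCoef θ (Sum.inr j) else if i.val = j.val + 1 then 1 else 0

/-- `A(e_n) ⋯ A(e_1)`. -/
def recMatrixProd {p q : ℕ} (θ : Param p q) (e : ℤ → ℝ) :
    ℕ → Matrix (Fin p ⊕ Fin q) (Fin p ⊕ Fin q) ℝ
  | 0 => 1
  | n + 1 => recMatrix θ (e ((n : ℤ) + 1)) * recMatrixProd θ e n

/-- The submultiplicative matrix norm `∑ |M_ij|`. -/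
def entryNorm {ι : Type*} [Fintype ι] (M : Matrix ι ι ℝ) : ℝ := ∑ i, ∑ j, |M i j|

/-- The top Lyapunov exponent `γ = inf_{n ≥ 1} (1/n) E log ‖A(ε_n) ⋯ A(ε_1)‖`. -/
def topLyapunov {Ω : Type*} [MeasurableSpace Ω] (μ : Measure Ω) {p q : ℕ} (θ : Param p q)
    (ε : ℤ → Ω → ℝ) : ℝ :=
  ⨅ n : ℕ, (∫ ω, Real.log (entryNorm (recMatrixProd θ (fun t => ε t ω) (n + 1))) ∂μ) /
    ((n : ℝ) + 1)

/-- `Y_n = O_P(1)`. -/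
def IsBigOP {Ω : Type*} [MeasurableSpace Ω] (μ : Measure Ω) (Y : ℕ → Ω → ℝ) : Prop :=
  ∀ η : ENNReal, 0 < η → ∃ M : ℝ, ∀ᶠ n in atTop, μ {ω | M < |Y n ω|} ≤ η

/-- `Y_n = o_P(1)`. -/
def IsLittleOP {Ω : Type*} [MeasurableSpace Ω] (μ : Measure Ω) (Y : ℕ → Ω → ℝ) : Prop :=
  TendstoInMeasure μ Y atTop (fun _ => 0)

/-- The truncated estimate `σ̂_t² = c_0(v) + ∑_{i=1}^t c_i(v) X_{t-i}²`, where `v` is the value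
of the parameter estimate. -/
def volHatSq {p q : ℕ} (x : ℤ → ℝ) (v : Param p q) (t : ℕ) : ℝ :=
  coef v 0 + ∑ i ∈ Finset.Icc 1 t, coef v i * x ((t : ℤ) - (i : ℤ)) ^ 2

/-- The residual `ε̂_t = X_t / σ̂_t`. -/
def residual {p q : ℕ} (x : ℤ → ℝ) (v : Param p q) (t : ℕ) : ℝ :=
  x (t : ℤ) / Real.sqrt (volHatSq x v t)

/-- The partial sum process `∑_{t=1}^{⌊nu⌋} e_t^k`. -/
def powerSum (k n : ℕ) (e : ℕ → ℝ) (u : ℝ) : ℝ :=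
  ∑ t ∈ Finset.Icc 1 ⌊(n : ℝ) * u⌋₊, e t ^ k

/-- The estimate `θ̂_n`, a function `est n` of the sample `X_0, …, X_n`. -/
def estimate {Ω : Type*} {p q : ℕ} (est : ∀ n : ℕ, (Fin (n + 1) → ℝ) → Param p q)
    (X : ℤ → Ω → ℝ) (n : ℕ) (ω : Ω) : Param p q :=
  est n (fun i => X (i.val : ℤ) ω)

/-- `n^{-1/2} (Ŝ_n^{(k)}(u) - S_n^{(k)}(u))`, where `Ŝ_n^{(k)}` is the partial sum process of
the `k`th powers of the residuals and `S_n^{(k)}` that of the innovations. -/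
def scaledDiff {Ω : Type*} {p q : ℕ} (est : ∀ n : ℕ, (Fin (n + 1) → ℝ) → Param p q)
    (ε X : ℤ → Ω → ℝ) (k n : ℕ) (u : ℝ) (ω : Ω) : ℝ :=
  1 / Real.sqrt n *
    (powerSum k n (fun t => residual (fun s => X s ω) (estimate est X n ω) t) u -
      powerSum k n (fun t => ε (t : ℤ) ω) u)

/-- `⟨ψ(θ), √n (θ̂_n - θ)⟩`. -/
def psiInner {Ω : Type*} [MeasurableSpace Ω] (μ : Measure Ω) {p q : ℕ}
    (est : ∀ n : ℕ, (Fin (n + 1) → ℝ) → Param p q) (X : ℤ → Ω → ℝ) (θ : Param p q)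
    (n : ℕ) (ω : Ω) : ℝ :=
  ∑ j, psi μ X θ j * (Real.sqrt n * (estimate est X n ω j - θ j))

end

end GARCH

/-! The residual factors as `ε̂_t = ε_t y_t` with `y_t = (σ_t² / σ̂_t²)^{1/2}`. A second order
expansion gives `y_t^k = 1 - (k/2) ⟨∂ log σ_t²(θ), θ̂_n - θ⟩ + R_t`, where `|R_t| ≤ V Z_t (|θ̂_n -
θ|² + g^t)` as soon as `|θ̂_n - θ| ≤ δ`, an event whose probability tends to one. Here `g < 1`, `V`
does not depend on `t`, and `Z_t` depends on `ε_{t-1}, ε_{t-2}, …` only and has a bounded mean.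
After multiplication by `ε_t^k`, summation and division by `√n`, the remainder is at most `V / √n`
times `n |θ̂_n - θ|²` multiplied by an average of `|ε_t|^k Z_t`, plus a geometrically weighted sum
of the same variables. All these factors are `O_P(1)`: independence of `ε_t` and `Z_t` makes the
`k`th moment of `ε_0` sufficient. In the linear term, a law of large numbers for `ε_t^k ∂ log
σ_t²(θ)`, uniform over initial segments, produces the drift `u μ_k ψ(θ)`. The final equivalence
compares the two suprema; at `u = 1` the drift can be read off.

Three facts make the expansion work with so little integrability.

Coefficients (`exists_coef_bounds`): for `i ≥ 1`, `c_i` is a polynomial of degree at most `i` with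
nonnegative coefficients. A relative perturbation of the parameters by `d` therefore changes `c_i`
by a relative amount of at most `(1 + d)^i - 1`, and a weight `g^i` absorbs this when `d` is small.

Small powers (`div_le_geometric`): a summand of `σ_t²` divided by `σ_t²` lies in `[0, 1]`, hence is
dominated by an arbitrarily small power of the summand. Powers of such ratios have a mean once
`X_0²` has some positive moment.

Stationarity (`stationary_facts`): a negative Lyapunov exponent makes the `s`th moments of the
matrix products summable for some `s > 0`. The series solution of the Markovian recursion then has a
finite `s`th moment, and tightness of the stationary solution forces it to coincide with that
series. Finally `σ_t² = σ_t²(θ)`, since the difference solves a contracting homogeneous recursion.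

The law of large numbers (`tendsto_measure_sum_past`) approximates a functional of the whole past in
`L¹` by one of finitely many innovations, to which the strong law applies along residue classes. -/

namespace GARCH

open MeasureTheory ProbabilityTheory Filter

/-! ### Coefficients of the volatility series: derivatives, relative perturbation bounds, geometric
decay. -/

section Coefficients

variable {p q : ℕ}

theorem coef_zero (u : Param p q) :
    coef u 0 = u (Sum.inl 0) / (1 - ∑ j : Fin q, u (Sum.inr j)) := by
  rw [coef]

theorem coef_succ (u : Param p q) (i : ℕ) :
    coef u (i + 1) = (if h : i + 1 < p + 1 then u (Sum.inl ⟨i + 1, h⟩) else 0) +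
      ∑ j : Fin q, if j.val < i then u (Sum.inr j) * coef u (i - j.val) else 0 := by
  rw [coef]

/-- The directional derivative of `c_i` at `u` in the direction `h`. -/
noncomputable def coefLin (u h : Param p q) (i : ℕ) : ℝ := ∑ j, coefDeriv u i j * h j

/-- The guard `j.val < i` keeps `c_0` out of the recursion, so for `i ≥ 1` the coefficient is a
polynomial in the parameters and no condition on `∑ t_j` is needed. -/
theorem hasDerivAt_coef_succ (u : Param p q) (j : Fin (p + 1) ⊕ Fin q) (i : ℕ) :
    HasDerivAt (fun x : ℝ => coef (Function.update u j x) (i + 1)) (coefDeriv u (i + 1) j)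
      (u j) := by
  refine DifferentiableAt.hasDerivAt (𝕜 := ℝ) ?_
  induction i using Nat.strong_induction_on with
  | _ i ih =>
    simp only [coef_succ]
    have hup : ∀ l, DifferentiableAt ℝ (fun x : ℝ => Function.update u j x l) (u j) := by
      intro l
      by_cases hl : l = j
      · subst hl; simp
      · simp [Function.update_of_ne hl]
    refine DifferentiableAt.add ?_ (DifferentiableAt.fun_sum fun l _ => ?_)
    · split_ifs
      · exact hup _
      · simp
    · split_ifs with hl
      · refine (hup _).mul ?_
        have : i - l.val = (i - l.val - 1) + 1 := by omega
        rw [this]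
        exact ih _ (by omega)
      · simp

theorem coefDeriv_succ (u : Param p q) (i : ℕ) (j : Fin (p + 1) ⊕ Fin q) :
    coefDeriv u (i + 1) j =
      (if h : i + 1 < p + 1 then (if Sum.inl ⟨i + 1, h⟩ = j then 1 else 0) else 0) +
      ∑ l : Fin q, if l.val < i then
        (if Sum.inr l = j then 1 else 0) * coef u (i - l.val) +
          u (Sum.inr l) * coefDeriv u (i - l.val) j else 0 := by
  refine (hasDerivAt_coef_succ u j i).unique ?_
  simp only [coef_succ]
  have hup : ∀ l, HasDerivAt (fun x : ℝ => Function.update u j x l)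
      (if l = j then 1 else 0) (u j) := by
    intro l
    by_cases hl : l = j
    · subst hl; simpa using hasDerivAt_id' (u l)
    · simpa [Function.update_of_ne hl, hl] using hasDerivAt_const (u j) (u l)
  refine HasDerivAt.add ?_ (HasDerivAt.fun_sum fun l _ => ?_)
  · by_cases h1 : i + 1 < p + 1
    · simpa only [h1, dif_pos] using hup (Sum.inl ⟨i + 1, h1⟩)
    · simpa only [h1, dif_neg, not_false_eq_true] using hasDerivAt_const (u j) (0 : ℝ)
  · by_cases hl : l.val < i
    · simp only [hl, if_true]
      obtain ⟨m, hm⟩ : ∃ m, i - l.val = m + 1 := ⟨i - l.val - 1, by omega⟩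
      rw [hm]
      simpa using (hup (Sum.inr l)).fun_mul (hasDerivAt_coef_succ u j m)
    · simp only [hl, if_false]
      exact hasDerivAt_const _ _

theorem coefLin_succ (u h : Param p q) (i : ℕ) :
    coefLin u h (i + 1) =
      (if hi : i + 1 < p + 1 then h (Sum.inl ⟨i + 1, hi⟩) else 0) +
      ∑ l : Fin q, if l.val < i then
        h (Sum.inr l) * coef u (i - l.val) + u (Sum.inr l) * coefLin u h (i - l.val) else 0 := by
  unfold coefLin
  simp only [coefDeriv_succ, add_mul, Finset.sum_add_distrib, Finset.sum_mul]
  congr 1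
  · split_ifs <;> simp
  · rw [Finset.sum_comm]
    refine Finset.sum_congr rfl fun l _ => ?_
    split_ifs
    · simp only [add_mul, Finset.sum_add_distrib, Finset.mul_sum, mul_assoc]
      simp [mul_comm]
    · simp

theorem coefDeriv_zero (u : Param p q) (hu : ∑ l : Fin q, u (Sum.inr l) ≠ 1)
    (j : Fin (p + 1) ⊕ Fin q) :
    coefDeriv u 0 j = (if Sum.inl 0 = j then 1 else 0) / (1 - ∑ l : Fin q, u (Sum.inr l)) +
      u (Sum.inl 0) * (∑ l : Fin q, if Sum.inr l = j then 1 else 0) /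
        (1 - ∑ l : Fin q, u (Sum.inr l)) ^ 2 := by
  unfold coefDeriv
  simp only [coef_zero]
  have hup : ∀ l, HasDerivAt (fun x : ℝ => Function.update u j x l)
      (if l = j then 1 else 0) (u j) := by
    intro l
    by_cases hl : l = j
    · subst hl; simpa using hasDerivAt_id' (u l)
    · simpa [Function.update_of_ne hl, hl] using hasDerivAt_const (u j) (u l)
  have h1 : HasDerivAt (fun x : ℝ => 1 - ∑ l : Fin q, Function.update u j x (Sum.inr l))
      (-∑ l : Fin q, if Sum.inr l = j then 1 else 0) (u j) := by
    simpa using (HasDerivAt.fun_sum fun l (_ : l ∈ Finset.univ) => hup (Sum.inr l)).const_sub 1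
  have hne : (1 - ∑ l : Fin q, u (Sum.inr l)) ≠ 0 := sub_ne_zero.2 hu.symm
  have h2 := (hup (Sum.inl 0)).fun_div h1 (by simpa using hne)
  rw [h2.deriv]
  simp only [Function.update_eq_self]
  field_simp
  ring

theorem coefLin_zero (u h : Param p q) (hu : ∑ l : Fin q, u (Sum.inr l) ≠ 1) :
    coefLin u h 0 = h (Sum.inl 0) / (1 - ∑ l : Fin q, u (Sum.inr l)) +
      u (Sum.inl 0) * (∑ l : Fin q, h (Sum.inr l)) / (1 - ∑ l : Fin q, u (Sum.inr l)) ^ 2 := by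
  unfold coefLin
  simp only [coefDeriv_zero u hu, Fintype.sum_sum_type, add_mul, Finset.sum_add_distrib]
  simp only [Finset.mul_sum, Finset.sum_div, Finset.sum_mul]
  simp [div_mul_eq_mul_div, ite_div]
  ring

theorem coef_nonneg {u : Param p q} (hu : ∀ j, 0 ≤ u j) (i : ℕ) : 0 ≤ coef u (i + 1) := by
  induction i using Nat.strong_induction_on with
  | _ i ih =>
    rw [coef_succ]
    refine add_nonneg ?_ (Finset.sum_nonneg fun l _ => ?_)
    · split_ifs
      exacts [hu _, le_rfl]
    · split_ifs with hl
      · obtain ⟨m, hm⟩ : ∃ m, i - l.val = m + 1 := ⟨i - l.val - 1, by omega⟩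
        rw [hm]
        exact mul_nonneg (hu _) (ih m (by omega))
      · exact le_rfl

/-- A bound along the recursion: if `f` satisfies a recursion dominated by `r` times the one of
the coefficients, then `|f_i| ≤ r_i c_i`. -/
theorem abs_le_of_recursion {u : Param p q} (hu : ∀ j, 0 ≤ u j) {r f : ℕ → ℝ} (hr : Monotone r)
    {a : ℕ → ℝ} {b : ℕ → Fin q → ℝ}
    (hf : ∀ i, f (i + 1) = a i + ∑ l : Fin q, if l.val < i then b i l else 0)
    (ha : ∀ i, |a i| ≤ r 1 * (if h : i + 1 < p + 1 then u (Sum.inl ⟨i + 1, h⟩) else 0))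
    (hb : ∀ i (l : Fin q), l.val < i → |f (i - l.val)| ≤ r (i - l.val) * coef u (i - l.val) →
      |b i l| ≤ r (i - l.val + 1) * (u (Sum.inr l) * coef u (i - l.val))) (i : ℕ) :
    |f (i + 1)| ≤ r (i + 1) * coef u (i + 1) := by
  induction i using Nat.strong_induction_on with
  | _ i ih =>
    rw [coef_succ, hf, mul_add, Finset.mul_sum]
    refine (abs_add_le _ _).trans (add_le_add ((ha i).trans ?_)
      ((Finset.abs_sum_le_sum_abs _ _).trans (Finset.sum_le_sum fun l _ => ?_)))
    · refine mul_le_mul_of_nonneg_right (hr (by omega)) ?_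
      split_ifs
      exacts [hu _, le_rfl]
    · split_ifs with hl
      · obtain ⟨m, hm⟩ : ∃ m, i - l.val = m + 1 := ⟨i - l.val - 1, by omega⟩
        have h1 := hb i l hl
        rw [hm] at h1 ⊢
        refine (h1 (ih m (by omega))).trans (mul_le_mul_of_nonneg_right (hr (by omega)) ?_)
        exact mul_nonneg (hu _) (coef_nonneg hu _)
      · simp

/-- A monomial of degree at most `i` has relative differential at most `i d` when each variable
moves by a relative amount `d`; nonnegative coefficients let the bound pass to `c_i`. -/
theorem abs_coefLin_le {u h : Param p q} (hu : ∀ j, 0 ≤ u j) {d : ℝ} (hd : 0 ≤ d)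
    (hh : ∀ j, |h j| ≤ d * u j) (i : ℕ) :
    |coefLin u h (i + 1)| ≤ (((i + 1 : ℕ) : ℝ) * d) * coef u (i + 1) := by
  refine abs_le_of_recursion hu (r := fun i => (i : ℝ) * d)
    (fun a b hab => by dsimp only; gcongr) (coefLin_succ u h) (fun i => ?_) ?_ i
  · split_ifs with hi
    · simpa using hh _
    · simp
  · intro i l hl ih
    refine (abs_add_le _ _).trans ?_
    obtain ⟨m, hm⟩ : ∃ m, i - l.val = m + 1 := ⟨i - l.val - 1, by omega⟩
    rw [hm] at ih ⊢
    have hc := coef_nonneg hu m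
    rw [abs_mul, abs_mul, abs_of_nonneg hc, abs_of_nonneg (hu _)]
    have h1 := mul_le_mul_of_nonneg_right (hh (Sum.inr l)) hc
    have h2 := mul_le_mul_of_nonneg_left ih (hu (Sum.inr l))
    push_cast at h2 ⊢
    nlinarith

/-- A monomial of degree at most `i` is multiplied by at most `(1 + d)^i` under the perturbation. -/
theorem abs_coef_sub_le {u h : Param p q} (hu : ∀ j, 0 ≤ u j) {d : ℝ} (hd : 0 ≤ d)
    (hh : ∀ j, |h j| ≤ d * u j) (i : ℕ) :
    |coef (u + h) (i + 1) - coef u (i + 1)| ≤ ((1 + d) ^ (i + 1) - 1) * coef u (i + 1) := by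
  refine abs_le_of_recursion hu (r := fun i => (1 + d) ^ i - 1)
    (f := fun i => coef (u + h) i - coef u i)
    (a := fun i => if hi : i + 1 < p + 1 then h (Sum.inl ⟨i + 1, hi⟩) else 0)
    (b := fun i l => h (Sum.inr l) * coef u (i - l.val) +
      (u + h) (Sum.inr l) * (coef (u + h) (i - l.val) - coef u (i - l.val)))
    (fun a b hab => by dsimp only; gcongr; linarith) (fun i => ?_) (fun i => ?_) ?_ i
  · rw [coef_succ, coef_succ, add_sub_add_comm, ← Finset.sum_sub_distrib]
    congr 1
    · split_ifs <;> simp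
    · refine Finset.sum_congr rfl fun l _ => ?_
      split_ifs
      · simp; ring
      · simp
  · split_ifs with hi
    · simpa using hh _
    · simp
  · intro i l hl ih
    refine (abs_add_le _ _).trans ?_
    obtain ⟨m, hm⟩ : ∃ m, i - l.val = m + 1 := ⟨i - l.val - 1, by omega⟩
    rw [hm] at ih ⊢
    have hc := coef_nonneg hu m
    rw [abs_mul, abs_mul, abs_of_nonneg hc]
    have h1 := mul_le_mul_of_nonneg_right (hh (Sum.inr l)) hc
    have h3 : |(u + h) (Sum.inr l)| ≤ (1 + d) * u (Sum.inr l) := by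
      refine (abs_add_le _ _).trans ?_
      rw [abs_of_nonneg (hu _)]
      linarith [hh (Sum.inr l)]
    have h2 := mul_le_mul h3 ih (abs_nonneg _) (mul_nonneg (by linarith) (hu _))
    refine (add_le_add h1 h2).trans (le_of_eq ?_)
    ring

/-- The same comparison with the extremal monomial, now for the second order Taylor remainder of `(1
+ d)^i`. -/
theorem abs_coef_sub_sub_coefLin_le {u h : Param p q} (hu : ∀ j, 0 ≤ u j) {d : ℝ} (hd : 0 ≤ d)
    (hh : ∀ j, |h j| ≤ d * u j) (i : ℕ) :
    |coef (u + h) (i + 1) - coef u (i + 1) - coefLin u h (i + 1)| ≤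
      ((1 + d) ^ (i + 1) - 1 - ((i + 1 : ℕ) : ℝ) * d) * coef u (i + 1) := by
  refine abs_le_of_recursion hu (r := fun i => (1 + d) ^ i - 1 - (i : ℝ) * d)
    (f := fun i => coef (u + h) i - coef u i - coefLin u h i)
    -- The term `s_i` is linear and leaves no remainder; the product `t_j c_{i-j}` leaves the
    -- increment of one factor times that of the other, plus the inherited remainder.
    (a := fun i => 0)
    (b := fun i l => h (Sum.inr l) * (coef (u + h) (i - l.val) - coef u (i - l.val)) +
      u (Sum.inr l) * (coef (u + h) (i - l.val) - coef u (i - l.val) - coefLin u h (i - l.val)))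
    (monotone_nat_of_le_succ fun n => ?_) (fun i => ?_) (fun i => ?_) ?_ i
  · push_cast
    have := one_le_pow₀ (n := n) (show 1 ≤ 1 + d by linarith)
    rw [pow_succ]
    nlinarith
  · rw [coef_succ, coef_succ, coefLin_succ, add_sub_add_comm, add_sub_add_comm,
      ← Finset.sum_sub_distrib, ← Finset.sum_sub_distrib]
    congr 1
    · split_ifs <;> simp
    · refine Finset.sum_congr rfl fun l _ => ?_
      split_ifs
      · simp; ring
      · simp
  · simp
  · intro i l hl ih
    refine (abs_add_le _ _).trans ?_
    obtain ⟨m, hm⟩ : ∃ m, i - l.val = m + 1 := ⟨i - l.val - 1, by omega⟩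
    rw [hm] at ih ⊢
    rw [abs_mul, abs_mul, abs_of_nonneg (hu _)]
    have hdu := mul_nonneg hd (hu (Sum.inr l))
    have h1 := mul_le_mul (hh (Sum.inr l)) (abs_coef_sub_le hu hd hh m) (abs_nonneg _) hdu
    have h2 := mul_le_mul_of_nonneg_left ih (hu (Sum.inr l))
    refine (add_le_add h1 h2).trans (le_of_eq ?_)
    push_cast
    ring

theorem pow_mul_coef_le {u v : Param p q} (hu : ∀ j, 0 ≤ u j) {d : ℝ} (hd : 0 ≤ d) (hd1 : d ≤ 1)
    (hv : ∀ j, (1 - d) * u j ≤ v j) (i : ℕ) :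
    (1 - d) ^ (i + 1) * coef u (i + 1) ≤ coef v (i + 1) := by
  have h0 : 0 ≤ 1 - d := by linarith
  have h1 : 1 - d ≤ 1 := by linarith
  induction i using Nat.strong_induction_on with
  | _ i ih =>
    rw [coef_succ, coef_succ, mul_add, Finset.mul_sum]
    refine add_le_add ?_ (Finset.sum_le_sum fun l _ => ?_)
    · split_ifs with hi
      · refine le_trans (mul_le_mul_of_nonneg_right ?_ (hu _)) (hv _)
        simpa using pow_le_pow_of_le_one h0 h1 (show 1 ≤ i + 1 by omega)
      · simp
    · split_ifs with hl
      · obtain ⟨m, hm⟩ : ∃ m, i - l.val = m + 1 := ⟨i - l.val - 1, by omega⟩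
        rw [hm]
        have h2 := mul_le_mul (hv (Sum.inr l)) (ih m (by omega))
          (mul_nonneg (pow_nonneg h0 _) (coef_nonneg hu _)) ((mul_nonneg h0 (hu _)).trans (hv _))
        refine le_trans ?_ h2
        rw [show (1 - d) * u (Sum.inr l) * ((1 - d) ^ (m + 1) * coef u (m + 1)) =
          (1 - d) ^ (m + 2) * (u (Sum.inr l) * coef u (m + 1)) by ring]
        exact mul_le_mul_of_nonneg_right (pow_le_pow_of_le_one h0 h1 (by omega))
          (mul_nonneg (hu _) (coef_nonneg hu _))
      · simp

/-- A rate `ρ < 1` for which `∑ t_j ρ^{-j} < 1`. -/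
theorem exists_rate {u : Param p q} (hu : ∀ j, 0 ≤ u j)
    (h1 : ∑ j : Fin q, u (Sum.inr j) < 1) :
    ∃ ρ : ℝ, 0 < ρ ∧ ρ < 1 ∧ ∃ τ : ℝ, 0 ≤ τ ∧ τ < 1 ∧
      ∑ j : Fin q, u (Sum.inr j) * (ρ ^ (j.val + 1))⁻¹ ≤ τ := by
  set S := ∑ j : Fin q, u (Sum.inr j)
  -- At `ρ = 1` the sum is `S < 1`, so slightly to the left of `1` it stays below the midpoint `(S +
  -- 1) / 2`.
  have hcont : Tendsto (fun ρ : ℝ => ∑ j : Fin q, u (Sum.inr j) * (ρ ^ (j.val + 1))⁻¹)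
      (nhdsWithin 1 (Set.Iio 1)) (nhds S) := by
    have : ContinuousAt (fun ρ : ℝ => ∑ j : Fin q, u (Sum.inr j) * (ρ ^ (j.val + 1))⁻¹) 1 := by
      refine tendsto_finsetSum _ fun j _ => ?_
      refine ContinuousAt.mul continuousAt_const ?_
      exact ContinuousAt.inv₀ (by fun_prop) (by simp)
    have h := this.tendsto
    simp only [one_pow, inv_one, mul_one] at h
    exact h.mono_left nhdsWithin_le_nhds
  have hS : 0 ≤ S := Finset.sum_nonneg fun j _ => hu _
  have e1 := hcont.eventually (gt_mem_nhds (show S < (S + 1) / 2 by linarith))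
  have e2 : ∀ᶠ ρ : ℝ in nhdsWithin 1 (Set.Iio 1), 0 < ρ :=
    nhdsWithin_le_nhds (lt_mem_nhds one_pos)
  have e3 : ∀ᶠ ρ : ℝ in nhdsWithin 1 (Set.Iio 1), ρ < 1 := self_mem_nhdsWithin
  obtain ⟨ρ, ha, hb, hc⟩ := (e1.and (e2.and e3)).exists
  exact ⟨ρ, hb, hc, (S + 1) / 2, by linarith, by linarith, ha.le⟩

/-- Inserting `K ρ^i` into the recursion returns at most `(K₀ + K τ) ρ^i`, so the bound propagates
once `K₀ + K τ ≤ K`. -/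
theorem exists_coef_le {u : Param p q} (hu : ∀ j, 0 ≤ u j)
    {ρ τ : ℝ} (hρ : 0 < ρ) (hτ : τ < 1)
    (h1 : ∑ j : Fin q, u (Sum.inr j) * (ρ ^ (j.val + 1))⁻¹ ≤ τ) :
    ∃ K : ℝ, 0 < K ∧ ∀ i, coef u (i + 1) ≤ K * ρ ^ (i + 1) := by
  obtain ⟨K₀, hK₀⟩ : ∃ K₀ : ℝ, ∀ i : Fin (p + 1), u (Sum.inl i) * (ρ ^ i.val)⁻¹ ≤ K₀ := by
    refine ⟨∑ i : Fin (p + 1), u (Sum.inl i) * (ρ ^ i.val)⁻¹, fun i => ?_⟩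
    exact Finset.single_le_sum (f := fun i : Fin (p + 1) => u (Sum.inl i) * (ρ ^ i.val)⁻¹)
      (fun i _ => mul_nonneg (hu _) (by positivity)) (Finset.mem_univ i)
  have hτ' : 0 < 1 - τ := by linarith
  have hK₀' : 0 ≤ K₀ := le_trans (mul_nonneg (hu _) (by positivity)) (hK₀ 0)
  -- `K₀ / (1 - τ)` would solve the fixed point inequality; the extra `1` makes the constant
  -- strictly positive.
  refine ⟨(K₀ + 1) / (1 - τ), by positivity, fun i => ?_⟩
  set K := (K₀ + 1) / (1 - τ) with hK
  have hKτ : K₀ + K * τ ≤ K := by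
    have : K * (1 - τ) = K₀ + 1 := by rw [hK]; field_simp
    linarith
  have hK0 : 0 ≤ K := by positivity
  induction i using Nat.strong_induction_on with
  | _ i ih =>
    rw [coef_succ]
    have e1 : (if h : i + 1 < p + 1 then u (Sum.inl ⟨i + 1, h⟩) else 0) ≤ K₀ * ρ ^ (i + 1) := by
      split_ifs with hi
      · have := hK₀ ⟨i + 1, hi⟩
        rwa [← div_eq_mul_inv, div_le_iff₀ (by positivity)] at this
      · positivity
    have e2 : (∑ l : Fin q, if l.val < i then u (Sum.inr l) * coef u (i - l.val) else 0) ≤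
        ∑ l : Fin q, (u (Sum.inr l) * (ρ ^ (l.val + 1))⁻¹) * (K * ρ ^ (i + 1)) := by
      refine Finset.sum_le_sum fun l _ => ?_
      split_ifs with hl
      · obtain ⟨m, hm⟩ : ∃ m, i - l.val = m + 1 := ⟨i - l.val - 1, by omega⟩
        rw [hm]
        refine (mul_le_mul_of_nonneg_left (ih m (by omega)) (hu _)).trans (le_of_eq ?_)
        rw [show i + 1 = (l.val + 1) + (m + 1) by omega, pow_add]
        field_simp
        ring
      · exact mul_nonneg (mul_nonneg (hu _) (by positivity)) (by positivity)
    rw [← Finset.sum_mul] at e2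
    have e3 := mul_le_mul_of_nonneg_right h1 (show 0 ≤ K * ρ ^ (i + 1) by positivity)
    have e4 := mul_le_mul_of_nonneg_right hKτ (show 0 ≤ ρ ^ (i + 1) by positivity)
    nlinarith

end Coefficients

/-! ### Elementary inequalities for powers and for ratios of sums. -/

section ScalarBounds

/-- The quotient `((1 + x)^i - 1) / x` increases in `x`. This extracts the factor `d` and leaves a
growth rate `1 + D` that is fixed in advance. -/
theorem one_add_pow_sub_one_le {d D : ℝ} (hd : 0 ≤ d) (hD : 0 < D) (h : d ≤ D) (i : ℕ) :
    (1 + d) ^ i - 1 ≤ d / D * ((1 + D) ^ i - 1) := by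
  have hdD : 0 ≤ d / D := by positivity
  induction i with
  | zero => simp
  | succ i ih =>
    have h1 : (1:ℝ) ≤ (1 + D) ^ i := one_le_pow₀ (by linarith)
    have h2 : d / D * D = d := by field_simp
    have h3 := mul_le_mul ih (show 1 + d ≤ 1 + D by linarith) (by linarith)
      (mul_nonneg hdD (by linarith))
    rw [pow_succ, pow_succ]
    nlinarith

/-- The second order analogue: the quotient of the Taylor remainder by `x²` increases in `x`. -/
theorem one_add_pow_sub_linear_le {d D : ℝ} (hd : 0 ≤ d) (hD : 0 < D) (h : d ≤ D) (i : ℕ) :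
    (1 + d) ^ i - 1 - i * d ≤ (d / D) ^ 2 * ((1 + D) ^ i - 1 - i * D) := by
  induction i with
  | zero => simp
  | succ i ih =>
    have h1 := mul_le_mul_of_nonneg_left (one_add_pow_sub_one_le hd hD h i) hd
    have h2 : d * (d / D * ((1 + D) ^ i - 1)) = (d / D) ^ 2 * (D * ((1 + D) ^ i - 1)) := by
      field_simp
    rw [h2] at h1
    have h3 : (1 + d) ^ (i + 1) - 1 - ((i + 1 : ℕ) : ℝ) * d =
        ((1 + d) ^ i - 1 - i * d) + d * ((1 + d) ^ i - 1) := by push_cast; ring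
    have h4 : (1 + D) ^ (i + 1) - 1 - ((i + 1 : ℕ) : ℝ) * D =
        ((1 + D) ^ i - 1 - i * D) + D * ((1 + D) ^ i - 1) := by push_cast; ring
    rw [h3, h4, mul_add]
    exact add_le_add ih h1

theorem abs_pow_sub_linear_le {y : ℝ} (hy : 0 < y) (k : ℕ) :
    |y ^ k - 1 - k * (y - 1)| ≤ (k : ℝ) ^ 2 * ((y - 1) ^ 2 * (1 + y) ^ k) := by
  induction k with
  | zero => simp
  | succ k ih =>
    have h1 : y ^ (k + 1) - 1 - ((k + 1 : ℕ) : ℝ) * (y - 1) =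
        y * (y ^ k - 1 - k * (y - 1)) + k * (y - 1) ^ 2 := by push_cast; ring
    rw [h1]
    refine (abs_add_le _ _).trans ?_
    rw [abs_mul, abs_of_pos hy, abs_of_nonneg (show 0 ≤ (k : ℝ) * (y - 1) ^ 2 by positivity)]
    have h2 := mul_le_mul_of_nonneg_left ih hy.le
    have h3 : (1:ℝ) ≤ (1 + y) ^ k := one_le_pow₀ (by linarith)
    have h4 : (1:ℝ) ≤ (1 + y) ^ (k + 1) := one_le_pow₀ (by linarith)
    have hk : (0:ℝ) ≤ k := by positivity
    have hs := sq_nonneg (y - 1)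
    calc _ ≤ y * ((k : ℝ) ^ 2 * ((y - 1) ^ 2 * (1 + y) ^ k)) + k * (y - 1) ^ 2 := by linarith
      _ ≤ (k : ℝ) ^ 2 * ((y - 1) ^ 2 * (1 + y) ^ (k + 1)) + k * ((y - 1) ^ 2 * (1 + y) ^ (k + 1)) := by
          refine add_le_add ?_ ?_
          · rw [pow_succ (1 + y)]
            have : 0 ≤ (k : ℝ) ^ 2 * ((y - 1) ^ 2 * (1 + y) ^ k) := by positivity
            nlinarith
          · exact mul_le_mul_of_nonneg_left (le_mul_of_one_le_right hs h4) hk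
      _ ≤ _ := by
          have : 0 ≤ (y - 1) ^ 2 * (1 + y) ^ (k + 1) := by positivity
          push_cast
          nlinarith

/-- Second order expansion of `x ↦ x^{-k/2}` at `1`, in terms of `y = x^{-1/2}`. -/
theorem abs_pow_sub_expansion_le {y : ℝ} (hy : 0 < y) (k : ℕ) :
    |y ^ k - 1 + k / 2 * ((y ^ 2)⁻¹ - 1)| ≤
      2 * (k : ℝ) ^ 2 * 2 ^ (k + 2) * (((y ^ 2)⁻¹ - 1) ^ 2 * (1 + y ^ 2) ^ (k + 2)) := by
  have hk : (0:ℝ) ≤ k := by positivity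
  have hk2 : (k : ℝ) ≤ (k : ℝ) ^ 2 := by
    rcases Nat.eq_zero_or_pos k with h | h
    · simp [h]
    · have : (1:ℝ) ≤ k := by exact_mod_cast h
      nlinarith
  -- With `x = y⁻²` one has `x - 1 = (1 - y)(1 + y) / y²`. The next identity shows that `y - 1` and
  -- `-(x - 1) / 2` differ only to second order, so the expansion of `y^k` at `1` becomes one in `x
  -- - 1`.
  have e1 : (y - 1) ^ 2 = ((y ^ 2)⁻¹ - 1) ^ 2 * (y ^ 4 / (1 + y) ^ 2) := by
    field_simp
    ring
  have e2 : y - 1 + ((y ^ 2)⁻¹ - 1) / 2 = (y - 1) ^ 2 * ((2 * y + 1) / (2 * y ^ 2)) := by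
    field_simp
    ring
  have e3 : y ^ k - 1 + k / 2 * ((y ^ 2)⁻¹ - 1) =
      (y ^ k - 1 - k * (y - 1)) + k * ((y - 1) ^ 2 * ((2 * y + 1) / (2 * y ^ 2))) := by
    rw [← e2]; ring
  rw [e3]
  refine (abs_add_le _ _).trans ?_
  rw [abs_of_nonneg (show 0 ≤ (k : ℝ) * ((y - 1) ^ 2 * ((2 * y + 1) / (2 * y ^ 2))) by positivity)]
  set E := ((y ^ 2)⁻¹ - 1) ^ 2 with hE
  have hE0 : 0 ≤ E := sq_nonneg _
  have h1 : (y - 1) ^ 2 * (1 + y) ^ k ≤ E * (1 + y) ^ (k + 2) := by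
    rw [e1, mul_assoc]
    refine mul_le_mul_of_nonneg_left ?_ hE0
    have : y ^ 4 / (1 + y) ^ 2 ≤ (1 + y) ^ 2 := by
      rw [div_le_iff₀ (by positivity), ← pow_add]
      exact pow_le_pow_left₀ hy.le (by linarith) 4
    calc _ ≤ (1 + y) ^ 2 * (1 + y) ^ k := mul_le_mul_of_nonneg_right this (by positivity)
      _ = _ := by ring
  have h2 : (y - 1) ^ 2 * ((2 * y + 1) / (2 * y ^ 2)) ≤ E * (1 + y) ^ (k + 2) := by
    rw [e1, mul_assoc]
    refine mul_le_mul_of_nonneg_left ?_ hE0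
    have h3 : (1 + y) ^ 2 ≤ (1 + y) ^ (k + 2) := pow_le_pow_right₀ (by linarith) (by omega)
    refine le_trans ?_ h3
    rw [div_mul_div_comm, div_le_iff₀ (by positivity)]
    have : 0 ≤ y ^ 2 := by positivity
    have hh : (1 + y) ^ 4 ≥ y ^ 2 * (2 * y + 1) := by
      have : (1 + y) ^ 4 = y ^ 4 + 4 * y ^ 3 + 6 * y ^ 2 + 4 * y + 1 := by ring
      rw [this]
      have : y ^ 2 * (2 * y + 1) = 2 * y ^ 3 + y ^ 2 := by ring
      rw [this]
      have := pow_pos hy 3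
      have := pow_pos hy 2
      have := pow_pos hy 4
      nlinarith
    have h5 : (1 + y) ^ 2 * ((1 + y) ^ 2 * (2 * y ^ 2)) = (1 + y) ^ 4 * (2 * y ^ 2) := by ring
    have h6 : y ^ 4 * (2 * y + 1) = (y ^ 2 * (2 * y + 1)) * y ^ 2 := by ring
    rw [h5, h6]
    have := mul_le_mul_of_nonneg_right hh.le this
    have : 0 ≤ (1 + y) ^ 4 * y ^ 2 := by positivity
    linarith
  have h3 : (1 + y) ^ (k + 2) ≤ 2 ^ (k + 2) * (1 + y ^ 2) ^ (k + 2) := by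
    rw [← mul_pow]
    refine pow_le_pow_left₀ (by linarith) ?_ _
    nlinarith [sq_nonneg (y - 1)]
  have h4 := mul_le_mul_of_nonneg_left h3 hE0
  have h5 := abs_pow_sub_linear_le hy k
  have h6 := mul_le_mul_of_nonneg_left h1 (sq_nonneg (k : ℝ))
  have h7 := mul_le_mul_of_nonneg_left h2 hk
  have h8 : (k : ℝ) * (E * (1 + y) ^ (k + 2)) ≤ (k : ℝ) ^ 2 * (E * (1 + y) ^ (k + 2)) :=
    mul_le_mul_of_nonneg_right hk2 (by positivity)
  have h9 := mul_le_mul_of_nonneg_left h4 (sq_nonneg (k : ℝ))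
  calc _ ≤ 2 * ((k : ℝ) ^ 2 * (E * (1 + y) ^ (k + 2))) := by linarith
    _ ≤ 2 * ((k : ℝ) ^ 2 * (E * (2 ^ (k + 2) * (1 + y ^ 2) ^ (k + 2)))) := by linarith
    _ = _ := by ring

/-- A number in `[0, 1]` does not decrease when raised to a power `s ≤ 1`, after which `S` may be
replaced by its lower bound. This trades the summand for a small power of it. -/
theorem div_le_rpow_div {a b S s : ℝ} (ha : 0 ≤ a) (hb : 0 < b) (haS : a ≤ S) (hbS : b ≤ S)
    (hs : 0 ≤ s) (hs1 : s ≤ 1) : a / S ≤ (a / b) ^ s := by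
  have hS : 0 < S := hb.trans_le hbS
  have h1 : a / S ≤ 1 := (div_le_one hS).2 haS
  have h0 : 0 ≤ a / S := by positivity
  calc a / S = (a / S) ^ (1:ℝ) := (Real.rpow_one _).symm
    _ ≤ (a / S) ^ s := Real.rpow_le_rpow_of_exponent_ge_of_imp h0 h1 hs1 (by simp)
    _ ≤ (a / b) ^ s := Real.rpow_le_rpow h0 (div_le_div_of_nonneg_left ha hb hbS) hs

/-- A term `c x` of a sum bounded below by `b` is, relative to this sum, at most of the order
`g^{4i}` times a small power of `∑ g^{4Mi} x_i^e`. -/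
theorem div_le_geometric {K b g ρ e Z x c S w : ℝ} {M i : ℕ} (hM : 1 ≤ M) (he : 0 < e)
    (he1 : e ≤ 1) (hg : 0 < g) (hρ : 0 < ρ) (hgρ : ρ ^ e = g ^ (8 * M))
    (hK : 0 < K) (hb : 0 < b) (hx : 0 ≤ x) (hc : 0 ≤ c) (hw : 0 < w) (hw1 : w ≤ 1)
    (hcK : w * c ≤ K * ρ ^ i) (hS : c * x ≤ S) (hbS : b ≤ S)
    (hZ : (g ^ (4 * M)) ^ i * x ^ e ≤ Z) :
    w * (c * x) ≤ S * ((K / b) ^ (e / M) * Z ^ (1 / (M : ℝ)) * (g ^ i) ^ 4) := by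
  have hM0 : (0:ℝ) < M := by exact_mod_cast hM
  have hM1 : (1:ℝ) ≤ M := by exact_mod_cast hM
  have hs0 : 0 ≤ e / M := by positivity
  have hs1 : e / M ≤ 1 := by rw [div_le_one hM0]; linarith
  have hSp : 0 < S := hb.trans_le hbS
  have h1 := div_le_rpow_div (mul_nonneg hc hx) hb hS hbS hs0 hs1
  have h2 : c * x / b ≤ w⁻¹ * (K / b * (ρ ^ i * x)) := by
    have : c ≤ w⁻¹ * (K * ρ ^ i) := by
      rw [← div_eq_inv_mul, le_div_iff₀ hw]; linarith
    calc c * x / b ≤ w⁻¹ * (K * ρ ^ i) * x / b := by gcongr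
      _ = _ := by ring
  have h3 : (c * x / b) ^ (e / M) ≤ (w⁻¹ * (K / b * (ρ ^ i * x))) ^ (e / (M:ℝ)) :=
    Real.rpow_le_rpow (by positivity) h2 hs0
  rw [Real.mul_rpow (by positivity) (by positivity), Real.mul_rpow (by positivity) (by positivity)]
    at h3
  have h4 : w⁻¹ ^ (e / (M:ℝ)) ≤ w⁻¹ := by
    have := Real.rpow_le_rpow_of_exponent_le (one_le_inv_iff₀.2 ⟨hw, hw1⟩) hs1
    rwa [Real.rpow_one] at this
  have h5 : (ρ ^ i * x) ^ (e / (M:ℝ)) ≤ (g ^ i) ^ 4 * Z ^ (1 / (M:ℝ)) := by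
    rw [div_eq_mul_one_div, Real.rpow_mul (by positivity), Real.mul_rpow (by positivity) hx,
      ← Real.rpow_natCast ρ i, ← Real.rpow_mul hρ.le, mul_comm (i:ℝ) e, Real.rpow_mul hρ.le,
      hgρ, Real.rpow_natCast]
    -- Half of the decay stays outside as `(g^i)^4`, to be spent against weights later; the other
    -- half is the weight of the moving sum that `Z` bounds.
    have e1 : (g ^ (8 * M)) ^ i * x ^ e = ((g ^ i) ^ 4) ^ M * ((g ^ (4 * M)) ^ i * x ^ e) := by
      rw [← mul_assoc, ← pow_mul, ← pow_mul, ← pow_mul, ← pow_mul, ← pow_add]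
      congr 2; ring
    rw [e1, Real.mul_rpow (by positivity) (by positivity)]
    have e2 : (((g ^ i) ^ 4) ^ M) ^ (1 / (M:ℝ)) = (g ^ i) ^ 4 := by
      rw [one_div]
      exact Real.pow_rpow_inv_natCast (by positivity) (by omega)
    rw [e2]
    gcongr
  have h6 : c * x / S ≤ w⁻¹ * ((K / b) ^ (e / (M:ℝ)) * ((g ^ i) ^ 4 * Z ^ (1 / (M:ℝ)))) := by
    refine h1.trans (h3.trans ?_)
    gcongr
  rw [div_le_iff₀ hSp, ← div_eq_inv_mul, div_mul_eq_mul_div, le_div_iff₀ hw] at h6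
  linarith

theorem sum_range_geom_le {g : ℝ} (hg : 0 < g) (hg1 : g < 1) (t : ℕ) :
    ∑ i ∈ Finset.range t, g ^ (i + 1) ≤ (1 - g)⁻¹ := by
  calc ∑ i ∈ Finset.range t, g ^ (i + 1) ≤ ∑ i ∈ Finset.range t, g ^ i :=
        Finset.sum_le_sum fun i _ => pow_le_pow_of_le_one hg.le hg1.le (by omega)
    _ ≤ ∑' i, g ^ i := (summable_geometric_of_lt_one hg.le hg1).sum_le_tsum _
        (fun i _ => by positivity)
    _ = _ := tsum_geometric_of_lt_one hg.le hg1

end ScalarBounds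

/-! ### Expansion of the volatility ratio along one trajectory, for abstract coefficients. -/

section Expansion

/-- The sum of a sequence dominated by `A g^(i+1)`, from the index `t` on. -/
theorem abs_tsum_tail_le {f : ℕ → ℝ} {A g : ℝ} (hg : 0 < g) (hg1 : g < 1)
    (hf : ∀ i, |f i| ≤ A * g ^ (i + 1)) (t : ℕ) :
    Summable f ∧ |∑' i, f (i + t)| ≤ A * (1 - g)⁻¹ * g ^ t := by
  have hs : Summable fun i => A * g ^ (i + 1) :=
    (((summable_geometric_of_lt_one hg.le hg1).comp_injective (add_left_injective 1))).mul_left A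
  have hA : 0 ≤ A := by
    have := (abs_nonneg _).trans (hf 0)
    simpa using nonneg_of_mul_nonneg_left this (by positivity)
  have hsum := (hasSum_geometric_of_lt_one hg.le hg1).mul_left (A * g ^ t)
  refine ⟨Summable.of_norm_bounded hs hf, ?_⟩
  have := tsum_of_norm_bounded (f := fun i => f (i + t)) hsum (fun i => (hf (i + t)).trans ?_)
  · rw [Real.norm_eq_abs] at this
    linarith
  · rw [mul_assoc, ← pow_add]
    exact mul_le_mul_of_nonneg_left (pow_le_pow_of_le_one hg.le hg1.le (by omega)) hA

/-- Turns an absolute bound into one relative to the volatility, which is bounded below by `c₀`. -/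
theorem le_div_mul_mul {A c₀ v ζ : ℝ} (hA : 0 ≤ A) (hc₀ : 0 < c₀) (hv : c₀ ≤ v) (hζ : 1 ≤ ζ) :
    A ≤ A / c₀ * v * ζ := by
  have h1 : A ≤ A / c₀ * v := by
    rw [div_mul_eq_mul_div, le_div_iff₀ hc₀]
    exact mul_le_mul_of_nonneg_left hv hA
  have : 0 ≤ A / c₀ * v := mul_nonneg (div_nonneg hA hc₀.le) (hc₀.le.trans hv)
  exact h1.trans (le_mul_of_one_le_right this hζ)

/-- `e₀` is the increment of the constant term, `F` that of the coefficients kept by the truncation,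
`T` the part of the series that the truncation drops, and `r` stands for `g^t`. Each is small
relative to `v`. -/
theorem abs_ratio_sub_one_le {B C₁ G c₀ v v' d ζ e₀ F T r : ℝ} (hc₀ : 0 < c₀) (hB : 0 ≤ B)
    (hC₁ : 0 ≤ C₁) (hG : 0 ≤ G) (hv : c₀ ≤ v) (hd : 0 ≤ d) (hζ : 1 ≤ ζ) (hT0 : 0 ≤ T)
    (hr : 0 ≤ r) (hΔ : v' - v = e₀ + F - T) (h₀ : |e₀| ≤ C₁ * d)
    (hF : |F| ≤ C₁ * d * (v * (B * ζ)) * G) (hT : T ≤ 1 * (v * (B * ζ)) * G * r) :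
    |v' / v - 1| ≤ (C₁ / c₀ + C₁ * B * G + B * G) * (d + r) * ζ := by
  have hvp : 0 < v := by linarith
  have hζ0 : 0 ≤ ζ := by linarith
  rw [div_sub_one hvp.ne', abs_div, abs_of_pos hvp, div_le_iff₀ hvp, hΔ]
  have h1 := le_div_mul_mul (mul_nonneg hC₁ hd) hc₀ hv hζ
  have h2 : |e₀ + F - T| ≤ |e₀| + |F| + T := by
    refine (abs_sub _ _).trans ?_
    rw [abs_of_nonneg hT0]
    linarith [abs_add_le e₀ F]
  have e : (C₁ / c₀ + C₁ * B * G + B * G) * (d + r) * ζ * v =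
      C₁ * d / c₀ * v * ζ + C₁ * d * (v * (B * ζ)) * G +
      1 * (v * (B * ζ)) * G * r + (C₁ / c₀ * r * v * ζ + C₁ * B * G * r * v * ζ +
      B * G * d * v * ζ) := by ring
  rw [e]
  have : 0 ≤ (C₁ / c₀ * r * v * ζ + C₁ * B * G * r * v * ζ + B * G * d * v * ζ) := by
    positivity
  linarith

/-- Here `D` is the full differential, while `v'` sees a truncated sum; hence the additional tail
`TL` of the differential. The increments `e₀` and `F` are now of second order. -/
theorem abs_ratio_sub_linear_le {B C₁ G c₀ v v' d ζ e₀ F T TL D r : ℝ} (hc₀ : 0 < c₀)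
    (hB : 0 ≤ B) (hC₁ : 0 ≤ C₁) (hG : 0 ≤ G) (hv : c₀ ≤ v) (hd1 : d ≤ 1)
    (hζ : 1 ≤ ζ) (hT0 : 0 ≤ T) (hr : 0 ≤ r) (hΔ : v' - v - D = e₀ + F - T - TL)
    (h₀ : |e₀| ≤ C₁ * d ^ 2) (hF : |F| ≤ C₁ * d ^ 2 * (v * (B * ζ)) * G)
    (hT : T ≤ 1 * (v * (B * ζ)) * G * r) (hTL : |TL| ≤ C₁ * d * (v * (B * ζ)) * G * r) :
    |v' / v - 1 - D / v| ≤ (C₁ / c₀ + C₁ * B * G + (B * G + C₁ * B * G)) * (d ^ 2 + r) * ζ := by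
  have hvp : 0 < v := by linarith
  have hζ0 : 0 ≤ ζ := by linarith
  rw [div_sub_one hvp.ne', ← sub_div, abs_div, abs_of_pos hvp, div_le_iff₀ hvp, hΔ]
  have h1 := le_div_mul_mul (mul_nonneg hC₁ (sq_nonneg d)) hc₀ hv hζ
  have h2 : |e₀ + F - T - TL| ≤ |e₀| + |F| + T + |TL| := by
    refine (abs_sub _ _).trans ?_
    have := abs_sub (e₀ + F) T
    rw [abs_of_nonneg hT0] at this
    linarith [abs_add_le e₀ F]
  have h3 : C₁ * d * (v * (B * ζ)) * G * r ≤ C₁ * (v * (B * ζ)) * G * r := by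
    have : 0 ≤ C₁ * (v * (B * ζ)) * G * r := by positivity
    calc _ = (C₁ * (v * (B * ζ)) * G * r) * d := by ring
      _ ≤ _ := mul_le_of_le_one_right this hd1
  have e : (C₁ / c₀ + C₁ * B * G + (B * G + C₁ * B * G)) * (d ^ 2 + r) * ζ * v =
      C₁ * d ^ 2 / c₀ * v * ζ + C₁ * d ^ 2 * (v * (B * ζ)) * G +
      1 * (v * (B * ζ)) * G * r + C₁ * (v * (B * ζ)) * G * r +
      (C₁ / c₀ * r * v * ζ + C₁ * B * G * r * v * ζ +
      B * G * d ^ 2 * v * ζ + C₁ * B * G * d ^ 2 * v * ζ) := by ring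
  rw [e]
  have : 0 ≤ (C₁ / c₀ * r * v * ζ + C₁ * B * G * r * v * ζ +
      B * G * d ^ 2 * v * ζ + C₁ * B * G * d ^ 2 * v * ζ) := by
    positivity
  linarith

/-- The truncated `v'` controls the part `S` of `v` with the same indices, but not the dropped tail
`T`. The latter is compared with the lower bound `c₀ / 2` of `v'`, at the cost of the factor `1 +
W`. -/
theorem ratio_le_of_tail {B G c₀ v v' ζ W S T : ℝ} (hc₀ : 0 < c₀) (hB : 0 ≤ B) (hG : 0 ≤ G)
    (hv' : c₀ / 2 ≤ v') (hζ : 1 ≤ ζ) (hW : 0 ≤ W) (hv : v = c₀ + (S + T)) (hT : T ≤ W)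
    (hS : S ≤ v' * (B * ζ) * G) : v / v' ≤ (2 + B * G + 2 / c₀) * ((1 + W) * ζ) := by
  have hv'p : 0 < v' := by linarith
  have hζ0 : 0 ≤ ζ := by linarith
  rw [div_le_iff₀ hv'p]
  have h2 : W ≤ 2 / c₀ * W * v' := by
    rw [div_mul_eq_mul_div, div_mul_eq_mul_div, le_div_iff₀ hc₀]
    nlinarith
  have h3 : v ≤ (2 + B * G * ζ + 2 / c₀ * W) * v' := by
    rw [hv]
    nlinarith
  refine h3.trans (mul_le_mul_of_nonneg_right ?_ hv'p.le)
  have e : (2 + B * G + 2 / c₀) * ((1 + W) * ζ) =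
      2 + B * G * ζ + 2 / c₀ * W + (2 * ((1 + W) * ζ - 1) +
      B * G * W * ζ + 2 / c₀ * (ζ + W * (ζ - 1))) := by ring
  rw [e]
  have h4 : 0 ≤ (1 + W) * ζ - 1 := by nlinarith
  have h5 : 0 ≤ ζ - 1 := by linarith
  have : 0 ≤ (2 * ((1 + W) * ζ - 1) + B * G * W * ζ + 2 / c₀ * (ζ + W * (ζ - 1))) := by
    positivity
  linarith

/-- The exponent `k + 4` of `ζ` collects `2` from the squared deviation and `k + 2` from the power
of `1 + v / v'` in the second order expansion. -/
theorem abs_sqrt_ratio_pow_le (k : ℕ) {C₂ C₃ C₄ v v' d r ζ W D : ℝ} (hv : 0 < v) (hv' : 0 < v')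
    (hC₃ : 0 ≤ C₃) (hr : 0 ≤ r) (hr1 : r ≤ 1)
    (hζ : 1 ≤ ζ) (hW : 0 ≤ W)
    (hΔ : |v' / v - 1| ≤ C₂ * (d + r) * ζ) (hΔL : |v' / v - 1 - D| ≤ C₃ * (d ^ 2 + r) * ζ)
    (hR : v / v' ≤ C₄ * ((1 + W) * ζ)) :
    |Real.sqrt (v / v') ^ k - 1 + k / 2 * D| ≤
      (2 * (k:ℝ) ^ 2 * 2 ^ (k + 2) * (2 * C₂ ^ 2 * (1 + C₄) ^ (k + 2)) + k / 2 * C₃) *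
        ((1 + W) ^ (k + 2) * ζ ^ (k + 4) * (d ^ 2 + r)) := by
  have hζ0 : 0 ≤ ζ := by linarith
  have hy : 0 < Real.sqrt (v / v') := Real.sqrt_pos.2 (by positivity)
  have hy2 : Real.sqrt (v / v') ^ 2 = v / v' := Real.sq_sqrt (by positivity)
  have hexp := abs_pow_sub_expansion_le hy k
  rw [hy2, inv_div] at hexp
  have h1 : Real.sqrt (v / v') ^ k - 1 + k / 2 * D =
      (Real.sqrt (v / v') ^ k - 1 + k / 2 * (v' / v - 1)) -
      k / 2 * (v' / v - 1 - D) := by ring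
  rw [h1]
  refine (abs_sub _ _).trans ?_
  rw [abs_mul, abs_of_nonneg (show (0:ℝ) ≤ k / 2 by positivity)]
  have h2 : (v' / v - 1) ^ 2 ≤ 2 * C₂ ^ 2 * (d ^ 2 + r) * ζ ^ 2 := by
    rw [← sq_abs]
    refine (pow_le_pow_left₀ (abs_nonneg _) hΔ 2).trans ?_
    have : (d + r) ^ 2 ≤ 2 * (d ^ 2 + r) := by nlinarith [sq_nonneg (d - r)]
    calc _ = C₂ ^ 2 * ζ ^ 2 * (d + r) ^ 2 := by ring
      _ ≤ C₂ ^ 2 * ζ ^ 2 * (2 * (d ^ 2 + r)) := mul_le_mul_of_nonneg_left this (by positivity)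
      _ = _ := by ring
  have h3 : (1 + v / v') ^ (k + 2) ≤ (1 + C₄) ^ (k + 2) * (1 + W) ^ (k + 2) * ζ ^ (k + 2) := by
    rw [← mul_pow, ← mul_pow]
    refine pow_le_pow_left₀ (by positivity) ?_ _
    have : 1 ≤ (1 + W) * ζ := by nlinarith
    calc _ ≤ (1 + W) * ζ + C₄ * ((1 + W) * ζ) := add_le_add this hR
      _ = _ := by ring
  have h4 := mul_le_mul h2 h3 (by positivity) (by positivity)
  have h5 : ζ ≤ (1 + W) ^ (k + 2) * ζ ^ (k + 4) := by
    have e1 : ζ ≤ ζ ^ (k + 4) := le_self_pow₀ hζ (by omega)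
    have e2 : 1 ≤ (1 + W) ^ (k + 2) := one_le_pow₀ (by linarith)
    calc ζ ≤ ζ ^ (k + 4) := e1
      _ ≤ _ := le_mul_of_one_le_left (by positivity) e2
  calc _ ≤ 2 * (k:ℝ) ^ 2 * 2 ^ (k + 2) * (2 * C₂ ^ 2 * (d ^ 2 + r) * ζ ^ 2 *
        ((1 + C₄) ^ (k + 2) * (1 + W) ^ (k + 2) * ζ ^ (k + 2))) +
        k / 2 * (C₃ * (d ^ 2 + r) * ((1 + W) ^ (k + 2) * ζ ^ (k + 4))) := by
        refine add_le_add (hexp.trans (mul_le_mul_of_nonneg_left h4 (by positivity)))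
          (mul_le_mul_of_nonneg_left (hΔL.trans ?_) (by positivity))
        exact mul_le_mul_of_nonneg_left h5 (by positivity)
    _ = _ := by ring

/-- Expansion of the `k`th power of the ratio of volatilities along one trajectory. Here `a i`
stands for the squared observations, `(c₀, c)` for the coefficients at the true parameter,
`(c₀', c')` for those at a parameter at distance `d`, and `(L₀, L)` for the differential. -/
theorem ratio_expansion (k : ℕ) {c₀ g B C₁ : ℝ} (hc₀ : 0 < c₀) (hg : 0 < g) (hg1 : g < 1)
    (hB : 0 ≤ B) (hC₁ : 0 ≤ C₁) :
    ∃ C : ℝ, 0 ≤ C ∧ ∀ (c c' L a : ℕ → ℝ) (c₀' L₀ d ζ W v v' : ℝ) (t : ℕ),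
      0 ≤ d → d ≤ 1 → 1 ≤ ζ → 0 ≤ W → (∀ i, 0 ≤ a i) → (∀ i, 0 ≤ c i) → (∀ i, 0 ≤ c' i) →
      |c₀' - c₀| ≤ C₁ * d → |c₀' - c₀ - L₀| ≤ C₁ * d ^ 2 → c₀ / 2 ≤ c₀' →
      (∀ i, g ^ (i + 1) * |c' i - c i| ≤ C₁ * d * c i) →
      (∀ i, g ^ (i + 1) * |c' i - c i - L i| ≤ C₁ * d ^ 2 * c i) →
      (∀ i, g ^ (i + 1) * |L i| ≤ C₁ * d * c i) →
      (∀ i, g ^ (i + 1) * c i ≤ c' i) →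
      (Summable fun i => c i * a i) → v = c₀ + ∑' i, c i * a i →
      v' = c₀' + ∑ i ∈ Finset.range t, c' i * a i →
      (∀ i, c i * a i ≤ v * (B * ζ * (g ^ (i + 1)) ^ 4)) →
      (∀ i < t, g ^ (i + 1) * (c' i * a i) ≤ v' * (B * ζ * (g ^ (i + 1)) ^ 4)) →
      ∑' i, c (i + t) * a (i + t) ≤ W →
      0 < v' ∧ |Real.sqrt (v / v') ^ k - 1 + k / 2 * ((L₀ + ∑' i, L i * a i) / v)| ≤
        C * ((1 + W) ^ (k + 2) * ζ ^ (k + 4) * (d ^ 2 + g ^ t)) := by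
  set G := (1 - g)⁻¹ with hG
  have hG0 : 0 < G := by rw [hG]; exact inv_pos.2 (by linarith)
  set C₂ := C₁ / c₀ + C₁ * B * G + B * G with hC₂
  set C₃ := C₁ / c₀ + C₁ * B * G + (B * G + C₁ * B * G) with hC₃
  set C₄ := 2 + B * G + 2 / c₀ with hC₄
  have hC₃0 : 0 ≤ C₃ := by positivity
  refine ⟨2 * (k:ℝ) ^ 2 * 2 ^ (k + 2) * (2 * C₂ ^ 2 * (1 + C₄) ^ (k + 2)) + k / 2 * C₃,
    by positivity, ?_⟩
  intro c c' L a c₀' L₀ d ζ W v v' t hd hd1 hζ hW ha hc hc' h₀ h₀L h₀' hcc hccL hL hlow hsum hv hv'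
    hz hz' hT
  have hζ0 : 0 < ζ := by linarith
  have hca : ∀ i, 0 ≤ c i * a i := fun i => mul_nonneg (hc i) (ha i)
  have hv0 : c₀ ≤ v := by
    have : 0 ≤ ∑' i, c i * a i := tsum_nonneg hca
    linarith
  have hvp : 0 < v := by linarith
  have hv'0 : c₀ / 2 ≤ v' := by
    rw [hv']
    have := Finset.sum_nonneg fun i (_ : i ∈ Finset.range t) => mul_nonneg (hc' i) (ha i)
    linarith
  have hv'p : 0 < v' := by linarith
  refine ⟨hv'p, ?_⟩
  have hgi : ∀ i : ℕ, 0 < g ^ (i + 1) := fun i => by positivity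
  have hgi1 : ∀ i : ℕ, g ^ (i + 1) ≤ 1 := fun i => pow_le_one₀ hg.le hg1.le
  have hgt1 : g ^ t ≤ 1 := pow_le_one₀ hg.le hg1.le
  have hgt0 : 0 < g ^ t := by positivity
  -- Of the four powers of `g^(i+1)` in the bound for `c i * a i`, one pays for the weight in front
  -- of `f i`; enough remains for a convergent geometric series.
  have key : ∀ (f : ℕ → ℝ) (A : ℝ), 0 ≤ A → (∀ i, g ^ (i + 1) * |f i| ≤ A * c i) →
      ∀ i, |f i * a i| ≤ A * (v * (B * ζ)) * g ^ (i + 1) := by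
    intro f A hA hf i
    rw [abs_mul, abs_of_nonneg (ha i)]
    have h1 := mul_le_mul_of_nonneg_right (hf i) (ha i)
    have h2 := mul_le_mul_of_nonneg_left (hz i) hA
    have h3 : g ^ (i + 1) * (|f i| * a i) ≤ g ^ (i + 1) * (A * (v * (B * ζ)) * (g ^ (i + 1)) ^ 3) := by
      calc _ ≤ A * (v * (B * ζ * (g ^ (i + 1)) ^ 4)) := by linarith
        _ = _ := by ring
    refine (le_of_mul_le_mul_left h3 (hgi i)).trans ?_
    refine mul_le_mul_of_nonneg_left ?_ (by positivity)
    exact pow_le_of_le_one (hgi i).le (hgi1 i) (by norm_num)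
  have hkc := key c 1 zero_le_one (fun i => by
    rw [abs_of_nonneg (hc i), one_mul]
    exact mul_le_of_le_one_left (hc i) (hgi1 i))
  obtain ⟨-, hTa⟩ := abs_tsum_tail_le hg hg1 hkc t
  set T := ∑' i, c (i + t) * a (i + t) with hTdef
  have hT0 : 0 ≤ T := tsum_nonneg fun i => hca _
  rw [abs_of_nonneg hT0] at hTa
  have hsplit : ∑' i, c i * a i = ∑ i ∈ Finset.range t, c i * a i + T :=
    (hsum.sum_add_tsum_nat_add t).symm
  have hkL := key L (C₁ * d) (by positivity) hL
  obtain ⟨hLs, hLT⟩ := abs_tsum_tail_le hg hg1 hkL t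
  set TL := ∑' i, L (i + t) * a (i + t) with hTLdef
  have hsplitL : ∑' i, L i * a i = ∑ i ∈ Finset.range t, L i * a i + TL :=
    (hLs.sum_add_tsum_nat_add t).symm
  have hfin : ∀ (f : ℕ → ℝ) (A : ℝ), 0 ≤ A → (∀ i, g ^ (i + 1) * |f i| ≤ A * c i) →
      |∑ i ∈ Finset.range t, f i * a i| ≤ A * (v * (B * ζ)) * G := by
    intro f A hA hf
    refine (Finset.abs_sum_le_sum_abs _ _).trans ?_
    refine (Finset.sum_le_sum fun i _ => key f A hA hf i).trans ?_
    rw [← Finset.mul_sum]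
    exact mul_le_mul_of_nonneg_left (sum_range_geom_le hg hg1 t) (by positivity)
  have hF1 := hfin (fun i => c' i - c i) (C₁ * d) (by positivity) hcc
  have hF2 := hfin (fun i => c' i - c i - L i) (C₁ * d ^ 2) (by positivity) hccL
  set F1 := ∑ i ∈ Finset.range t, (c' i - c i) * a i with hF1d
  set F2 := ∑ i ∈ Finset.range t, (c' i - c i - L i) * a i with hF2d
  have hΔ : v' - v = (c₀' - c₀) + F1 - T := by
    rw [hv, hv', hsplit, hF1d]
    simp only [sub_mul, Finset.sum_sub_distrib]
    ring
  have hΔL : v' - v - (L₀ + ∑' i, L i * a i) = (c₀' - c₀ - L₀) + F2 - T - TL := by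
    rw [hΔ, hsplitL, hF1d, hF2d]
    simp only [sub_mul, Finset.sum_sub_distrib]
    ring
  have hS : ∑ i ∈ Finset.range t, c i * a i ≤ v' * (B * ζ) * G := by
    have : ∀ i ∈ Finset.range t, c i * a i ≤ v' * (B * ζ) * g ^ (i + 1) := by
      intro i hi
      have e1 := hz' i (Finset.mem_range.1 hi)
      have e2 := mul_le_mul_of_nonneg_left (mul_le_mul_of_nonneg_right (hlow i) (ha i)) (hgi i).le
      -- Two powers are spent here: one to pass from `c` to `c'`, one for the weight in the bound
      -- for `c'`.
      have e3 : g ^ (i + 1) * (g ^ (i + 1) * (c i * a i)) ≤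
          g ^ (i + 1) * (g ^ (i + 1) * (v' * (B * ζ) * (g ^ (i + 1)) ^ 2)) := by
        calc _ ≤ v' * (B * ζ * (g ^ (i + 1)) ^ 4) := by linarith only [e1, e2]
          _ = _ := by ring
      refine (le_of_mul_le_mul_left (le_of_mul_le_mul_left e3 (hgi i)) (hgi i)).trans ?_
      refine mul_le_mul_of_nonneg_left ?_ (by positivity)
      exact pow_le_of_le_one (hgi i).le (hgi1 i) (by norm_num)
    refine (Finset.sum_le_sum this).trans ?_
    rw [← Finset.mul_sum]
    exact mul_le_mul_of_nonneg_left (sum_range_geom_le hg hg1 t) (by positivity)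
  exact abs_sqrt_ratio_pow_le k hvp hv'p hC₃0 hgt0.le hgt1 hζ hW
    (abs_ratio_sub_one_le hc₀ hB hC₁ hG0.le hv0 hd hζ hT0 hgt0.le hΔ h₀ hF1 hTa)
    (abs_ratio_sub_linear_le hc₀ hB hC₁ hG0.le hv0 hd1 hζ hT0 hgt0.le hΔL h₀L hF2 hTa hLT)
    (ratio_le_of_tail hc₀ hB hG0.le hv'0 hζ hW (hv.trans (by rw [hsplit])) hT hS)

end Expansion

/-! ### Bounds for the coefficients in a neighbourhood of the true parameter. -/

section Pathwise

variable {p q : ℕ}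

/-- `c_0` is a quotient, not a polynomial, so the relative bounds for `i ≥ 1` do not cover it. Its
increment equals its differential times `N / (N - b)`, with `N` the denominator and `b` the
perturbation of `∑ t_j`. -/
theorem exists_coef_zero_bound {θ : Param p q} (hθ : ∀ j, 0 < θ j)
    (hsum : ∑ j : Fin q, θ (Sum.inr j) < 1) :
    ∃ C δ : ℝ, 0 ≤ C ∧ 0 < δ ∧ ∀ h : Param p q, ‖h‖ ≤ δ →
      |coef (θ + h) 0 - coef θ 0| ≤ C * ‖h‖ ∧
      |coef (θ + h) 0 - coef θ 0 - coefLin θ h 0| ≤ C * ‖h‖ ^ 2 ∧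
      |coefLin θ h 0| ≤ C * ‖h‖ := by
  set N := 1 - ∑ j : Fin q, θ (Sum.inr j) with hN
  have hN0 : 0 < N := by linarith
  set s := θ (Sum.inl 0) with hs
  have hs0 : 0 < s := hθ _
  set Λ := 1 / N + s * q / N ^ 2 with hΛ
  have hΛ0 : 0 ≤ Λ := by positivity
  -- The radius keeps `|b| ≤ N / 2`, hence the perturbed denominator at least `N / 2`; `q + 1` keeps
  -- it positive when `q = 0`.
  refine ⟨2 * Λ + Λ * (2 * q / N), N / (2 * (q + 1)), by positivity, by positivity, ?_⟩
  intro h hh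
  set a := h (Sum.inl 0) with ha
  set b := ∑ j : Fin q, h (Sum.inr j) with hb
  have ha1 : |a| ≤ ‖h‖ := norm_le_pi_norm h (Sum.inl 0)
  have hb1 : |b| ≤ q * ‖h‖ := by
    refine (Finset.abs_sum_le_sum_abs _ _).trans ?_
    refine (Finset.sum_le_sum fun j _ => norm_le_pi_norm h (Sum.inr j)).trans ?_
    simp
  have hn := norm_nonneg h
  have hb2 : |b| ≤ N / 2 := by
    refine hb1.trans ?_
    rw [le_div_iff₀ (by positivity)] at hh
    have : (0:ℝ) ≤ q := by positivity
    nlinarith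
  have hNb : N / 2 ≤ N - b := by linarith [le_abs_self b]
  have hNb0 : 0 < N - b := by linarith
  have hL : coefLin θ h 0 = a / N + s * b / N ^ 2 := coefLin_zero θ h hsum.ne
  have hc : coef (θ + h) 0 = (s + a) / (N - b) := by
    rw [coef_zero]
    simp only [Pi.add_apply, Finset.sum_add_distrib]
    rw [← hs, ← ha, ← hb, hN]
    congr 1; ring
  have hc' : coef θ 0 = s / N := by rw [coef_zero]
  have hLb : |coefLin θ h 0| ≤ Λ * ‖h‖ := by
    rw [hL]
    refine (abs_add_le _ _).trans ?_
    rw [abs_div, abs_div, abs_mul, abs_of_pos hN0, abs_of_pos hs0, abs_of_pos (pow_pos hN0 2)]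
    calc _ ≤ ‖h‖ / N + s * (q * ‖h‖) / N ^ 2 := by gcongr
      _ = _ := by rw [hΛ]; ring
  have e1 : coef (θ + h) 0 - coef θ 0 = coefLin θ h 0 * (N / (N - b)) := by
    rw [hc, hc', hL]; field_simp; ring
  have e2 : coef (θ + h) 0 - coef θ 0 - coefLin θ h 0 = coefLin θ h 0 * (b / (N - b)) := by
    rw [e1]; field_simp; ring
  have b1 : |N / (N - b)| ≤ 2 := by
    rw [abs_of_pos (by positivity), div_le_iff₀ hNb0]; linarith
  have b2 : |b / (N - b)| ≤ 2 * q / N * ‖h‖ := by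
    rw [abs_div, abs_of_pos hNb0, div_le_iff₀ hNb0]
    refine hb1.trans ?_
    have h1 : q * ‖h‖ = 2 * q / N * ‖h‖ * (N / 2) := by field_simp
    rw [h1]
    exact mul_le_mul_of_nonneg_left hNb (by positivity)
  have hx : 0 ≤ Λ * (2 * q / N) := by positivity
  refine ⟨?_, ?_, ?_⟩
  · rw [e1, abs_mul]
    have := mul_le_mul hLb b1 (abs_nonneg _) (by positivity)
    nlinarith [mul_nonneg hx hn]
  · rw [e2, abs_mul]
    have := mul_le_mul hLb b2 (abs_nonneg _) (by positivity)
    nlinarith [mul_nonneg hΛ0 (sq_nonneg ‖h‖)]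
  · nlinarith [mul_nonneg hx hn, mul_nonneg hΛ0 hn]

theorem volHatSq_eq (x : ℤ → ℝ) (v : Param p q) (t : ℕ) :
    volHatSq x v t = coef v 0 +
      ∑ i ∈ Finset.range t, coef v (i + 1) * x ((t : ℤ) - ((i : ℤ) + 1)) ^ 2 := by
  unfold volHatSq
  congr 1
  rw [Finset.sum_bij' (i := fun i _ => i - 1) (j := fun i _ => i + 1)]
  · intro i hi
    simp only [Finset.mem_Icc] at hi
    simp only [Finset.mem_range]
    omega
  · intro i hi
    simp only [Finset.mem_range] at hi
    simp only [Finset.mem_Icc]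
    omega
  · intro i hi
    simp only [Finset.mem_Icc] at hi
    omega
  · intro i _
    omega
  · intro i hi
    simp only [Finset.mem_Icc] at hi
    obtain ⟨l, rfl⟩ : ∃ l, i = l + 1 := ⟨i - 1, by omega⟩
    simp

theorem exists_pos_le {θ : Param p q} (hθ : ∀ j, 0 < θ j) : ∃ m, 0 < m ∧ ∀ j, m ≤ θ j := by
  obtain ⟨j, hj⟩ := Finite.exists_min θ
  exact ⟨θ j, hθ j, hj⟩

/-- Relative bounds for the coefficients near `θ`, with weights `g^i`. -/
theorem exists_coef_bounds {θ : Param p q} (hθ : ∀ j, 0 < θ j)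
    (hsum : ∑ j : Fin q, θ (Sum.inr j) < 1) {g : ℝ} (hg : 0 < g) (hg1 : g < 1) :
    ∃ C δ : ℝ, 0 ≤ C ∧ 0 < δ ∧ δ ≤ 1 ∧ 
      (∀ j i, g ^ (i + 1) * |coefDeriv θ (i + 1) j| ≤ C * coef θ (i + 1)) ∧
      ∀ h : Param p q, ‖h‖ ≤ δ →
      (∀ j, 0 ≤ (θ + h) j) ∧
      |coef (θ + h) 0 - coef θ 0| ≤ C * ‖h‖ ∧
      |coef (θ + h) 0 - coef θ 0 - coefLin θ h 0| ≤ C * ‖h‖ ^ 2 ∧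
      coef θ 0 / 2 ≤ coef (θ + h) 0 ∧
      (∀ i, g ^ (i + 1) * |coef (θ + h) (i + 1) - coef θ (i + 1)| ≤ C * ‖h‖ * coef θ (i + 1)) ∧
      (∀ i, g ^ (i + 1) * |coef (θ + h) (i + 1) - coef θ (i + 1) - coefLin θ h (i + 1)| ≤
        C * ‖h‖ ^ 2 * coef θ (i + 1)) ∧
      (∀ i, g ^ (i + 1) * |coefLin θ h (i + 1)| ≤ C * ‖h‖ * coef θ (i + 1)) ∧
      (∀ i, g ^ (i + 1) * coef θ (i + 1) ≤ coef (θ + h) (i + 1)) ∧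
      (∀ i, g ^ (i + 1) * coef (θ + h) (i + 1) ≤ coef θ (i + 1)) := by
  obtain ⟨C₀, δ₀, hC₀, hδ₀, h0⟩ := exists_coef_zero_bound hθ hsum
  obtain ⟨m, hm, hmθ⟩ := exists_pos_le hθ
  have hθ' : ∀ j, 0 ≤ θ j := fun j => (hθ j).le
  have hc0 : 0 < coef θ 0 := by
    rw [coef_zero]; exact div_pos (hθ _) (by linarith)
  -- With this margin `g (1 + D) = g (2 - g) ≤ 1`, so a weight `g^i` absorbs the growth `(1 + D)^i`.
  set D := 1 - g with hD
  have hD0 : 0 < D := by linarith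
  have hD1 : D < 1 := by linarith
  have hgD : g * (1 + D) ≤ 1 := by nlinarith [sq_nonneg (1 - g)]
  have hpow : ∀ n : ℕ, g ^ n * (1 + D) ^ n ≤ 1 := fun n => by
    rw [← mul_pow]; exact pow_le_one₀ (by positivity) hgD
  have hbern : ∀ n : ℕ, g ^ n * n ≤ 1 / D := fun n => by
    have h1 := one_add_mul_le_pow (show (-2:ℝ) ≤ D by linarith) n
    rw [le_div_iff₀ hD0]
    have h2 := mul_le_mul_of_nonneg_left h1 (pow_nonneg hg.le n)
    have h3 := hpow n
    have h4 : 0 < g ^ n := by positivity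
    nlinarith
  set C := C₀ + 1 / (m * D) + (1 / (m * D)) ^ 2 with hC
  have hCm : 1 / (m * D) ≤ C := by rw [hC]; nlinarith [sq_nonneg (1 / (m * D))]
  have hCm2 : (1 / (m * D)) ^ 2 ≤ C := by
    have : 0 ≤ 1 / (m * D) := by positivity
    linarith
  have hCC : C₀ ≤ C := by
    have : 0 ≤ 1 / (m * D) := by positivity
    linarith [sq_nonneg (1 / (m * D))]
  have hC0 : 0 ≤ C := by positivity
  have hlin : ∀ (h : Param p q) (i : ℕ),
      g ^ (i + 1) * |coefLin θ h (i + 1)| ≤ C * ‖h‖ * coef θ (i + 1) := by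
    intro h i
    have hc := coef_nonneg hθ' i
    have h1 := abs_coefLin_le (d := ‖h‖ / m) hθ' (by positivity) (fun j => by
      calc |h j| ≤ ‖h‖ := norm_le_pi_norm h j
        _ = ‖h‖ / m * m := by field_simp
        _ ≤ _ := mul_le_mul_of_nonneg_left (hmθ j) (by positivity)) i
    calc _ ≤ g ^ (i + 1) * ((((i + 1 : ℕ) : ℝ) * (‖h‖ / m)) * coef θ (i + 1)) := by gcongr
      _ = (g ^ (i + 1) * ((i + 1 : ℕ) : ℝ)) * (‖h‖ / m * coef θ (i + 1)) := by ring
      _ ≤ 1 / D * (‖h‖ / m * coef θ (i + 1)) :=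
        mul_le_mul_of_nonneg_right (hbern _) (by positivity)
      _ = 1 / (m * D) * (‖h‖ * coef θ (i + 1)) := by field_simp
      _ ≤ C * (‖h‖ * coef θ (i + 1)) := mul_le_mul_of_nonneg_right hCm (by positivity)
      _ = _ := by ring
  -- The bound `m * D` makes the relative perturbation `‖h‖ / m` at most `D`; the last one keeps the
  -- perturbed `c_0` above half of its value at `θ`.
  refine ⟨C, min (min δ₀ 1) (min (m * D) (coef θ 0 / (2 * (C₀ + 1)))), hC0, by positivity,
    (min_le_left _ _).trans (min_le_right _ _), ?_, ?_⟩
  · intro j i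
    have h1 := hlin (Pi.single j 1) i
    have h2 : coefLin θ (Pi.single j 1) (i + 1) = coefDeriv θ (i + 1) j := by
      simp [coefLin, Pi.single_apply]
    have h3 : ‖(Pi.single j 1 : Param p q)‖ = 1 := by
      rw [Pi.norm_single]; simp
    rwa [h2, h3, mul_one] at h1
  intro h hh
  have hh1 : ‖h‖ ≤ δ₀ := hh.trans ((min_le_left _ _).trans (min_le_left _ _))
  have hh2 : ‖h‖ ≤ m * D := hh.trans ((min_le_right _ _).trans (min_le_left _ _))
  have hh3 : ‖h‖ ≤ coef θ 0 / (2 * (C₀ + 1)) := hh.trans ((min_le_right _ _).trans (min_le_right _ _))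
  obtain ⟨h01, h02, -⟩ := h0 h hh1
  have hn := norm_nonneg h
  set d := ‖h‖ / m with hd
  have hd0 : 0 ≤ d := by positivity
  have hdD : d ≤ D := by rw [hd, div_le_iff₀ hm]; linarith
  have hdD' : d / D = 1 / (m * D) * ‖h‖ := by rw [hd]; field_simp
  have hhd : ∀ j, |h j| ≤ d * θ j := fun j => by
    calc |h j| ≤ ‖h‖ := norm_le_pi_norm h j
        _ = ‖h‖ / m * m := by field_simp
        _ ≤ _ := mul_le_mul_of_nonneg_left (hmθ j) (by positivity)
  have hlow : ∀ j, (1 - d) * θ j ≤ (θ + h) j := fun j => by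
    have := neg_abs_le (h j)
    have := hhd j
    simp only [Pi.add_apply]; linarith
  have hsub : ∀ i, g ^ (i + 1) * |coef (θ + h) (i + 1) - coef θ (i + 1)| ≤
      d / D * ((1 - g ^ (i + 1)) * coef θ (i + 1)) := fun i => by
    have hc := coef_nonneg hθ' i
    have h1 := (abs_coef_sub_le hθ' hd0 hhd i).trans
      (mul_le_mul_of_nonneg_right (one_add_pow_sub_one_le hd0 hD0 hdD (i + 1)) hc)
    have h2 := mul_le_mul_of_nonneg_left h1 (pow_nonneg hg.le (i + 1))
    refine h2.trans ?_
    have h3 : 0 ≤ d / D * coef θ (i + 1) := by positivity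
    have h4 := mul_le_mul_of_nonneg_right (hpow (i + 1)) h3
    nlinarith
  have hDd1 : d / D ≤ 1 := (div_le_one hD0).2 hdD
  refine ⟨fun j => (mul_nonneg (by linarith) (hθ' j)).trans (hlow j),
    h01.trans (mul_le_mul_of_nonneg_right hCC hn),
    h02.trans (mul_le_mul_of_nonneg_right hCC (sq_nonneg _)), ?_, ?_, ?_, hlin h, ?_, ?_⟩
  · rw [le_div_iff₀ (by positivity)] at hh3
    have := neg_abs_le (coef (θ + h) 0 - coef θ 0)
    nlinarith
  · intro i
    have hc := coef_nonneg hθ' i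
    refine (hsub i).trans ?_
    rw [hdD', mul_assoc, mul_assoc]
    have h1 : (1 - g ^ (i + 1)) * coef θ (i + 1) ≤ coef θ (i + 1) :=
      mul_le_of_le_one_left hc (by linarith [pow_pos hg (i + 1)])
    calc _ ≤ 1 / (m * D) * (‖h‖ * coef θ (i + 1)) := by gcongr
      _ ≤ _ := mul_le_mul_of_nonneg_right hCm (by positivity)
  · intro i
    have hc := coef_nonneg hθ' i
    have h1 := (abs_coef_sub_sub_coefLin_le hθ' hd0 hhd i).trans
      (mul_le_mul_of_nonneg_right (one_add_pow_sub_linear_le hd0 hD0 hdD (i + 1)) hc)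
    have h2 := mul_le_mul_of_nonneg_left h1 (pow_nonneg hg.le (i + 1))
    refine h2.trans ?_
    have h3 : 0 ≤ (d / D) ^ 2 * coef θ (i + 1) := by positivity
    have h4 := mul_le_mul_of_nonneg_right (hpow (i + 1)) h3
    have h5 : g ^ (i + 1) * ((d / D) ^ 2 * ((1 + D) ^ (i + 1) - 1 - ((i + 1 : ℕ) : ℝ) * D) *
        coef θ (i + 1)) ≤ (d / D) ^ 2 * coef θ (i + 1) := by
      have h6 : 0 ≤ g ^ (i + 1) * ((d / D) ^ 2 * coef θ (i + 1)) * (1 + ((i + 1 : ℕ) : ℝ) * D) := by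
        positivity
      nlinarith
    refine h5.trans ?_
    rw [hdD', mul_pow, mul_assoc, mul_assoc]
    exact mul_le_mul_of_nonneg_right hCm2 (by positivity)
  · intro i
    refine le_trans (mul_le_mul_of_nonneg_right ?_ (coef_nonneg hθ' i))
      (pow_mul_coef_le hθ' hd0 (by linarith) hlow i)
    exact pow_le_pow_left₀ hg.le (by linarith) _
  · intro i
    have hc := coef_nonneg hθ' i
    have h1 := hsub i
    have h2 : d / D * ((1 - g ^ (i + 1)) * coef θ (i + 1)) ≤ (1 - g ^ (i + 1)) * coef θ (i + 1) :=
      mul_le_of_le_one_left (mul_nonneg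
        (sub_nonneg.2 (pow_le_one₀ hg.le hg1.le)) hc) hDd1
    have h3 := mul_le_mul_of_nonneg_left (le_abs_self (coef (θ + h) (i + 1) - coef θ (i + 1)))
      (pow_nonneg hg.le (i + 1))
    calc g ^ (i + 1) * coef (θ + h) (i + 1) =
        g ^ (i + 1) * (coef (θ + h) (i + 1) - coef θ (i + 1)) + g ^ (i + 1) * coef θ (i + 1) := by
          ring
      _ ≤ (1 - g ^ (i + 1)) * coef θ (i + 1) + g ^ (i + 1) * coef θ (i + 1) :=
          add_le_add (h3.trans (h1.trans h2)) le_rfl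
      _ = _ := by ring

end Pathwise

/-! ### Expansion of the residual volatility for GARCH coefficients along a trajectory. -/

section Pathwise

variable {p q : ℕ}

/-- The moving sum `∑_{i ≥ 1} r^i |x_{t-i}|^{2e}`. -/
noncomputable def powSum (r e : ℝ) (x : ℤ → ℝ) (t : ℤ) : ℝ :=
  ∑' i : ℕ, r ^ (i + 1) * (x (t - ((i : ℤ) + 1)) ^ 2) ^ e

set_option maxHeartbeats 600000 in
/-- The expansion of the `k`th power of the ratio of the volatilities along a trajectory, with
bounds in terms of moving sums of small powers of the observations. -/
theorem exists_path_expansion {θ : Param p q} (hθ : ∀ j, 0 < θ j)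
    (hsum : ∑ j : Fin q, θ (Sum.inr j) < 1) {e : ℝ} (he : 0 < e) (he1 : e ≤ 1) (k : ℕ) :
    ∃ ρ r g δ C : ℝ, 0 < ρ ∧ ρ < 1 ∧ 0 < r ∧ r < 1 ∧ 0 < g ∧ g < 1 ∧ 0 < δ ∧ 0 ≤ C ∧
      ∀ (x : ℤ → ℝ) (t : ℤ),
      (Summable fun i : ℕ => r ^ (i + 1) * (x (t - ((i : ℤ) + 1)) ^ 2) ^ e) →
      (Summable fun i : ℕ => ρ ^ (i + 1) * x (t - ((i : ℤ) + 1)) ^ 2) →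
      (Summable fun i : ℕ => coef θ (i + 1) * x (t - ((i : ℤ) + 1)) ^ 2) ∧
      (∀ j, Summable fun i : ℕ => coefDeriv θ (i + 1) j * x (t - ((i : ℤ) + 1)) ^ 2) ∧
      0 < volSq x θ t ∧
      (∀ j, |dLogVolSq x θ t j| ≤ C * (1 + powSum r e x t)) ∧
      ∀ n : ℕ, t = n → ∀ v : Param p q, ‖v - θ‖ ≤ δ →
        0 < volHatSq x v n ∧
        |Real.sqrt (volSq x θ t / volHatSq x v n) ^ k - 1 +
          k / 2 * ∑ j, dLogVolSq x θ t j * (v j - θ j)| ≤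
          C * ((1 + ∑' i : ℕ, ρ ^ (i + 1) * x (0 - ((i : ℤ) + 1)) ^ 2) ^ (k + 2) *
            (1 + powSum r e x t) * (‖v - θ‖ ^ 2 + g ^ n)) := by
  have hθ' : ∀ j, 0 ≤ θ j := fun j => (hθ j).le
  obtain ⟨ρ, hρ, hρ1, τ, hτ0, hτ1, hτ⟩ := exists_rate hθ' hsum
  obtain ⟨K, hK, hcK⟩ := exists_coef_le hθ' hρ hτ1 hτ
  have hc0 : 0 < coef θ 0 := by
    rw [coef_zero]; exact div_pos (hθ _) (by linarith)
  set c₀ := coef θ 0 with hc₀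
  -- `ratio_expansion` produces `ζ^(k+4)`. Taking `ζ` to be the `M`th root of `1 + Z` makes this
  -- linear in the moving sum `Z`, which has a mean.
  set M := k + 4 with hM
  have hM1 : 1 ≤ M := by omega
  have hM0 : (0:ℝ) < M := by exact_mod_cast hM1
  set g := ρ ^ (e / (8 * M)) with hgdef
  have hg : 0 < g := Real.rpow_pos_of_pos hρ _
  have hg1 : g < 1 := Real.rpow_lt_one hρ.le hρ1 (by positivity)
  have hgρ : ρ ^ e = g ^ (8 * M) := by
    rw [hgdef, ← Real.rpow_natCast, ← Real.rpow_mul hρ.le]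
    congr 1
    push_cast
    field_simp
  set r := g ^ (4 * M) with hr
  have hr0 : 0 < r := by positivity
  have hr1 : r < 1 := pow_lt_one₀ hg.le hg1 (by omega)
  obtain ⟨C₁, δ, hC₁, hδ, hδ1, hderiv, hbd⟩ := exists_coef_bounds hθ hsum hg hg1
  -- The bound `c₀ / 2` lies below both the true volatility and the estimated one, so one constant
  -- serves both.
  set B := (K / (c₀ / 2)) ^ (e / M) with hB
  have hB0 : 0 ≤ B := Real.rpow_nonneg (by positivity) _
  obtain ⟨C₂, hC₂, hexp⟩ := ratio_expansion k hc0 hg hg1 hB0 hC₁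
  have hG : 0 < (1 - g)⁻¹ := inv_pos.2 (by linarith)
  obtain ⟨E, hE0, hE⟩ : ∃ E : ℝ, 0 ≤ E ∧ ∀ j, |coefDeriv θ 0 j| / c₀ ≤ E := by
    refine ⟨∑ j, |coefDeriv θ 0 j| / c₀, Finset.sum_nonneg fun _ _ => by positivity, fun j => ?_⟩
    exact Finset.single_le_sum (f := fun j => |coefDeriv θ 0 j| / c₀)
      (fun _ _ => by positivity) (Finset.mem_univ j)
  refine ⟨ρ, r, g, δ, C₂ * (1 + K) ^ (k + 2) + (E + C₁ * B * (1 - g)⁻¹), hρ, hρ1, hr0, hr1, hg,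
    hg1, hδ, by positivity, ?_⟩
  intro x t hZs hVs
  set a : ℕ → ℝ := fun i => x (t - ((i : ℤ) + 1)) ^ 2 with ha
  have ha0 : ∀ i, 0 ≤ a i := fun i => sq_nonneg _
  set Z := powSum r e x t with hZ
  have hZ0 : 0 ≤ Z := tsum_nonneg fun i => by positivity
  have hterm : ∀ i, r ^ (i + 1) * a i ^ e ≤ 1 + Z := fun i => by
    have : r ^ (i + 1) * a i ^ e ≤ Z := hZs.le_tsum i fun j _ => by positivity
    linarith
  set ζ := (1 + Z) ^ (1 / (M : ℝ)) with hζ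
  have hζ1 : 1 ≤ ζ := Real.one_le_rpow (by linarith) (by positivity)
  have hζM : ζ ^ (k + 4) = 1 + Z := by
    rw [hζ, one_div, ← hM]
    exact Real.rpow_inv_natCast_pow (by linarith) (by omega)
  have hζZ : ζ ≤ 1 + Z := by
    rw [← hζM]; exact le_self_pow₀ hζ1 (by omega)
  have hc := coef_nonneg hθ'
  have hca : ∀ i, 0 ≤ coef θ (i + 1) * a i := fun i => mul_nonneg (hc i) (ha0 i)
  have hsc : Summable fun i => coef θ (i + 1) * a i := by
    refine Summable.of_nonneg_of_le hca (fun i => ?_) (hVs.mul_left K)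
    calc _ ≤ K * ρ ^ (i + 1) * a i := mul_le_mul_of_nonneg_right (hcK i) (ha0 i)
      _ = _ := by rw [ha]; ring
  have hv : volSq x θ t = c₀ + ∑' i, coef θ (i + 1) * a i := rfl
  set v := volSq x θ t with hvdef
  have hv0 : c₀ ≤ v := by
    have : 0 ≤ ∑' i, coef θ (i + 1) * a i := tsum_nonneg hca
    linarith
  have hvp : 0 < v := by linarith
  have hz : ∀ i, coef θ (i + 1) * a i ≤ v * (B * ζ * (g ^ (i + 1)) ^ 4) := fun i => by
    have h1 : coef θ (i + 1) * a i ≤ v := by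
      rw [hv]
      have : coef θ (i + 1) * a i ≤ ∑' i, coef θ (i + 1) * a i :=
        hsc.le_tsum i fun j _ => hca j
      linarith
    have := div_le_geometric (w := 1) hM1 he he1 hg hρ hgρ hK (half_pos hc0) (ha0 i) (hc i)
      one_pos le_rfl (by rw [one_mul]; exact hcK i) h1 (by linarith) (hterm i)
    rwa [one_mul] at this
  have hsd : ∀ j, ∀ i, |coefDeriv θ (i + 1) j * a i| ≤ C₁ * (v * (B * ζ)) * g ^ (i + 1) := by
    intro j i
    have hgi : 0 < g ^ (i + 1) := by positivity
    have hgi1 : g ^ (i + 1) ≤ 1 := pow_le_one₀ hg.le hg1.le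
    rw [abs_mul, abs_of_nonneg (ha0 i)]
    have h1 := mul_le_mul_of_nonneg_right (hderiv j i) (ha0 i)
    have h2 := mul_le_mul_of_nonneg_left (hz i) hC₁
    have h3 : g ^ (i + 1) * (|coefDeriv θ (i + 1) j| * a i) ≤
        g ^ (i + 1) * (C₁ * (v * (B * ζ)) * (g ^ (i + 1)) ^ 3) := by
      calc _ ≤ C₁ * (v * (B * ζ * (g ^ (i + 1)) ^ 4)) := by linarith only [h1, h2]
        _ = _ := by ring
    refine (le_of_mul_le_mul_left h3 hgi).trans ?_
    refine mul_le_mul_of_nonneg_left ?_ (by positivity)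
    exact pow_le_of_le_one hgi.le hgi1 (by norm_num)
  have hsds : ∀ j, Summable fun i => coefDeriv θ (i + 1) j * a i := fun j =>
    (abs_tsum_tail_le hg hg1 (hsd j) 0).1
  refine ⟨hsc, hsds, hvp, ?_, ?_⟩
  · intro j
    have h1 := (abs_tsum_tail_le hg hg1 (hsd j) 0).2
    simp only [add_zero, pow_zero, mul_one] at h1
    have h2 : dLogVolSq x θ t j = (coefDeriv θ 0 j + ∑' i, coefDeriv θ (i + 1) j * a i) / v := rfl
    rw [h2, abs_div, abs_of_pos hvp, div_le_iff₀ hvp]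
    have h3 : |coefDeriv θ 0 j| ≤ E * v * ζ := by
      have h4 := hE j
      rw [div_le_iff₀ hc0] at h4
      have h5 : E * c₀ ≤ E * v := mul_le_mul_of_nonneg_left hv0 hE0
      have h6 : E * v ≤ E * v * ζ := le_mul_of_one_le_right (by positivity) hζ1
      linarith only [h4, h5, h6]
    calc _ ≤ E * v * ζ + C₁ * (v * (B * ζ)) * (1 - g)⁻¹ :=
          (abs_add_le _ _).trans (add_le_add h3 h1)
      _ = (0 + (E + C₁ * B * (1 - g)⁻¹)) * ζ * v := by ring
      _ ≤ (C₂ * (1 + K) ^ (k + 2) + (E + C₁ * B * (1 - g)⁻¹)) * (1 + Z) * v := by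
          have : 0 ≤ C₂ * (1 + K) ^ (k + 2) := by positivity
          gcongr
  · intro n hn u hu
    have hn0 := norm_nonneg (u - θ)
    obtain ⟨hp0, hb1, hb2, hb3, hb4, hb5, hb6, hb7, hb8⟩ := hbd (u - θ) hu
    have hadd : θ + (u - θ) = u := by abel
    simp only [hadd] at hp0 hb1 hb2 hb3 hb4 hb5 hb6 hb7 hb8
    have hv' : volHatSq x u n = coef u 0 + ∑ i ∈ Finset.range n, coef u (i + 1) * a i := by
      rw [volHatSq_eq, ha, hn]
    have hcu := coef_nonneg hp0
    have hz' : ∀ i < n, g ^ (i + 1) * (coef u (i + 1) * a i) ≤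
        volHatSq x u n * (B * ζ * (g ^ (i + 1)) ^ 4) := by
      intro i hi
      have hnn : ∀ i ∈ Finset.range n, 0 ≤ coef u (i + 1) * a i :=
        fun i _ => mul_nonneg (hcu i) (ha0 i)
      have h1 := Finset.single_le_sum hnn (Finset.mem_range.2 hi)
      have h2 := Finset.sum_nonneg hnn
      exact div_le_geometric (w := g ^ (i + 1)) hM1 he he1 hg hρ hgρ hK (half_pos hc0) (ha0 i)
        (hcu i) (by positivity) (pow_le_one₀ hg.le hg1.le) ((hb8 i).trans (hcK i))
        (by rw [hv']; linarith) (by rw [hv']; linarith) (hterm i)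
    set V := ∑' i : ℕ, ρ ^ (i + 1) * x (0 - ((i : ℤ) + 1)) ^ 2 with hV
    have hV0 : 0 ≤ V := tsum_nonneg fun i => by positivity
    -- Beyond index `n` the series at time `n` involves only observations at negative times, so the
    -- dropped tail is bounded by a variable free of `n`.
    have htail : ∑' i, coef θ (i + n + 1) * a (i + n) ≤ K * V := by
      have hpt : ∀ i, ρ ^ (i + n + 1) * a (i + n) =
          ρ ^ n * (ρ ^ (i + 1) * x (0 - ((i : ℤ) + 1)) ^ 2) := by
        intro i
        have : t - (((i + n : ℕ) : ℤ) + 1) = 0 - ((i : ℤ) + 1) := by rw [hn]; push_cast; ring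
        simp only [ha, this]
        ring
      have hVn := (summable_nat_add_iff n).2 hVs
      have hVn' : Summable fun i : ℕ => ρ ^ n * (ρ ^ (i + 1) * x (0 - ((i : ℤ) + 1)) ^ 2) := by
        refine hVn.congr fun i => ?_
        exact hpt i
      have hVn'' : Summable fun i : ℕ => ρ ^ (i + 1) * x (0 - ((i : ℤ) + 1)) ^ 2 :=
        (summable_mul_left_iff (by positivity)).1 hVn'
      calc _ ≤ ∑' i : ℕ, K * (ρ ^ (i + 1) * x (0 - ((i : ℤ) + 1)) ^ 2) := by
            refine Summable.tsum_le_tsum (fun i => ?_) ((summable_nat_add_iff n).2 hsc)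
              (hVn''.mul_left K)
            calc _ ≤ K * ρ ^ (i + n + 1) * a (i + n) :=
                  mul_le_mul_of_nonneg_right (hcK (i + n)) (ha0 _)
              _ = K * (ρ ^ n * (ρ ^ (i + 1) * x (0 - ((i : ℤ) + 1)) ^ 2)) := by
                  rw [mul_assoc, hpt]
              _ ≤ _ := by
                  refine mul_le_mul_of_nonneg_left ?_ hK.le
                  exact mul_le_of_le_one_left (by positivity) (pow_le_one₀ hρ.le hρ1.le)
        _ = K * V := by rw [tsum_mul_left]
    have hmain := hexp (fun i => coef θ (i + 1)) (fun i => coef u (i + 1))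
      (fun i => coefLin θ (u - θ) (i + 1)) a (coef u 0) (coefLin θ (u - θ) 0) ‖u - θ‖ ζ (K * V)
      v (volHatSq x u n) n hn0 (hu.trans hδ1) hζ1 (by positivity) ha0 hc hcu hb1 hb2 hb3 hb4 hb5
      hb6 hb7 hsc hv hv' hz hz' htail
    refine ⟨hmain.1, ?_⟩
    have hD : ∑ j, dLogVolSq x θ t j * (u j - θ j) =
        (coefLin θ (u - θ) 0 + ∑' i, coefLin θ (u - θ) (i + 1) * a i) / v := by
      have h2 : ∀ j, dLogVolSq x θ t j =
        (coefDeriv θ 0 j + ∑' i, coefDeriv θ (i + 1) j * a i) / v := fun j => rfl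
      have h3 : ∑' i, coefLin θ (u - θ) (i + 1) * a i =
          ∑ j, (∑' i, coefDeriv θ (i + 1) j * a i) * (u j - θ j) := by
        simp only [coefLin, Finset.sum_mul, Pi.sub_apply, ← tsum_mul_right]
        rw [← Summable.tsum_finsetSum fun j _ => (hsds j).mul_right _]
        congr 1; ext i
        refine Finset.sum_congr rfl fun j _ => by ring
      rw [h3]
      simp only [h2, coefLin, Pi.sub_apply, ← Finset.sum_add_distrib, Finset.sum_div]
      refine Finset.sum_congr rfl fun j _ => by ring
    rw [hD]
    refine hmain.2.trans ?_
    rw [hζM]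
    have hgn : 0 < g ^ n := by positivity
    have h1 : (1 + K * V) ^ (k + 2) ≤ (1 + K) ^ (k + 2) * (1 + V) ^ (k + 2) := by
      rw [← mul_pow]
      refine pow_le_pow_left₀ (by positivity) ?_ _
      have e1 : 0 ≤ K + V := by positivity
      have e2 : (1 + K) * (1 + V) = 1 + K * V + (K + V) := by ring
      linarith only [e1, e2]
    calc _ ≤ C₂ * ((1 + K) ^ (k + 2) * (1 + V) ^ (k + 2) * (1 + Z) * (‖u - θ‖ ^ 2 + g ^ n)) := by
          gcongr
      _ = (C₂ * (1 + K) ^ (k + 2) + 0) *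
          ((1 + V) ^ (k + 2) * (1 + Z) * (‖u - θ‖ ^ 2 + g ^ n)) := by ring
      _ ≤ _ := by
          refine mul_le_mul_of_nonneg_right ?_ (by positivity)
          refine add_le_add le_rfl (by positivity)

end Pathwise

/-! ### The past of an i.i.d. sequence: independence and distributional invariance. -/

section IIDSequence

variable {Ω : Type*}

/-- The past `(ε_t, ε_{t-1}, …)` of a sequence. -/
def past (ε : ℤ → Ω → ℝ) (t : ℤ) (ω : Ω) : ℕ → ℝ := fun i => ε (t - i) ω

/-- The σ-algebra generated by `ε_s`, `s ∈ S`. -/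
abbrev sigmaOn (ε : ℤ → Ω → ℝ) (S : Set ℤ) : MeasurableSpace Ω :=
  ⨆ s ∈ S, MeasurableSpace.comap (ε s) inferInstance

theorem measurable_sigmaOn (ε : ℤ → Ω → ℝ) {S : Set ℤ} {s : ℤ} (hs : s ∈ S) :
    Measurable[sigmaOn ε S] (ε s) :=
  measurable_iff_comap_le.2 (le_iSup₂ (f := fun s (_ : s ∈ S) =>
    MeasurableSpace.comap (ε s) inferInstance) s hs)

theorem measurable_past_sigmaOn (ε : ℤ → Ω → ℝ) {S : Set ℤ} {t : ℤ} (hS : ∀ i : ℕ, t - i ∈ S) :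
    Measurable[sigmaOn ε S] (past ε t) :=
  @measurable_pi_lambda _ _ _ (sigmaOn ε S) _ _ fun i => measurable_sigmaOn ε (hS i)

/-- The filtration of `ℕ → ℝ` generated by the first coordinates. -/
def firstCoords : Filtration ℕ (MeasurableSpace.pi : MeasurableSpace (ℕ → ℝ)) where
  seq m := ⨆ i ∈ Set.Iio m, MeasurableSpace.comap (fun e : ℕ → ℝ => e i) inferInstance
  mono' := fun _ _ hab => biSup_mono fun _ hi => lt_of_lt_of_le hi hab
  le' := fun _ => iSup₂_le fun i _ => (measurable_pi_apply i).comap_le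

theorem iSup_firstCoords :
    ⨆ m, firstCoords m = (MeasurableSpace.pi : MeasurableSpace (ℕ → ℝ)) := by
  refine le_antisymm (iSup_le fun m => firstCoords.le m) (iSup_le fun i => ?_)
  refine le_trans ?_ (le_iSup _ (i + 1))
  exact le_iSup₂ (f := fun j (_ : j ∈ Set.Iio (i + 1)) =>
    MeasurableSpace.comap (fun e : ℕ → ℝ => e j) inferInstance) i (Set.mem_Iio.2 (Nat.lt_succ_self i))

theorem measurable_past_firstCoords (ε : ℤ → Ω → ℝ) {S : Set ℤ} {t : ℤ} {m : ℕ}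
    (hS : ∀ i < m, t - (i : ℤ) ∈ S) :
    Measurable[sigmaOn ε S, firstCoords m] (past ε t) := by
  refine measurable_iff_comap_le.2 ?_
  change MeasurableSpace.comap _ (⨆ i ∈ Set.Iio m, _) ≤ _
  simp only [MeasurableSpace.comap_iSup, MeasurableSpace.comap_comp]
  exact iSup₂_le fun i hi => (measurable_sigmaOn ε (hS i hi)).comap_le

variable [mΩ : MeasurableSpace Ω] {μ : Measure Ω}

theorem measurable_past {ε : ℤ → Ω → ℝ} (hε : ∀ t, Measurable (ε t)) (t : ℤ) :
    Measurable (past ε t) := measurable_pi_lambda _ fun i => hε (t - i)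

theorem sigmaOn_le {ε : ℤ → Ω → ℝ} (hε : ∀ t, Measurable (ε t)) (S : Set ℤ) :
    sigmaOn ε S ≤ mΩ := iSup₂_le fun s _ => (hε s).comap_le

theorem indep_sigmaOn {ε : ℤ → Ω → ℝ} (hε : ∀ t, Measurable (ε t)) (hi : iIndepFun ε μ)
    {S T : Set ℤ} (hST : Disjoint S T) : Indep (sigmaOn ε S) (sigmaOn ε T) μ :=
  indep_iSup_of_disjoint (fun s => (hε s).comap_le) hi hST

theorem lintegral_mul_sigmaOn {ε : ℤ → Ω → ℝ} (hε : ∀ t, Measurable (ε t)) (hi : iIndepFun ε μ)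
    {S T : Set ℤ} (hST : Disjoint S T) {f g : Ω → ENNReal} (hf : Measurable[sigmaOn ε S] f)
    (hg : Measurable[sigmaOn ε T] g) :
    ∫⁻ ω, f ω * g ω ∂μ = (∫⁻ ω, f ω ∂μ) * ∫⁻ ω, g ω ∂μ :=
  lintegral_mul_eq_lintegral_mul_lintegral_of_independent_measurableSpace (sigmaOn_le hε S)
    (sigmaOn_le hε T) (indep_sigmaOn hε hi hST) hf hg

/-- At every time the law of the past is the same infinite product measure. -/
theorem identDistrib_past {ε : ℤ → Ω → ℝ} (hε : ∀ t, Measurable (ε t)) (hi : iIndepFun ε μ)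
    (hid : ∀ t, IdentDistrib (ε t) (ε 0) μ μ) (s t : ℤ) :
    IdentDistrib (past ε s) (past ε t) μ μ := by
  refine ⟨(measurable_past hε s).aemeasurable, (measurable_past hε t).aemeasurable, ?_⟩
  have h : ∀ t : ℤ, μ.map (past ε t) = Measure.infinitePi fun _ : ℕ => μ.map (ε 0) := by
    intro t
    have hinj : Function.Injective fun i : ℕ => t - (i : ℤ) := fun a b hab => by
      simpa using hab
    have h1 := (hi.precomp hinj).map_fun_eq_infinitePi_map (fun i => hε _)
    have h2 : (fun i : ℕ => μ.map (ε (t - i))) = fun _ => μ.map (ε 0) := by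
      ext1 i; exact (hid _).map_eq
    rw [h2] at h1
    exact h1
  rw [h s, h t]

end IIDSequence

/-! ### Deterministic facts on averages along residue classes. -/

section Averages

/-- Regroups by residues modulo `m`; the classes below the remainder `R` hold one more term. -/
theorem sum_range_mul_add {m : ℕ} (a : ℕ → ℝ) (Q R : ℕ) (hR : R ≤ m) :
    ∑ t ∈ Finset.range (m * Q + R), a t =
      ∑ b ∈ Finset.range m, ∑ i ∈ Finset.range (Q + if b < R then 1 else 0), a (m * i + b) := by
  induction Q generalizing R with
  | zero =>
    rw [mul_zero, zero_add, ← Finset.sum_subset (Finset.range_subset_range.2 hR)]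
    · refine Finset.sum_congr rfl fun b hb => ?_
      simp [Finset.mem_range.1 hb]
    · intro b _ hb
      rw [Finset.mem_range] at hb
      simp [hb]
  | succ Q ih =>
    have h0 := ih m le_rfl
    have h1 : m * (Q + 1) + R = m * Q + m + R := by ring
    rw [h1]
    rw [Finset.sum_range_add, h0]
    have h2 : ∑ b ∈ Finset.range m, ∑ i ∈ Finset.range (Q + if b < m then 1 else 0), a (m * i + b) =
        ∑ b ∈ Finset.range m, ∑ i ∈ Finset.range (Q + 1), a (m * i + b) :=
      Finset.sum_congr rfl fun b hb => by simp [Finset.mem_range.1 hb]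
    have h3 : ∑ x ∈ Finset.range R, a (m * Q + m + x) =
        ∑ b ∈ Finset.range m, if b < R then a (m * (Q + 1) + b) else 0 := by
      rw [← Finset.sum_subset (Finset.range_subset_range.2 hR)]
      · refine Finset.sum_congr rfl fun b hb => ?_
        rw [if_pos (Finset.mem_range.1 hb)]
        congr 1
      · intro b _ hb
        simp at hb
        simp [hb]
    rw [h2, h3, ← Finset.sum_add_distrib]
    refine Finset.sum_congr rfl fun b _ => ?_
    split_ifs
    · rw [Finset.sum_range_succ _ (Q + 1)]
    · simp

/-- For large `N` convergence gives `|s N| ≤ η N ≤ η n`; the finitely many other `N` have a fixed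
bound, which `η n` eventually exceeds. -/
theorem eventually_forall_le_of_tendsto_zero {s : ℕ → ℝ}
    (hs : Tendsto (fun n : ℕ => s n / n) atTop (nhds 0)) (h0 : s 0 = 0) {η : ℝ} (hη : 0 < η) :
    ∀ᶠ n : ℕ in atTop, ∀ N ≤ n, |s N| ≤ η * n := by
  have h1 := (Metric.tendsto_atTop.1 hs) η hη
  obtain ⟨N₀, hN₀⟩ := h1
  obtain ⟨M, hM⟩ : ∃ M : ℝ, ∀ N < N₀, |s N| ≤ M :=
    ⟨∑ i ∈ Finset.range N₀, |s i|, fun N hN => Finset.single_le_sum (f := fun i => |s i|)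
      (fun i _ => abs_nonneg _) (Finset.mem_range.2 hN)⟩
  have h2 : ∀ᶠ n : ℕ in atTop, M ≤ η * n :=
    (tendsto_natCast_atTop_atTop.const_mul_atTop hη).eventually_ge_atTop M
  filter_upwards [h2] with n hn N hN
  by_cases hlt : N < N₀
  · exact (hM N hlt).trans hn
  · rcases Nat.eq_zero_or_pos N with rfl | hpos
    · rw [h0, abs_zero]; positivity
    · have h3 := hN₀ N (not_lt.1 hlt)
      have hNp : (0:ℝ) < N := by exact_mod_cast hpos
      rw [Real.dist_eq, sub_zero, abs_div, abs_of_pos hNp, div_lt_iff₀ hNp] at h3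
      refine h3.le.trans (mul_le_mul_of_nonneg_left ?_ hη.le)
      exact_mod_cast hN

theorem eventually_forall_abs_sum_le {m : ℕ} (hm : 0 < m) {a : ℕ → ℝ}
    (h : ∀ b < m, Tendsto (fun n : ℕ => (∑ i ∈ Finset.range n, a (m * i + b)) / n) atTop (nhds 0))
    {η : ℝ} (hη : 0 < η) :
    ∀ᶠ n : ℕ in atTop, ∀ N ≤ n, |∑ t ∈ Finset.range N, a t| ≤ η * n := by
  have hm0 : (0:ℝ) < m := by exact_mod_cast hm
  have h1 : ∀ᶠ n : ℕ in atTop, ∀ b ∈ Finset.range m, ∀ N ≤ n,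
      |∑ i ∈ Finset.range N, a (m * i + b)| ≤ η / m * n := by
    rw [eventually_all_finset]
    intro b hb
    exact eventually_forall_le_of_tendsto_zero
      (s := fun N => ∑ i ∈ Finset.range N, a (m * i + b)) (h b (Finset.mem_range.1 hb)) (by simp)
      (by positivity)
  filter_upwards [h1] with n hn N hN
  have hdm := Nat.div_add_mod N m
  have hlt := Nat.mod_lt N hm
  rw [← hdm, sum_range_mul_add a _ _ hlt.le]
  refine (Finset.abs_sum_le_sum_abs _ _).trans ?_
  calc _ ≤ ∑ _b ∈ Finset.range m, η / m * n := by
        refine Finset.sum_le_sum fun b hb => hn b hb _ ?_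
        have h2 : N / m ≤ m * (N / m) := Nat.le_mul_of_pos_left _ hm
        split_ifs with hbR <;> omega
    _ = η * n := by
        rw [Finset.sum_const, Finset.card_range, nsmul_eq_mul]; field_simp

end Averages

/-! ### Laws of large numbers for functionals of the past. -/

section LawOfLargeNumbers

variable {Ω : Type*} [mΩ : MeasurableSpace Ω] {μ : Measure Ω} [IsProbabilityMeasure μ]

/-- The strong law for functionals of finitely many coordinates of an i.i.d. sequence, uniformly
over the initial segments. -/
theorem ae_eventually_forall_abs_sum_le {ε : ℤ → Ω → ℝ} (hε : ∀ t, Measurable (ε t))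
    (hi : iIndepFun ε μ) (hid : ∀ t, IdentDistrib (ε t) (ε 0) μ μ) {H : (ℕ → ℝ) → ℝ} {m : ℕ}
    (hH : Measurable[firstCoords m] H) (hint : Integrable (fun ω => H (past ε 0 ω)) μ) {η : ℝ}
    (hη : 0 < η) :
    ∀ᵐ ω ∂μ, ∀ᶠ n : ℕ in atTop, ∀ N ≤ n,
      |∑ i ∈ Finset.range N, (H (past ε ((i : ℤ) + 1) ω) - ∫ ω', H (past ε 0 ω') ∂μ)| ≤ η * n := by
  have hHm : Measurable H := hH.mono (firstCoords.le m) le_rfl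
  set c := ∫ ω', H (past ε 0 ω') ∂μ with hc
  have hident : ∀ s t : ℤ, IdentDistrib (fun ω => H (past ε s ω) - c)
      (fun ω => H (past ε t ω) - c) μ μ := fun s t =>
    (identDistrib_past hε hi hid s t).comp (hHm.sub_const c)
  -- Times `m + 1` apart have disjoint windows of `m` innovations, so along one residue class the
  -- variables are pairwise independent. With `m + 1` in place of `m` the modulus is positive even
  -- if `m = 0`.
  have hSLLN : ∀ b : ℕ, ∀ᵐ ω ∂μ, Tendsto (fun n : ℕ =>
      (∑ i ∈ Finset.range n, (H (past ε (((m + 1) * i + b : ℕ) + 1 : ℤ) ω) - c)) / n)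
      atTop (nhds 0) := by
    intro b
    have hint0 : Integrable (fun ω => H (past ε (((m + 1) * 0 + b : ℕ) + 1 : ℤ) ω) - c) μ :=
      (hident _ 0).integrable_iff.2 (hint.sub (integrable_const c))
    have h1 := strong_law_ae_real
      (fun (i : ℕ) ω => H (past ε (((m + 1) * i + b : ℕ) + 1 : ℤ) ω) - c) hint0 ?_
      (fun i => hident _ _)
    · have h2 : μ[fun ω => H (past ε (((m + 1) * 0 + b : ℕ) + 1 : ℤ) ω) - c] = 0 := by
        rw [(hident _ 0).integral_eq, integral_sub hint (integrable_const c)]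
        simp [hc]
      rwa [h2] at h1
    · intro i j hij
      have hmeas : ∀ i : ℕ, Measurable[sigmaOn ε (Set.Ioc ((((m + 1) * i + b : ℕ) : ℤ) + 1 - m)
          ((((m + 1) * i + b : ℕ) : ℤ) + 1))]
          (fun ω => H (past ε (((m + 1) * i + b : ℕ) + 1 : ℤ) ω) - c) := by
        intro i
        refine Measurable.sub_const ?_ c
        refine hH.comp (measurable_past_firstCoords ε fun l hl => ?_)
        simp only [Set.mem_Ioc]
        omega
      refine (IndepFun_iff_Indep _ _ _).2 ?_
      refine indep_of_indep_of_le_left (indep_of_indep_of_le_right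
        (indep_sigmaOn hε hi ?_) (hmeas j).comap_le) (hmeas i).comap_le
      rw [Set.disjoint_left]
      intro x hx hx'
      simp only [Set.mem_Ioc] at hx hx'
      push_cast at hx hx'
      rcases lt_or_gt_of_ne hij with h | h
      · have h3 : (i : ℤ) + 1 ≤ j := by exact_mod_cast h
        have : ((m : ℤ) + 1) * (i + 1) ≤ (m + 1) * j := mul_le_mul_of_nonneg_left h3 (by omega)
        rw [mul_add] at this
        linarith [hx.2, hx'.1]
      · have h3 : (j : ℤ) + 1 ≤ i := by exact_mod_cast h
        have : ((m : ℤ) + 1) * (j + 1) ≤ (m + 1) * i := mul_le_mul_of_nonneg_left h3 (by omega)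
        rw [mul_add] at this
        linarith [hx.1, hx'.2]
  filter_upwards [ae_all_iff.2 hSLLN] with ω hω
  refine eventually_forall_abs_sum_le (m := m + 1) (by omega)
    (a := fun i : ℕ => H (past ε ((i : ℤ) + 1) ω) - c) (fun b _ => ?_) hη
  exact hω b

/-- By Lévy's upward theorem, conditional expectations given the first `m` coordinates converge in
`L¹`. -/
theorem exists_firstCoords_approx {ν : Measure (ℕ → ℝ)} [IsFiniteMeasure ν] {F : (ℕ → ℝ) → ℝ}
    (hF : Measurable F) (hint : Integrable F ν) {δ : ENNReal} (hδ : 0 < δ) :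
    ∃ m, ∃ H : (ℕ → ℝ) → ℝ, Measurable[firstCoords m] H ∧ Integrable H ν ∧
      ∫⁻ e, ENNReal.ofReal |F e - H e| ∂ν ≤ δ := by
  have h := hint.tendsto_eLpNorm_condExp (ℱ := firstCoords)
    (by rw [iSup_firstCoords]; exact hF.stronglyMeasurable)
  obtain ⟨m, hm⟩ := (h.eventually (ge_mem_nhds hδ)).exists
  refine ⟨m, ν[F | firstCoords m], stronglyMeasurable_condExp.measurable, integrable_condExp, ?_⟩
  rw [eLpNorm_one_eq_lintegral_enorm] at hm
  refine le_trans (le_of_eq (lintegral_congr fun e => ?_)) hm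
  rw [Pi.sub_apply, ← Real.enorm_eq_ofReal_abs, ← enorm_neg, neg_sub]

/-- The weak law of large numbers for integrable functionals of the past of an i.i.d. sequence,
uniformly over the initial segments. -/
theorem tendsto_measure_sum_past {ε : ℤ → Ω → ℝ} (hε : ∀ t, Measurable (ε t))
    (hi : iIndepFun ε μ) (hid : ∀ t, IdentDistrib (ε t) (ε 0) μ μ) {F : (ℕ → ℝ) → ℝ}
    (hF : Measurable F) (hint : Integrable (fun ω => F (past ε 0 ω)) μ) {η : ℝ} (hη : 0 < η) :
    Tendsto (fun n : ℕ => μ {ω | ∃ N ≤ n, η * n <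
      |∑ i ∈ Finset.range N, (F (past ε ((i : ℤ) + 1) ω) - ∫ ω', F (past ε 0 ω') ∂μ)|})
      atTop (nhds 0) := by
  have hp := measurable_past hε
  set ν := μ.map (past ε 0) with hν
  have : IsProbabilityMeasure ν := Measure.isProbabilityMeasure_map (hp 0).aemeasurable
  rw [ENNReal.tendsto_nhds_zero]
  intro τ hτ
  wlog hτ1 : τ ≤ 1 generalizing τ
  · filter_upwards [this 1 one_pos le_rfl] with n hn
    exact hn.trans (not_le.1 hτ1).le
  have hτtop : τ ≠ ⊤ := ne_top_of_le_ne_top ENNReal.one_ne_top hτ1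
  -- Chosen so that `n κ = (η n / 4) (τ / 2)`, as the Markov bound for `D n` requires. Together with
  -- `τ ≤ 1` it also keeps the difference of the two means below `η / 4`.
  set κ : ℝ := η * τ.toReal / 8 with hκ
  have hτr : 0 < τ.toReal := ENNReal.toReal_pos hτ.ne' hτtop
  have hτr1 : τ.toReal ≤ 1 := by
    simpa using ENNReal.toReal_mono ENNReal.one_ne_top hτ1
  have hκ0 : 0 < κ := by positivity
  obtain ⟨m, H, hH, hHint, hFH⟩ := exists_firstCoords_approx (ν := ν) hF
    ((integrable_map_measure hF.aestronglyMeasurable (hp 0).aemeasurable).2 hint)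
    (ENNReal.ofReal_pos.2 hκ0)
  have hHm : Measurable H := hH.mono (firstCoords.le m) le_rfl
  have hHint' : Integrable (fun ω => H (past ε 0 ω)) μ :=
    (integrable_map_measure hHm.aestronglyMeasurable (hp 0).aemeasurable).1 hHint
  set c := ∫ ω', F (past ε 0 ω') ∂μ with hc
  set c' := ∫ ω', H (past ε 0 ω') ∂μ with hc'
  have hdist : ∀ t : ℤ, ∫⁻ ω, ENNReal.ofReal |F (past ε t ω) - H (past ε t ω)| ∂μ ≤
      ENNReal.ofReal κ := by
    intro t
    have hm' : Measurable fun e => ENNReal.ofReal |F e - H e| := by fun_prop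
    rw [lintegral_map hm' (hp 0)] at hFH
    have := ((identDistrib_past hε hi hid t 0).comp hm').lintegral_eq
    exact (le_of_eq this).trans hFH
  have hcc : |c - c'| ≤ η / 4 := by
    rw [hc, hc', ← integral_sub hint hHint']
    refine abs_integral_le_integral_abs.trans ?_
    rw [integral_eq_lintegral_of_nonneg_ae (Eventually.of_forall fun _ => abs_nonneg _)
      (by fun_prop)]
    have := ENNReal.toReal_mono ENNReal.ofReal_ne_top (hdist 0)
    rw [ENNReal.toReal_ofReal hκ0.le] at this
    refine this.trans ?_
    rw [hκ]
    nlinarith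
  -- the exceptional sets for the approximation
  set A : ℕ → Set Ω := fun n => {ω | ∃ N ≤ n, η / 4 * n <
    |∑ i ∈ Finset.range N, (H (past ε ((i : ℤ) + 1) ω) - c')|} with hA
  have hAm : ∀ n, MeasurableSet (A n) := by
    intro n
    have : A n = ⋃ N ∈ Finset.range (n + 1), {ω | η / 4 * n <
        |∑ i ∈ Finset.range N, (H (past ε ((i : ℤ) + 1) ω) - c')|} := by
      ext ω
      simp [hA]
    rw [this]
    refine Finset.measurableSet_biUnion _ fun N _ => measurableSet_lt measurable_const ?_
    have hm' : ∀ i : ℕ, Measurable fun ω => H (past ε ((i : ℤ) + 1) ω) - c' :=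
      fun i => (hHm.comp (hp _)).sub_const c'
    exact (Finset.measurable_fun_sum _ fun i _ => hm' i).abs
  have hA0 : Tendsto (fun n => μ (A n)) atTop (nhds 0) := by
    have := tendsto_measure_of_ae_tendsto_indicator_of_isFiniteMeasure (μ := μ) atTop
      (A := (∅ : Set Ω)) MeasurableSet.empty hAm ?_
    · simpa using this
    · filter_upwards [ae_eventually_forall_abs_sum_le hε hi hid hH hHint'
        (show 0 < η / 4 by positivity)] with ω hω
      filter_upwards [hω] with n hn
      simp only [hA, Set.mem_ofPred_eq, Set.mem_empty_iff_false, iff_false, not_exists, not_and,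
        not_lt]
      exact hn
  -- Summing the absolute errors of all `n` terms controls every initial segment `N ≤ n` at once.
  set D : ℕ → Set Ω := fun n => {ω | ENNReal.ofReal (η / 4 * n) ≤
    ∑ i ∈ Finset.range n, ENNReal.ofReal |F (past ε ((i : ℤ) + 1) ω) - H (past ε ((i : ℤ) + 1) ω)|}
    with hD
  have hDb : ∀ n, 0 < n → μ (D n) ≤ τ / 2 := by
    intro n hn
    have hn0 : (0:ℝ) < n := by exact_mod_cast hn
    have hm' : ∀ i : ℕ, Measurable fun ω => ENNReal.ofReal
        |F (past ε ((i : ℤ) + 1) ω) - H (past ε ((i : ℤ) + 1) ω)| := fun i =>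
      ENNReal.measurable_ofReal.comp (((hF.comp (hp _)).sub (hHm.comp (hp _))).abs)
    have h1 := mul_meas_ge_le_lintegral₀ (μ := μ)
      (Finset.measurable_fun_sum (Finset.range n) fun i _ => hm' i).aemeasurable
      (ENNReal.ofReal (η / 4 * n))
    rw [lintegral_finsetSum _ fun i _ => hm' i] at h1
    have h2 := h1.trans (Finset.sum_le_sum fun i _ => hdist ((i : ℤ) + 1))
    rw [Finset.sum_const, Finset.card_range, nsmul_eq_mul] at h2
    have h3 : (n : ENNReal) * ENNReal.ofReal κ = ENNReal.ofReal (η / 4 * n) * (τ / 2) := by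
      rw [← ENNReal.ofReal_toReal hτtop, ← ENNReal.ofReal_natCast,
        ← ENNReal.ofReal_mul hn0.le, show (2 : ENNReal) = ENNReal.ofReal 2 by simp,
        ← ENNReal.ofReal_div_of_pos two_pos, ← ENNReal.ofReal_mul (by positivity)]
      congr 1
      rw [hκ]
      ring
    rw [h3] at h2
    have h4 : ENNReal.ofReal (η / 4 * n) ≠ 0 := (ENNReal.ofReal_pos.2 (by positivity)).ne'
    exact (ENNReal.mul_le_mul_iff_right h4 ENNReal.ofReal_ne_top).1 h2
  have hτ2 : 0 < τ / 2 := ENNReal.half_pos hτ.ne'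
  filter_upwards [hA0.eventually (ge_mem_nhds hτ2), eventually_gt_atTop 0] with n hn hn0
  have hnp : (0:ℝ) < n := by exact_mod_cast hn0
  calc _ ≤ μ (A n ∪ D n) := by
        refine measure_mono fun ω hω => ?_
        obtain ⟨N, hN, hlt⟩ := hω
        by_contra hcon
        simp only [Set.mem_union, not_or] at hcon
        obtain ⟨h1, h2⟩ := hcon
        have h1' : |∑ i ∈ Finset.range N, (H (past ε ((i : ℤ) + 1) ω) - c')| ≤ η / 4 * n := by
          by_contra hh
          exact h1 ⟨N, hN, not_le.1 hh⟩
        have h2' : ∑ i ∈ Finset.range n, |F (past ε ((i : ℤ) + 1) ω) - H (past ε ((i : ℤ) + 1) ω)|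
            < η / 4 * n := by
          have : ¬ (ENNReal.ofReal (η / 4 * n) ≤ _) := h2
          rw [← ENNReal.ofReal_sum_of_nonneg fun i _ => abs_nonneg _, not_le] at this
          exact (ENNReal.ofReal_lt_ofReal_iff_of_nonneg
            (Finset.sum_nonneg fun i _ => abs_nonneg _)).1 this
        have h3 : ∑ i ∈ Finset.range N, (F (past ε ((i : ℤ) + 1) ω) - c) =
            ∑ i ∈ Finset.range N, (H (past ε ((i : ℤ) + 1) ω) - c') +
            ∑ i ∈ Finset.range N, (F (past ε ((i : ℤ) + 1) ω) - H (past ε ((i : ℤ) + 1) ω)) +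
            N * (c' - c) := by
          rw [← Finset.sum_add_distrib, ← nsmul_eq_mul, ← Finset.card_range N,
            ← Finset.sum_const, Finset.card_range, ← Finset.sum_add_distrib]
          refine Finset.sum_congr rfl fun i _ => by ring
        have h4 : |∑ i ∈ Finset.range N,
            (F (past ε ((i : ℤ) + 1) ω) - H (past ε ((i : ℤ) + 1) ω))| ≤ η / 4 * n := by
          refine (Finset.abs_sum_le_sum_abs _ _).trans (le_trans ?_ h2'.le)
          exact Finset.sum_le_sum_of_subset_of_nonneg (Finset.range_subset_range.2 hN)
            fun i _ _ => abs_nonneg _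
        have h5 : |(N : ℝ) * (c' - c)| ≤ η / 4 * n := by
          rw [abs_mul, Nat.abs_cast, abs_sub_comm]
          have hNn : (N : ℝ) ≤ n := by exact_mod_cast hN
          calc _ ≤ (n : ℝ) * (η / 4) := mul_le_mul hNn hcc (abs_nonneg _) hnp.le
            _ = _ := by ring
        rw [h3] at hlt
        have h6 := abs_add_three (∑ i ∈ Finset.range N, (H (past ε ((i : ℤ) + 1) ω) - c'))
          (∑ i ∈ Finset.range N, (F (past ε ((i : ℤ) + 1) ω) - H (past ε ((i : ℤ) + 1) ω)))
          (N * (c' - c))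
        have h7 : 0 < η * n := by positivity
        linarith
    _ ≤ μ (A n) + μ (D n) := measure_union_le _ _
    _ ≤ τ / 2 + τ / 2 := add_le_add hn (hDb n hn0)
    _ = τ := ENNReal.add_halves τ

end LawOfLargeNumbers

/-! ### Products of the random matrices of the recursion. -/

section MatrixProducts

variable {p q : ℕ}

/-- The product `A(e_0) A(e_1) ⋯ A(e_{l-1})`. -/
noncomputable def backProd (θ : Param p q) :
    (ℕ → ℝ) → ℕ → Matrix (Fin p ⊕ Fin q) (Fin p ⊕ Fin q) ℝ
  | _, 0 => 1
  | e, l + 1 => recMatrix θ (e 0) * backProd θ (fun i => e (i + 1)) l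

theorem backProd_add (θ : Param p q) (e : ℕ → ℝ) (l m : ℕ) :
    backProd θ e (l + m) = backProd θ e l * backProd θ (fun i => e (i + l)) m := by
  induction l generalizing e with
  | zero => simp [backProd]
  | succ l ih =>
    rw [show l + 1 + m = (l + m) + 1 by ring, backProd, backProd, ih, Matrix.mul_assoc]
    congr 3

theorem backProd_succ (θ : Param p q) (e : ℕ → ℝ) (l : ℕ) :
    backProd θ e (l + 1) = backProd θ e l * recMatrix θ (e l) := by
  rw [backProd_add]
  simp [backProd]

/-- Reading the innovations backwards from time `n` expresses the matrix product as a functional of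
the past at time `n`. -/
theorem recMatrixProd_eq_backProd (θ : Param p q) (e : ℤ → ℝ) (n : ℕ) :
    recMatrixProd θ e n = backProd θ (fun i => e (n - i)) n := by
  induction n with
  | zero => rfl
  | succ n ih =>
    rw [recMatrixProd, backProd, ih]
    congr 2
    ext i; congr 1; push_cast; ring

theorem lagCoef_nonneg {θ : Param p q} (hθ : ∀ j, 0 ≤ θ j) (i : Fin p ⊕ Fin q) :
    0 ≤ lagCoef θ i := by
  cases i <;> exact hθ _

theorem recMatrix_nonneg {θ : Param p q} (hθ : ∀ j, 0 ≤ θ j) (e : ℝ) (i j : Fin p ⊕ Fin q) :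
    0 ≤ recMatrix θ e i j := by
  have h := lagCoef_nonneg hθ
  rcases i with i | i <;> rcases j with j | j <;> simp only [recMatrix] <;> split_ifs <;>
    first
    | exact mul_nonneg (sq_nonneg _) (h _)
    | exact h _
    | norm_num

theorem backProd_nonneg {θ : Param p q} (hθ : ∀ j, 0 ≤ θ j) (e : ℕ → ℝ) (l : ℕ)
    (i j : Fin p ⊕ Fin q) : 0 ≤ backProd θ e l i j := by
  induction l generalizing e i j with
  | zero =>
    rw [backProd, Matrix.one_apply]
    split_ifs <;> norm_num
  | succ l ih =>
    rw [backProd, Matrix.mul_apply]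
    exact Finset.sum_nonneg fun k _ => mul_nonneg (recMatrix_nonneg hθ _ _ _) (ih _ _ _)

theorem measurable_recMatrix (θ : Param p q) (i j : Fin p ⊕ Fin q) :
    Measurable fun e => recMatrix θ e i j := by
  rcases i with i | i <;> rcases j with j | j <;> simp only [recMatrix] <;> split_ifs <;> fun_prop

theorem measurable_backProd (θ : Param p q) {Ω : Type*} {mΩ : MeasurableSpace Ω} (l : ℕ)
    {f : Ω → ℕ → ℝ} (hf : ∀ i < l, Measurable fun ω => f ω i) (i j : Fin p ⊕ Fin q) :
    Measurable fun ω => backProd θ (f ω) l i j := by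
  induction l generalizing f i j with
  | zero => exact measurable_const
  | succ l ih =>
    simp only [backProd, Matrix.mul_apply]
    refine Finset.measurable_fun_sum _ fun k _ => Measurable.mul ?_ ?_
    · exact (measurable_recMatrix θ i k).comp (hf 0 (by omega))
    · exact ih (f := fun ω i => f ω (i + 1)) (fun i hi => hf (i + 1) (by omega)) k j

theorem entryNorm_nonneg {ι : Type*} [Fintype ι] (M : Matrix ι ι ℝ) : 0 ≤ entryNorm M :=
  Finset.sum_nonneg fun _ _ => Finset.sum_nonneg fun _ _ => abs_nonneg _

theorem entryNorm_mul_le {ι : Type*} [Fintype ι] (M N : Matrix ι ι ℝ) :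
    entryNorm (M * N) ≤ entryNorm M * entryNorm N := by
  unfold entryNorm
  calc ∑ i, ∑ j, |(M * N) i j| ≤ ∑ i, ∑ j, ∑ k, |M i k| * |N k j| := by
        refine Finset.sum_le_sum fun i _ => Finset.sum_le_sum fun j _ => ?_
        rw [Matrix.mul_apply]
        refine (Finset.abs_sum_le_sum_abs _ _).trans (le_of_eq ?_)
        simp only [abs_mul]
    _ = ∑ i, ∑ k, |M i k| * ∑ j, |N k j| := by
        refine Finset.sum_congr rfl fun i _ => ?_
        rw [Finset.sum_comm]
        simp only [Finset.mul_sum]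
    _ ≤ ∑ i, ∑ k, |M i k| * ∑ k, ∑ j, |N k j| := by
        refine Finset.sum_le_sum fun i _ => Finset.sum_le_sum fun k _ => ?_
        refine mul_le_mul_of_nonneg_left ?_ (abs_nonneg _)
        exact Finset.single_le_sum (f := fun k => ∑ j, |N k j|)
          (fun k _ => Finset.sum_nonneg fun _ _ => abs_nonneg _) (Finset.mem_univ k)
    _ = _ := by simp only [Finset.sum_mul]

theorem mulVec_le_entryNorm_mul {ι : Type*} [Fintype ι] {M : Matrix ι ι ℝ} {y : ι → ℝ}
    (hy : ∀ i, 0 ≤ y i) (i : ι) : M.mulVec y i ≤ entryNorm M * ∑ j, y j := by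
  have h1 : ∀ j, y j ≤ ∑ j, y j := fun j =>
    Finset.single_le_sum (fun j _ => hy j) (Finset.mem_univ j)
  have h2 : ∑ j, |M i j| ≤ entryNorm M :=
    Finset.single_le_sum (f := fun i => ∑ j, |M i j|)
      (fun i _ => Finset.sum_nonneg fun _ _ => abs_nonneg _) (Finset.mem_univ i)
  calc M.mulVec y i = ∑ j, M i j * y j := rfl
    _ ≤ ∑ j, |M i j| * ∑ j, y j := by
        refine Finset.sum_le_sum fun j _ => ?_
        exact mul_le_mul (le_abs_self _) (h1 j) (hy j) (abs_nonneg _)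
    _ = (∑ j, |M i j|) * ∑ j, y j := by rw [Finset.sum_mul]
    _ ≤ _ := mul_le_mul_of_nonneg_right h2 (Finset.sum_nonneg fun j _ => hy j)

theorem exists_entryNorm_recMatrix_le (θ : Param p q) :
    ∃ C : ℝ, 0 ≤ C ∧ ∀ e, entryNorm (recMatrix θ e) ≤ C * (1 + e ^ 2) := by
  have h : ∀ i j, ∃ C : ℝ, 0 ≤ C ∧ ∀ e, |recMatrix θ e i j| ≤ C * (1 + e ^ 2) := by
    intro i j
    refine ⟨1 + |lagCoef θ j|, by positivity, fun e => ?_⟩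
    have h0 := abs_nonneg (lagCoef θ j)
    have h1 := sq_nonneg e
    have h2 : (1 + |lagCoef θ j|) * (1 + e ^ 2) = 1 + |lagCoef θ j| + e ^ 2 +
      |lagCoef θ j| * e ^ 2 := by ring
    have h3 : 0 ≤ |lagCoef θ j| * e ^ 2 := by positivity
    rw [h2]
    rcases i with i | i <;> rcases j with j | j <;> simp only [recMatrix] <;> split_ifs <;>
      (try simp only [abs_mul, abs_one, abs_zero, abs_of_nonneg h1]) <;> linarith
  choose C hC0 hC using h
  refine ⟨∑ i, ∑ j, C i j, Finset.sum_nonneg fun i _ => Finset.sum_nonneg fun j _ => hC0 i j,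
    fun e => ?_⟩
  unfold entryNorm
  simp only [Finset.sum_mul]
  exact Finset.sum_le_sum fun i _ => Finset.sum_le_sum fun j _ => hC i j e

end MatrixProducts

/-! ### From a negative Lyapunov exponent to summable small moments. -/

section Moments

/-- Division with remainder by `n` gives `u (j n + r) ≤ (u n)^j u r`: finitely many geometric
series. -/
theorem tsum_ne_top_of_submultiplicative {u : ℕ → ENNReal} (hu : ∀ l m, u (l + m) ≤ u l * u m)
    (hfin : ∀ l, u l ≠ ⊤) {n : ℕ} (hn : 0 < n) (h1 : u n < 1) : ∑' l, u l ≠ ⊤ := by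
  have : NeZero n := ⟨hn.ne'⟩
  have hpow : ∀ j r, u (j * n + r) ≤ u n ^ j * u r := by
    intro j
    induction j with
    | zero => intro r; simp
    | succ j ih =>
      intro r
      rw [show (j + 1) * n + r = n + (j * n + r) by ring, pow_succ']
      calc _ ≤ u n * u (j * n + r) := hu _ _
        _ ≤ u n * (u n ^ j * u r) := by gcongr; exact ih r
        _ = _ := by ring
  rw [← (Nat.divModEquiv n).symm.tsum_eq, ENNReal.tsum_prod']
  refine ne_top_of_le_ne_top ?_ (ENNReal.tsum_le_tsum fun j => ENNReal.tsum_le_tsum fun r =>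
    (show u ((Nat.divModEquiv n).symm (j, r)) ≤ u n ^ j * u r from ?_))
  · simp only [ENNReal.tsum_mul_left, ENNReal.tsum_mul_right, ENNReal.tsum_geometric]
    refine ENNReal.mul_ne_top (ENNReal.inv_ne_top.2 (tsub_pos_of_lt h1).ne') ?_
    rw [tsum_fintype]
    exact ENNReal.sum_ne_top.2 fun r _ => hfin _
  · have := hpow j r
    simpa [Nat.divModEquiv, mul_comm, add_comm] using this

theorem rpow_tsum_le_tsum_rpow {ι : Type*} (f : ι → ENNReal) {s : ℝ} (hs : 0 < s) (hs1 : s ≤ 1) :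
    (∑' i, f i) ^ s ≤ ∑' i, f i ^ s := by
  classical
  have hfin : ∀ F : Finset ι, (∑ i ∈ F, f i) ^ s ≤ ∑ i ∈ F, f i ^ s := by
    intro F
    induction F using Finset.induction_on with
    | empty => simp [hs]
    | insert i F hi ih =>
      rw [Finset.sum_insert hi, Finset.sum_insert hi]
      exact (ENNReal.rpow_add_le_add_rpow _ _ hs.le hs1).trans (add_le_add le_rfl ih)
  have h : ∑' i, f i ≤ (∑' i, f i ^ s) ^ (1 / s) := by
    rw [ENNReal.tsum_eq_iSup_sum]
    refine iSup_le fun F => ?_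
    rw [one_div, ENNReal.le_rpow_inv_iff hs]
    exact (hfin F).trans (ENNReal.sum_le_tsum F)
  rwa [one_div, ENNReal.le_rpow_inv_iff hs] at h

variable {Ω : Type*} [mΩ : MeasurableSpace Ω] {μ : Measure Ω}

/-- If `E log Z < 0`, then `E Z^s < 1` for some `0 < s ≤ 1`. -/
theorem exists_rpow_lintegral_lt_one [IsProbabilityMeasure μ] {Z : Ω → ℝ} (hZ : Measurable Z) (h0 : ∀ ω, 0 ≤ Z ω)
    (hint : Integrable Z μ) (hlog : ∫ ω, Real.log (Z ω) ∂μ < 0) :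
    ∃ s : ℝ, 0 < s ∧ s ≤ 1 ∧ ∫⁻ ω, ENNReal.ofReal (Z ω) ^ s ∂μ < 1 := by
  -- The integral of a non-integrable function is `0` by convention, so a negative integral
  -- certifies integrability.
  have hlogint : Integrable (fun ω => Real.log (Z ω)) μ := by
    by_contra h
    rw [integral_undef h] at hlog
    exact lt_irrefl _ hlog
  -- Difference quotients of `s ↦ Z^s` at `0` with step `1 / (n + 1)`. They lie between `log Z` and
  -- `1 + Z` and tend to `log Z`; the value `0` at `Z = 0` matches `Real.log 0 = 0`.
  set φ : ℕ → Ω → ℝ := fun n ω => if Z ω = 0 then 0 else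
    (Z ω ^ (1 / ((n : ℝ) + 1)) - 1) * ((n : ℝ) + 1) with hφ
  have hmeas : ∀ n, Measurable (φ n) := fun n =>
    Measurable.ite (measurableSet_eq_fun hZ measurable_const) measurable_const (by fun_prop)
  have hbound : ∀ n ω, Real.log (Z ω) ≤ φ n ω ∧ φ n ω ≤ 1 + Z ω := by
    intro n ω
    simp only [hφ]
    split_ifs with hz
    · simp [hz]
    · have hzp : 0 < Z ω := lt_of_le_of_ne (h0 ω) (Ne.symm hz)
      have hn : (0:ℝ) < (n : ℝ) + 1 := by positivity
      constructor
      · have h1 := Real.log_le_sub_one_of_pos (Real.rpow_pos_of_pos hzp (1 / ((n : ℝ) + 1)))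
        rw [Real.log_rpow hzp] at h1
        have h2 := mul_le_mul_of_nonneg_right h1 hn.le
        calc Real.log (Z ω) = 1 / ((n : ℝ) + 1) * Real.log (Z ω) * ((n : ℝ) + 1) := by field_simp
          _ ≤ _ := h2
      · have h1 : Z ω ^ (1 / ((n : ℝ) + 1)) ≤ 1 + 1 / ((n : ℝ) + 1) * (Z ω - 1) := by
          have := rpow_one_add_le_one_add_mul_self (s := Z ω - 1) (by linarith)
            (p := 1 / ((n : ℝ) + 1)) (by positivity)
            (by rw [div_le_one hn]; linarith [(Nat.cast_nonneg n : (0:ℝ) ≤ n)])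
          simpa using this
        have h2 : (Z ω ^ (1 / ((n : ℝ) + 1)) - 1) * ((n : ℝ) + 1) ≤
            (1 / ((n : ℝ) + 1) * (Z ω - 1)) * ((n : ℝ) + 1) :=
          mul_le_mul_of_nonneg_right (by linarith) hn.le
        have h3 : (1 / ((n : ℝ) + 1) * (Z ω - 1)) * ((n : ℝ) + 1) = Z ω - 1 := by field_simp
        linarith
  have hlim : ∀ ω, Tendsto (fun n => φ n ω) atTop (nhds (Real.log (Z ω))) := by
    intro ω
    simp only [hφ]
    split_ifs with hz
    · simp [hz]
    · have hzp : 0 < Z ω := lt_of_le_of_ne (h0 ω) (Ne.symm hz)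
      have hd : HasDerivAt (fun x : ℝ => Z ω ^ x) (Real.log (Z ω)) 0 := by
        simpa using Real.hasStrictDerivAt_const_rpow hzp 0 |>.hasDerivAt
      have h1 := hd.tendsto_slope_zero_right
      have h2 : Tendsto (fun n : ℕ => 1 / ((n : ℝ) + 1)) atTop (nhdsWithin 0 (Set.Ioi 0)) :=
        tendsto_nhdsWithin_iff.2 ⟨tendsto_one_div_add_atTop_nhds_zero_nat,
          Eventually.of_forall fun n => by simp only [Set.mem_Ioi]; positivity⟩
      refine (h1.comp h2).congr fun n => ?_
      simp [mul_comm]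
  have hconv : Tendsto (fun n => ∫ ω, φ n ω ∂μ) atTop (nhds (∫ ω, Real.log (Z ω) ∂μ)) := by
    refine tendsto_integral_of_dominated_convergence (fun ω => |Real.log (Z ω)| + (1 + Z ω))
      (fun n => (hmeas n).aestronglyMeasurable)
      (hlogint.abs.add ((integrable_const 1).add hint)) (fun n => ?_)
      (Eventually.of_forall hlim)
    refine Eventually.of_forall fun ω => ?_
    obtain ⟨h1, h2⟩ := hbound n ω
    rw [Real.norm_eq_abs, abs_le]
    have := neg_abs_le (Real.log (Z ω))
    have := abs_nonneg (Real.log (Z ω))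
    have := h0 ω
    constructor <;> linarith
  obtain ⟨n, hn⟩ := (hconv.eventually (gt_mem_nhds hlog)).exists
  have hn1 : (0:ℝ) < (n : ℝ) + 1 := by positivity
  set s := 1 / ((n : ℝ) + 1) with hs
  have hs0 : 0 < s := by positivity
  have hs1 : s ≤ 1 := by rw [hs, div_le_one hn1]; linarith [(Nat.cast_nonneg n : (0:ℝ) ≤ n)]
  refine ⟨s, hs0, hs1, ?_⟩
  have hZs : ∀ ω, Z ω ^ s ≤ 1 + φ n ω * s := by
    intro ω
    simp only [hφ]
    split_ifs with hz
    · rw [hz, Real.zero_rpow hs0.ne']; norm_num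
    · rw [mul_assoc, show ((n : ℝ) + 1) * s = 1 by rw [hs]; field_simp]
      simp [hs]
  have hφint : Integrable (φ n) μ := by
    refine Integrable.mono' (hlogint.abs.add ((integrable_const 1).add hint))
      (hmeas n).aestronglyMeasurable (Eventually.of_forall fun ω => ?_)
    obtain ⟨h1, h2⟩ := hbound n ω
    rw [Real.norm_eq_abs, abs_le]
    have := neg_abs_le (Real.log (Z ω))
    have := abs_nonneg (Real.log (Z ω))
    have := h0 ω
    simp only [Pi.add_apply]
    constructor <;> linarith
  have hZsint : Integrable (fun ω => Z ω ^ s) μ := by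
    refine Integrable.mono' (((integrable_const 1).add (hφint.mul_const s)))
      (hZ.pow_const s).aestronglyMeasurable (Eventually.of_forall fun ω => ?_)
    rw [Real.norm_eq_abs, abs_of_nonneg (Real.rpow_nonneg (h0 ω) s)]
    exact hZs ω
  have hlt : ∫ ω, Z ω ^ s ∂μ < 1 := by
    calc ∫ ω, Z ω ^ s ∂μ ≤ ∫ ω, (1 + φ n ω * s) ∂μ :=
          integral_mono hZsint ((integrable_const 1).add (hφint.mul_const s)) hZs
      _ = 1 + (∫ ω, φ n ω ∂μ) * s := by
          rw [integral_add (integrable_const 1) (hφint.mul_const s), integral_mul_const]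
          simp
      _ < 1 := by nlinarith
  calc ∫⁻ ω, ENNReal.ofReal (Z ω) ^ s ∂μ = ∫⁻ ω, ENNReal.ofReal (Z ω ^ s) ∂μ :=
        lintegral_congr fun ω => (ENNReal.ofReal_rpow_of_nonneg (h0 ω) hs0.le)
    _ = ENNReal.ofReal (∫ ω, Z ω ^ s ∂μ) :=
        (ofReal_integral_eq_lintegral_ofReal hZsint
          (Eventually.of_forall fun ω => Real.rpow_nonneg (h0 ω) s)).symm
    _ < 1 := by rw [← ENNReal.ofReal_one]; exact (ENNReal.ofReal_lt_ofReal_iff one_pos).2 hlt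

variable {p q : ℕ}

/-- `E ‖A(ε_t) ⋯ A(ε_{t-l+1})‖^s`. -/
noncomputable def prodMoment (μ : Measure Ω) (θ : Param p q) (ε : ℤ → Ω → ℝ) (s : ℝ) (l : ℕ) :
    ENNReal :=
  ∫⁻ ω, ENNReal.ofReal (entryNorm (backProd θ (past ε 0 ω) l)) ^ s ∂μ

theorem measurable_entryNorm_backProd (θ : Param p q) {Ω : Type*} {mΩ : MeasurableSpace Ω} (l : ℕ)
    {f : Ω → ℕ → ℝ} (hf : ∀ i < l, Measurable fun ω => f ω i) :
    Measurable fun ω => entryNorm (backProd θ (f ω) l) :=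
  Finset.measurable_fun_sum _ fun i _ => Finset.measurable_fun_sum _ fun j _ =>
    (measurable_backProd θ l hf i j).abs

theorem lintegral_entryNorm_backProd {ε : ℤ → Ω → ℝ} (hε : ∀ t, Measurable (ε t))
    (hi : iIndepFun ε μ) (hid : ∀ t, IdentDistrib (ε t) (ε 0) μ μ) (θ : Param p q) (s : ℝ) (l : ℕ)
    (t : ℤ) : ∫⁻ ω, ENNReal.ofReal (entryNorm (backProd θ (past ε t ω) l)) ^ s ∂μ =
      prodMoment μ θ ε s l := by
  have hm : Measurable fun e : ℕ → ℝ => ENNReal.ofReal (entryNorm (backProd θ e l)) ^ s :=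
    ((measurable_entryNorm_backProd θ l fun i _ => measurable_pi_apply i).ennreal_ofReal).pow_const s
  exact ((identDistrib_past hε hi hid t 0).comp hm).lintegral_eq

/-- The first `l` factors and the next `m` factors use disjoint sets of innovations, so the
expectation of the product of their norms splits. -/
theorem prodMoment_add_le {ε : ℤ → Ω → ℝ} (hε : ∀ t, Measurable (ε t))
    (hi : iIndepFun ε μ) (hid : ∀ t, IdentDistrib (ε t) (ε 0) μ μ) (θ : Param p q) {s : ℝ}
    (hs : 0 ≤ s) (l m : ℕ) :
    prodMoment μ θ ε s (l + m) ≤ prodMoment μ θ ε s l * prodMoment μ θ ε s m := by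
  rw [← lintegral_entryNorm_backProd hε hi hid θ s m (0 - l), prodMoment, prodMoment]
  rw [← lintegral_mul_sigmaOn hε hi (S := Set.Ioi (-(l:ℤ))) (T := Set.Iic (-(l:ℤ)))]
  · refine lintegral_mono fun ω => ?_
    rw [← ENNReal.mul_rpow_of_nonneg _ _ hs, ← ENNReal.ofReal_mul (entryNorm_nonneg _)]
    refine ENNReal.rpow_le_rpow (ENNReal.ofReal_le_ofReal ?_) hs
    rw [backProd_add]
    have : (fun i : ℕ => past ε 0 ω (i + l)) = past ε (0 - l) ω := by
      ext i; simp only [past]; congr 1; push_cast; ring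
    rw [this]
    exact entryNorm_mul_le _ _
  · exact Set.disjoint_left.2 fun x (hx : -(l:ℤ) < x) (hx' : x ≤ -(l:ℤ)) => not_le.2 hx hx'
  · refine (Measurable.ennreal_ofReal ?_).pow_const s
    refine measurable_entryNorm_backProd θ l fun i hi => measurable_sigmaOn ε ?_
    simp only [Set.mem_Ioi]; omega
  · refine (Measurable.ennreal_ofReal ?_).pow_const s
    refine measurable_entryNorm_backProd θ m fun i hi => measurable_sigmaOn ε ?_
    simp only [Set.mem_Iic]; omega

variable [IsProbabilityMeasure μ]

/-- The norm of one matrix is at most a multiple of `1 + ε²`, which is integrable;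
submultiplicativity does the rest. -/
theorem prodMoment_one_ne_top {ε : ℤ → Ω → ℝ} (hε : IsInnovation μ ε) (θ : Param p q) (l : ℕ) :
    prodMoment μ θ ε 1 l ≠ ⊤ := by
  induction l with
  | zero =>
    unfold prodMoment backProd
    simp
  | succ l ih =>
    refine ne_top_of_le_ne_top ?_
      (prodMoment_add_le hε.measurable hε.indep hε.identDistrib θ zero_le_one l 1)
    refine ENNReal.mul_ne_top ih ?_
    obtain ⟨C, hC0, hC⟩ := exists_entryNorm_recMatrix_le θ
    have hint : Integrable (fun ω => C * (1 + ε 0 ω ^ 2)) μ :=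
      ((integrable_const 1).add hε.memLp.integrable_sq).const_mul C
    refine ne_top_of_le_ne_top hint.lintegral_lt_top.ne (lintegral_mono fun ω => ?_)
    rw [ENNReal.rpow_one]
    refine ENNReal.ofReal_le_ofReal ?_
    have : backProd θ (past ε 0 ω) 1 = recMatrix θ (ε 0 ω) := by simp [backProd, past]
    rw [this]
    exact hC _

/-- Negativity of the top Lyapunov exponent makes a small moment of the matrix products
summable. -/
theorem exists_tsum_prodMoment_ne_top {ε : ℤ → Ω → ℝ} (hε : IsInnovation μ ε) {θ : Param p q}
    (hγ : topLyapunov μ θ ε < 0) :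
    ∃ s : ℝ, 0 < s ∧ s ≤ 1 ∧ ∑' l, prodMoment μ θ ε s l ≠ ⊤ := by
  have hm := hε.measurable
  obtain ⟨n, hn⟩ := exists_lt_of_ciInf_lt hγ
  have hneg : ∫ ω, Real.log (entryNorm (recMatrixProd θ (fun t => ε t ω) (n + 1))) ∂μ < 0 := by
    by_contra h
    exact absurd hn (not_lt.2 (div_nonneg (not_lt.1 h) (by positivity)))
  have hpast : ∀ ω, recMatrixProd θ (fun t => ε t ω) (n + 1) =
      backProd θ (past ε ((n + 1 : ℕ) : ℤ) ω) (n + 1) := fun ω => recMatrixProd_eq_backProd _ _ _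
  simp only [hpast] at hneg
  have hZm : Measurable fun ω => entryNorm (backProd θ (past ε ((n + 1 : ℕ) : ℤ) ω) (n + 1)) :=
    measurable_entryNorm_backProd θ _ fun i _ => hm _
  have hfin1 := lintegral_entryNorm_backProd hm hε.indep hε.identDistrib θ 1 (n + 1) ((n + 1 : ℕ) : ℤ)
  simp only [ENNReal.rpow_one] at hfin1
  have hint : Integrable
      (fun ω => entryNorm (backProd θ (past ε ((n + 1 : ℕ) : ℤ) ω) (n + 1))) μ := by
    refine ⟨hZm.aestronglyMeasurable, ?_⟩
    rw [hasFiniteIntegral_iff_ofReal (Eventually.of_forall fun ω => entryNorm_nonneg _), hfin1]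
    exact (prodMoment_one_ne_top hε θ _).lt_top
  obtain ⟨s, hs, hs1, hlt⟩ := exists_rpow_lintegral_lt_one hZm (fun ω => entryNorm_nonneg _) hint hneg
  rw [lintegral_entryNorm_backProd hm hε.indep hε.identDistrib] at hlt
  refine ⟨s, hs, hs1, tsum_ne_top_of_submultiplicative
    (prodMoment_add_le hm hε.indep hε.identDistrib θ hs.le) (fun l => ?_) (Nat.succ_pos n) hlt⟩
  have h1 : prodMoment μ θ ε s l ≤ 1 + prodMoment μ θ ε 1 l := by
    calc prodMoment μ θ ε s l ≤
        ∫⁻ ω, (1 + ENNReal.ofReal (entryNorm (backProd θ (past ε 0 ω) l)) ^ (1:ℝ)) ∂μ := by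
          refine lintegral_mono fun ω => ?_
          rcases le_total (ENNReal.ofReal (entryNorm (backProd θ (past ε 0 ω) l))) 1 with h | h
          · exact (ENNReal.rpow_le_one h hs.le).trans le_self_add
          · exact (ENNReal.rpow_le_rpow_of_exponent_le h hs1).trans le_add_self
      _ = _ := by
          rw [lintegral_add_left measurable_const]
          simp [prodMoment]
  exact ne_top_of_le_ne_top (ENNReal.add_ne_top.2 ⟨ENNReal.one_ne_top,
    prodMoment_one_ne_top hε θ l⟩) h1

end Moments

/-! ### The Markovian form of the GARCH equations. -/

section StateVector

variable {p q : ℕ}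

/-- The vector `(x_t², …, x_{t-p+1}², s_t², …, s_{t-q+1}²)`. -/
def state (x s : ℤ → ℝ) (t : ℤ) : Fin p ⊕ Fin q → ℝ
  | Sum.inl i => x (t - (i.val : ℤ)) ^ 2
  | Sum.inr j => s (t - (j.val : ℤ)) ^ 2

/-- The vector `B_t` of the recursion `Y_t = A(ε_t) Y_{t-1} + B_t`, as a function of `ε_t`. -/
def recInput (θ : Param p q) (e : ℝ) : Fin p ⊕ Fin q → ℝ
  | Sum.inl i => if i.val = 0 then e ^ 2 * θ (Sum.inl 0) else 0
  | Sum.inr j => if j.val = 0 then θ (Sum.inl 0) else 0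

theorem state_nonneg (x s : ℤ → ℝ) (t : ℤ) (i : Fin p ⊕ Fin q) : 0 ≤ state x s t i := by
  cases i <;> exact sq_nonneg _

theorem recInput_nonneg {θ : Param p q} (hθ : ∀ j, 0 ≤ θ j) (e : ℝ) (i : Fin p ⊕ Fin q) :
    0 ≤ recInput θ e i := by
  rcases i with i | i <;> simp only [recInput] <;> split_ifs <;>
    first
    | exact mul_nonneg (sq_nonneg _) (hθ _)
    | exact hθ _
    | exact le_rfl

theorem measurable_recInput (θ : Param p q) (i : Fin p ⊕ Fin q) :
    Measurable fun e => recInput θ e i := by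
  rcases i with i | i <;> simp only [recInput] <;> split_ifs <;> fun_prop

theorem recInput_le {θ : Param p q} (hθ : ∀ j, 0 ≤ θ j) (e : ℝ) (i : Fin p ⊕ Fin q) :
    recInput θ e i ≤ θ (Sum.inl 0) * (1 + e ^ 2) := by
  have h1 := hθ (Sum.inl 0)
  have h2 := mul_nonneg h1 (sq_nonneg e)
  rcases i with i | i <;> simp only [recInput] <;> split_ifs <;> nlinarith

theorem volatility_eq_lagCoef {θ : Param p q} {x s : ℤ → ℝ} {t : ℤ}
    (hs : s t ^ 2 = θ (Sum.inl 0) +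
      ∑ i : Fin p, θ (Sum.inl i.succ) * x (t - ((i.val : ℤ) + 1)) ^ 2 +
      ∑ j : Fin q, θ (Sum.inr j) * s (t - ((j.val : ℤ) + 1)) ^ 2) :
    s t ^ 2 = θ (Sum.inl 0) + ∑ i, lagCoef θ i * state x s (t - 1) i := by
  rw [hs, Fintype.sum_sum_type, add_assoc]
  simp only [lagCoef, state, sub_sub, add_comm (1:ℤ)]

/-- The top row of each block is the volatility equation, multiplied by `ε_t²` in the block of
observations; all other rows shift the coordinates. -/
theorem state_step {θ : Param p q} {x s e : ℤ → ℝ} {t : ℤ} (hx : x t = s t * e t)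
    (hs : s t ^ 2 = θ (Sum.inl 0) +
      ∑ i : Fin p, θ (Sum.inl i.succ) * x (t - ((i.val : ℤ) + 1)) ^ 2 +
      ∑ j : Fin q, θ (Sum.inr j) * s (t - ((j.val : ℤ) + 1)) ^ 2) :
    state x s t = (recMatrix θ (e t)).mulVec (state x s (t - 1)) + recInput θ (e t) := by
  have hs' := volatility_eq_lagCoef hs
  rw [Fintype.sum_sum_type] at hs'
  ext i
  rw [Pi.add_apply, Matrix.mulVec, dotProduct, Fintype.sum_sum_type]
  rcases i with i | i
  · by_cases hi : i.val = 0
    · simp only [state, recMatrix, recInput, hi, if_true, mul_assoc, ← Finset.mul_sum]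
      rw [← mul_add, ← mul_add, Nat.cast_zero, sub_zero, hx, mul_pow, hs']
      simp only [state]
      ring
    · obtain ⟨m, hm⟩ : ∃ m, i.val = m + 1 := ⟨i.val - 1, by omega⟩
      have hlt : m < p := by have := i.isLt; omega
      simp only [recMatrix, recInput, hi, if_false, zero_mul, Finset.sum_const_zero, add_zero,
        ite_mul, one_mul]
      rw [Finset.sum_eq_single (⟨m, hlt⟩ : Fin p)]
      · rw [if_pos hm]
        simp only [state, hm]
        congr 2; push_cast; ring
      · intro b _ hb
        rw [if_neg]
        intro h
        exact hb (Fin.ext (by simp only; omega))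
      · simp
  · by_cases hi : i.val = 0
    · simp only [recMatrix, recInput, hi, if_true]
      simp only [state, hi, Nat.cast_zero, sub_zero] at hs' ⊢
      rw [hs']
      ring
    · obtain ⟨m, hm⟩ : ∃ m, i.val = m + 1 := ⟨i.val - 1, by omega⟩
      have hlt : m < q := by have := i.isLt; omega
      simp only [recMatrix, recInput, hi, if_false, zero_mul, Finset.sum_const_zero, add_zero,
        ite_mul, one_mul, zero_add]
      rw [Finset.sum_eq_single (⟨m, hlt⟩ : Fin q)]
      · rw [if_pos hm]
        simp only [state, hm]
        congr 2; push_cast; ring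
      · intro b _ hb
        rw [if_neg]
        intro h
        exact hb (Fin.ext (by simp only; omega))
      · simp

theorem state_iterate {θ : Param p q} {x s e : ℤ → ℝ}
    (h : ∀ t, state x s t = (recMatrix θ (e t)).mulVec (state x s (t - 1)) + recInput θ (e t))
    (t : ℤ) (m : ℕ) :
    state x s t = ∑ l ∈ Finset.range m,
      (backProd θ (fun i => e (t - i)) l).mulVec (recInput θ (e (t - l))) +
      (backProd θ (fun i => e (t - i)) m).mulVec (state x s (t - m)) := by
  induction m with
  | zero => simp [backProd]
  | succ m ih =>
    rw [Finset.sum_range_succ, backProd_succ, ih]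
    conv_lhs => rw [h (t - m)]
    rw [Matrix.mulVec_add, Matrix.mulVec_mulVec]
    have : t - (m : ℤ) - 1 = t - ((m + 1 : ℕ) : ℤ) := by push_cast; ring
    rw [this]
    abel

end StateVector

/-! ### Almost sure convergence of geometrically weighted series from small moments. -/

section MomentSums

variable {Ω : Type*} [mΩ : MeasurableSpace Ω] {μ : Measure Ω}

/-- By subadditivity of `x ↦ x^s`, the `s`th power of the series is at most a series whose
expectation is geometric. -/
theorem ae_summable_of_moment {W : ℕ → Ω → ℝ} (hW : ∀ n, Measurable (W n))
    (h0 : ∀ n ω, 0 ≤ W n ω) {s κ : ℝ} (hs : 0 < s) (hs1 : s ≤ 1) (hκ : 0 < κ) (hκ1 : κ < 1)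
    {C : ENNReal} (hC : C ≠ ⊤) (hm : ∀ n, ∫⁻ ω, ENNReal.ofReal (W n ω) ^ s ∂μ ≤ C) :
    ∀ᵐ ω ∂μ, Summable fun n : ℕ => κ ^ n * W n ω := by
  have hκs : ENNReal.ofReal κ ^ s < 1 :=
    ENNReal.rpow_lt_one (by rw [← ENNReal.ofReal_one]; exact (ENNReal.ofReal_lt_ofReal_iff one_pos).2 hκ1) hs
  have hterm : ∀ n, ∫⁻ ω, ENNReal.ofReal (κ ^ n * W n ω) ^ s ∂μ ≤ (ENNReal.ofReal κ ^ s) ^ n * C := by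
    intro n
    have : ∀ ω, ENNReal.ofReal (κ ^ n * W n ω) ^ s =
        (ENNReal.ofReal κ ^ s) ^ n * ENNReal.ofReal (W n ω) ^ s := by
      intro ω
      rw [ENNReal.ofReal_mul (by positivity), ENNReal.mul_rpow_of_nonneg _ _ hs.le,
        ENNReal.ofReal_pow hκ.le, ← ENNReal.rpow_natCast, ← ENNReal.rpow_natCast,
        ← ENNReal.rpow_mul, ← ENNReal.rpow_mul, mul_comm s]
    simp only [this]
    rw [lintegral_const_mul _ ((hW n).ennreal_ofReal.pow_const s)]
    gcongr
    exact hm n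
  have hmeas : ∀ n, Measurable fun ω => ENNReal.ofReal (κ ^ n * W n ω) ^ s := fun n =>
    (((hW n).const_mul _).ennreal_ofReal).pow_const s
  have hfin : ∫⁻ ω, ∑' n, ENNReal.ofReal (κ ^ n * W n ω) ^ s ∂μ ≠ ⊤ := by
    rw [lintegral_tsum fun n => (hmeas n).aemeasurable]
    refine ne_top_of_le_ne_top ?_ (ENNReal.tsum_le_tsum hterm)
    rw [ENNReal.tsum_mul_right, ENNReal.tsum_geometric]
    exact ENNReal.mul_ne_top (ENNReal.inv_ne_top.2 (tsub_pos_of_lt hκs).ne') hC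
  filter_upwards [ae_lt_top (Measurable.tsum hmeas) hfin] with ω hω
  have h1 := (rpow_tsum_le_tsum_rpow (fun n => ENNReal.ofReal (κ ^ n * W n ω)) hs hs1).trans_lt hω
  have h2 : ∑' n, ENNReal.ofReal (κ ^ n * W n ω) ≠ ⊤ := by
    intro h
    rw [h, ENNReal.top_rpow_of_pos hs] at h1
    exact lt_irrefl _ h1
  have h3 := ENNReal.summable_toReal h2
  refine h3.congr fun n => ?_
  exact ENNReal.toReal_ofReal (mul_nonneg (by positivity) (h0 n ω))

end MomentSums

/-! ### The series `σ_t²(θ)` and uniqueness for the volatility recursion. -/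

section VolatilitySeries

variable {p q : ℕ}

/-- The `c_i` are built by inverting `1 - ∑ β_j L^j`, `L` the lag operator: the recursion for `c_i`
reproduces the volatility equation, and `c_0` is the fixed point of `c = α_0 + (∑ β_j) c`. -/
theorem volSq_recursion {θ : Param p q} (hθ : ∑ j : Fin q, θ (Sum.inr j) ≠ 1) {x : ℤ → ℝ}
    (hs : ∀ t : ℤ, Summable fun i : ℕ => coef θ (i + 1) * x (t - ((i : ℤ) + 1)) ^ 2) (t : ℤ) :
    volSq x θ t = θ (Sum.inl 0) +
      ∑ i : Fin p, θ (Sum.inl i.succ) * x (t - ((i.val : ℤ) + 1)) ^ 2 +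
      ∑ j : Fin q, θ (Sum.inr j) * volSq x θ (t - ((j.val : ℤ) + 1)) := by
  set a : ℕ → ℝ := fun i => x (t - ((i : ℤ) + 1)) ^ 2 with ha
  have h0 : coef θ 0 = θ (Sum.inl 0) + (∑ j : Fin q, θ (Sum.inr j)) * coef θ 0 := by
    have : (1 - ∑ j : Fin q, θ (Sum.inr j)) ≠ 0 := sub_ne_zero.2 hθ.symm
    rw [coef_zero]
    field_simp
    ring
  have hA : HasSum (fun i : ℕ => (if h : i + 1 < p + 1 then θ (Sum.inl ⟨i + 1, h⟩) else 0) * a i)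
      (∑ i : Fin p, θ (Sum.inl i.succ) * a i.val) := by
    have h1 : HasSum
        (fun i : ℕ => (if h : i + 1 < p + 1 then θ (Sum.inl ⟨i + 1, h⟩) else 0) * a i)
        (∑ i ∈ Finset.range p,
          (if h : i + 1 < p + 1 then θ (Sum.inl ⟨i + 1, h⟩) else 0) * a i) :=
      hasSum_sum_of_ne_finset_zero fun i hi => by
        rw [Finset.mem_range] at hi
        simp [hi]
    rw [Finset.sum_range] at h1
    convert h1 using 1
    refine Finset.sum_congr rfl fun i _ => ?_
    simp only [add_lt_add_iff_right, i.isLt, dif_pos]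
    rfl
  have hB : ∀ l : Fin q, HasSum
      (fun i : ℕ => (if l.val < i then θ (Sum.inr l) * coef θ (i - l.val) else 0) * a i)
      (θ (Sum.inr l) * ∑' i : ℕ, coef θ (i + 1) * x (t - ((l.val : ℤ) + 1) - ((i : ℤ) + 1)) ^ 2) := by
    intro l
    have h1 := ((hs (t - ((l.val : ℤ) + 1))).hasSum).mul_left (θ (Sum.inr l))
    -- Lag `l + 1` shifts the series by `l + 1` places, and the guard makes exactly those first
    -- terms vanish.
    rw [← hasSum_nat_add_iff' (l.val + 1)]
    have h2 : ∑ i ∈ Finset.range (l.val + 1),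
        (if l.val < i then θ (Sum.inr l) * coef θ (i - l.val) else 0) * a i = 0 := by
      refine Finset.sum_eq_zero fun i hi => ?_
      rw [Finset.mem_range] at hi
      rw [if_neg (by omega), zero_mul]
    rw [h2, sub_zero]
    refine (congrArg (fun f => HasSum f _) (funext fun i => ?_)).mpr h1
    rw [if_pos (by omega), show i + (l.val + 1) - l.val = i + 1 by omega, mul_assoc]
    simp only [ha]
    congr 4
    push_cast; ring
  have hsum := hA.add (hasSum_sum fun l (_ : l ∈ Finset.univ) => hB l)
  have hfun : (fun i : ℕ => coef θ (i + 1) * a i) = fun i : ℕ =>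
      (if h : i + 1 < p + 1 then θ (Sum.inl ⟨i + 1, h⟩) else 0) * a i +
        ∑ l : Fin q, (if l.val < i then θ (Sum.inr l) * coef θ (i - l.val) else 0) * a i := by
    funext i
    rw [coef_succ, add_mul, Finset.sum_mul]
  have heq := hsum.tsum_eq
  rw [← hfun] at heq
  unfold volSq
  rw [heq]
  nth_rewrite 1 [h0]
  simp only [mul_add, Finset.sum_add_distrib, Finset.sum_mul]
  ring

/-- A bounded growth solution of the homogeneous volatility recursion vanishes. -/
theorem eq_zero_of_recursion {b : Fin q → ℝ} (hb : ∀ j, 0 ≤ b j) {ρ τ : ℝ} (hρ : 0 < ρ)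
    (hτ0 : 0 ≤ τ) (hτ1 : τ < 1) (hτ : ∑ j : Fin q, b j * (ρ ^ (j.val + 1))⁻¹ ≤ τ) {w : ℤ → ℝ}
    (hw : ∀ t, w t = ∑ j : Fin q, b j * w (t - ((j.val : ℤ) + 1))) {t : ℤ} {B : ℝ}
    (hB : ∀ n : ℕ, ρ ^ n * |w (t - n)| ≤ B) : w t = 0 := by
  have hB0 : 0 ≤ B := le_trans (by positivity) (hB 0)
  -- The recursion contracts the weighted supremum of `ρ^n |w (t - n)|` by the factor `τ`, and may
  -- be applied any number of times.
  have key : ∀ N n : ℕ, ρ ^ n * |w (t - n)| ≤ τ ^ N * B := by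
    intro N
    induction N with
    | zero => simpa using hB
    | succ N ih =>
      intro n
      rw [hw]
      calc ρ ^ n * |∑ j : Fin q, b j * w (t - n - ((j.val : ℤ) + 1))| ≤
          ρ ^ n * ∑ j : Fin q, b j * |w (t - n - ((j.val : ℤ) + 1))| := by
            refine mul_le_mul_of_nonneg_left ?_ (by positivity)
            refine (Finset.abs_sum_le_sum_abs _ _).trans (le_of_eq ?_)
            refine Finset.sum_congr rfl fun j _ => ?_
            rw [abs_mul, abs_of_nonneg (hb j)]
        _ = ∑ j : Fin q, (b j * (ρ ^ (j.val + 1))⁻¹) *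
            (ρ ^ (n + (j.val + 1)) * |w (t - ((n + (j.val + 1) : ℕ) : ℤ))|) := by
            rw [Finset.mul_sum]
            refine Finset.sum_congr rfl fun j _ => ?_
            have : t - n - ((j.val : ℤ) + 1) = t - ((n + (j.val + 1) : ℕ) : ℤ) := by
              push_cast; ring
            rw [this, pow_add]
            field_simp
            ring
        _ ≤ ∑ j : Fin q, (b j * (ρ ^ (j.val + 1))⁻¹) * (τ ^ N * B) := by
            refine Finset.sum_le_sum fun j _ => ?_
            exact mul_le_mul_of_nonneg_left (ih _) (mul_nonneg (hb j) (by positivity))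
        _ = (∑ j : Fin q, b j * (ρ ^ (j.val + 1))⁻¹) * (τ ^ N * B) := by rw [Finset.sum_mul]
        _ ≤ τ * (τ ^ N * B) := mul_le_mul_of_nonneg_right hτ (by positivity)
        _ = _ := by ring
  have h1 : |w t| ≤ 0 := by
    refine ge_of_tendsto' (f := fun N : ℕ => τ ^ N * B) (x := atTop) ?_ (fun N => ?_)
    · simpa using (tendsto_pow_atTop_nhds_zero_of_lt_one hτ0 hτ1).mul_const B
    · simpa using key N 0
  exact abs_nonpos_iff.1 h1

end VolatilitySeries

/-! ### Identification of the stationary solution with a functional of the past innovations. -/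

section StationarySolution

variable {Ω : Type*} [mΩ : MeasurableSpace Ω] {μ : Measure Ω} {p q : ℕ}

/-- The stationary solution of `Y_t = A(ε_t) Y_{t-1} + B_t` as a function of the past. -/
noncomputable def stateSeries (θ : Param p q) (e : ℕ → ℝ) (i : Fin p ⊕ Fin q) : ENNReal :=
  ∑' l, ENNReal.ofReal ((backProd θ e l).mulVec (recInput θ (e l)) i)

theorem measurable_stateSeries (θ : Param p q) (i : Fin p ⊕ Fin q) :
    Measurable fun e => stateSeries θ e i := by
  refine Measurable.tsum fun l => Measurable.ennreal_ofReal ?_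
  simp only [Matrix.mulVec, dotProduct]
  refine Finset.measurable_fun_sum _ fun j _ => Measurable.mul ?_ ?_
  · exact measurable_backProd θ l (fun i _ => measurable_pi_apply i) i j
  · exact (measurable_recInput θ j).comp (measurable_pi_apply l)

theorem mulVec_nonneg {ι : Type*} [Fintype ι] {M : Matrix ι ι ℝ} {y : ι → ℝ}
    (hM : ∀ i j, 0 ≤ M i j) (hy : ∀ i, 0 ≤ y i) (i : ι) : 0 ≤ M.mulVec y i :=
  Finset.sum_nonneg fun j _ => mul_nonneg (hM i j) (hy j)

/-- The `s`th power is taken termwise. In the term `l` the matrix product uses `ε_t, …, ε_{t-l+1}`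
and the input only `ε_{t-l}`, so the moments factor. -/
theorem lintegral_stateSeries_ne_top [IsProbabilityMeasure μ] {ε : ℤ → Ω → ℝ}
    (hε : IsInnovation μ ε) {θ : Param p q} (hθ : ∀ j, 0 ≤ θ j) {s : ℝ} (hs : 0 < s) (hs1 : s ≤ 1)
    (hU : ∑' l, prodMoment μ θ ε s l ≠ ⊤) :
    ∃ C : ENNReal, C ≠ ⊤ ∧ ∀ i t, ∫⁻ ω, stateSeries θ (past ε t ω) i ^ s ∂μ ≤ C := by
  set b : ℝ → ℝ := fun e => ∑ j, recInput θ e j with hb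
  have hbm : Measurable b := Finset.measurable_fun_sum _ fun j _ => measurable_recInput θ j
  have hb0 : ∀ e, 0 ≤ b e := fun e => Finset.sum_nonneg fun j _ => recInput_nonneg hθ e j
  set β := ∫⁻ ω, ENNReal.ofReal (b (ε 0 ω)) ^ s ∂μ with hβ
  have hβt : ∀ t, ∫⁻ ω, ENNReal.ofReal (b (ε t ω)) ^ s ∂μ = β := fun t =>
    ((hε.identDistrib t).comp (hbm.ennreal_ofReal.pow_const s)).lintegral_eq
  have hβtop : β ≠ ⊤ := by
    set c : ℝ := Fintype.card (Fin p ⊕ Fin q) * θ (Sum.inl 0) with hc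
    have hint : Integrable (fun ω => 1 + c * (1 + ε 0 ω ^ 2)) μ :=
      (integrable_const 1).add (((integrable_const 1).add hε.memLp.integrable_sq).const_mul c)
    refine ne_top_of_le_ne_top hint.lintegral_lt_top.ne (lintegral_mono fun ω => ?_)
    have h1 : b (ε 0 ω) ≤ c * (1 + ε 0 ω ^ 2) := by
      refine (Finset.sum_le_sum fun j _ => recInput_le hθ (ε 0 ω) j).trans (le_of_eq ?_)
      simp [hc, mul_assoc]
    rw [ENNReal.ofReal_rpow_of_nonneg (hb0 _) hs.le]
    refine ENNReal.ofReal_le_ofReal ?_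
    rcases le_total (b (ε 0 ω)) 1 with h | h
    · exact (Real.rpow_le_one (hb0 _) h hs.le).trans (by linarith [hb0 (ε 0 ω)])
    · have := Real.rpow_le_rpow_of_exponent_le h hs1
      rw [Real.rpow_one] at this
      linarith
  refine ⟨(∑' l, prodMoment μ θ ε s l) * β, ENNReal.mul_ne_top hU hβtop, fun i t => ?_⟩
  have hNm : ∀ l, Measurable fun ω => ENNReal.ofReal (entryNorm (backProd θ (past ε t ω) l)) ^ s :=
    fun l => (measurable_entryNorm_backProd θ l fun i _ => hε.measurable _).ennreal_ofReal.pow_const s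
  have hbm' : ∀ t, Measurable fun ω => ENNReal.ofReal (b (ε t ω)) ^ s := fun t =>
    (hbm.comp (hε.measurable t)).ennreal_ofReal.pow_const s
  calc ∫⁻ ω, stateSeries θ (past ε t ω) i ^ s ∂μ ≤
      ∫⁻ ω, ∑' l : ℕ, ENNReal.ofReal (entryNorm (backProd θ (past ε t ω) l)) ^ s *
        ENNReal.ofReal (b (ε (t - l) ω)) ^ s ∂μ := by
        refine lintegral_mono fun ω => (rpow_tsum_le_tsum_rpow _ hs hs1).trans ?_
        refine ENNReal.tsum_le_tsum fun l => ?_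
        rw [← ENNReal.mul_rpow_of_nonneg _ _ hs.le, ← ENNReal.ofReal_mul (entryNorm_nonneg _)]
        refine ENNReal.rpow_le_rpow (ENNReal.ofReal_le_ofReal ?_) hs.le
        exact mulVec_le_entryNorm_mul (fun j => recInput_nonneg hθ _ j) i
    _ = ∑' l : ℕ, ∫⁻ ω, ENNReal.ofReal (entryNorm (backProd θ (past ε t ω) l)) ^ s *
        ENNReal.ofReal (b (ε (t - l) ω)) ^ s ∂μ :=
        lintegral_tsum fun l => ((hNm l).mul (hbm' _)).aemeasurable
    _ = ∑' l : ℕ, prodMoment μ θ ε s l * β := by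
        congr 1; ext l
        rw [lintegral_mul_sigmaOn hε.measurable hε.indep (S := Set.Ioi (t - l)) (T := {t - (l:ℤ)}),
          lintegral_entryNorm_backProd hε.measurable hε.indep hε.identDistrib, hβt]
        · simp
        · refine (measurable_entryNorm_backProd θ l fun i hi =>
            measurable_sigmaOn ε ?_).ennreal_ofReal.pow_const s
          simp only [Set.mem_Ioi]; omega
        · exact (hbm.comp (measurable_sigmaOn ε (Set.mem_singleton (t - (l:ℤ))))).ennreal_ofReal.pow_const s
    _ = _ := ENNReal.tsum_mul_right

theorem tendsto_measure_lt_atTop [IsFiniteMeasure μ] {N : Ω → ℝ} (hN : Measurable N) :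
    Tendsto (fun L : ℕ => μ {ω | (L : ℝ) < N ω}) atTop (nhds 0) := by
  have := tendsto_measure_of_ae_tendsto_indicator_of_isFiniteMeasure (μ := μ) atTop
    (A := (∅ : Set Ω)) MeasurableSet.empty (As := fun L : ℕ => {ω | (L : ℝ) < N ω})
    (fun L => measurableSet_lt measurable_const hN) (Eventually.of_forall fun ω => ?_)
  · simpa using this
  · obtain ⟨n, hn⟩ := exists_nat_ge (N ω)
    filter_upwards [eventually_ge_atTop n] with L hL
    simp only [Set.mem_empty_iff_false, iff_false, not_lt]
    exact hn.trans (by exact_mod_cast hL)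

/-- The stationary solution is a functional of the past of the innovations. -/
theorem state_eq_stateSeries [IsProbabilityMeasure μ] {ε X σ : ℤ → Ω → ℝ}
    (hε : IsInnovation μ ε) {θ : Param p q} (hθ : ∀ j, 0 ≤ θ j) {s : ℝ} (hs : 0 < s)
    (hU : ∑' l, prodMoment μ θ ε s l ≠ ⊤) (hX : IsStationarySolution μ θ ε X σ) (t : ℤ)
    (i : Fin p ⊕ Fin q) :
    ∀ᵐ ω ∂μ, ENNReal.ofReal (state (fun t => X t ω) (fun t => σ t ω) t i) =
      stateSeries θ (past ε t ω) i := by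
  set Y : ℤ → Ω → Fin p ⊕ Fin q → ℝ := fun t ω => state (fun t => X t ω) (fun t => σ t ω) t with hY
  have hY0 : ∀ t ω i, 0 ≤ Y t ω i := fun t ω i => state_nonneg _ _ _ _
  have hpath : ∀ᵐ ω ∂μ, ∀ m : ℕ, Y t ω = ∑ l ∈ Finset.range m,
      (backProd θ (past ε t ω) l).mulVec (recInput θ (past ε t ω l)) +
      (backProd θ (past ε t ω) m).mulVec (Y (t - m) ω) := by
    filter_upwards [ae_all_iff.2 hX.obs_eq, ae_all_iff.2 hX.vol_eq] with ω h1 h2 m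
    exact state_iterate (x := fun u => X u ω) (s := fun u => σ u ω) (e := fun u => ε u ω)
      (fun u => state_step (e := fun u => ε u ω) (h1 u) (h2 u)) t m
  have hsplit : ∀ᵐ ω ∂μ, ∀ m : ℕ, ENNReal.ofReal (Y t ω i) =
      ∑ l ∈ Finset.range m, ENNReal.ofReal
        ((backProd θ (past ε t ω) l).mulVec (recInput θ (past ε t ω l)) i) +
      ENNReal.ofReal ((backProd θ (past ε t ω) m).mulVec (Y (t - m) ω) i) := by
    filter_upwards [hpath] with ω h m
    rw [← ENNReal.ofReal_sum_of_nonneg, ← ENNReal.ofReal_add]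
    · congr 1
      conv_lhs => rw [h m]
      simp
    · exact Finset.sum_nonneg fun l _ => mulVec_nonneg (backProd_nonneg hθ _ _)
        (recInput_nonneg hθ _) i
    · exact mulVec_nonneg (backProd_nonneg hθ _ _) (hY0 _ _) i
    · exact fun l _ => mulVec_nonneg (backProd_nonneg hθ _ _) (recInput_nonneg hθ _) i
  have hlower : ∀ᵐ ω ∂μ, stateSeries θ (past ε t ω) i ≤ ENNReal.ofReal (Y t ω i) := by
    filter_upwards [hsplit] with ω h
    exact ENNReal.tsum_le_of_sum_range_le fun m => by rw [h m]; exact le_self_add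
  set N : ℤ → Ω → ℝ := fun t ω => ∑ j, Y t ω j with hN
  have hNfun : ∃ G : (ℤ → ℝ × ℝ) → ℝ, Measurable G ∧
      ∀ t ω, N t ω = G (fun u => (X (u + t) ω, σ (u + t) ω)) := by
    refine ⟨fun y => ∑ j, state (p := p) (q := q) (fun u => (y u).1) (fun u => (y u).2) 0 j, ?_, ?_⟩
    · refine Finset.measurable_fun_sum _ fun j _ => ?_
      rcases j with j | j
      · exact ((measurable_fst.comp (measurable_pi_apply _)).pow_const 2)
      · exact ((measurable_snd.comp (measurable_pi_apply _)).pow_const 2)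
    · intro t ω
      refine Finset.sum_congr rfl fun j _ => ?_
      rcases j with j | j <;> simp only [hY, state] <;> congr 2 <;> ring
  obtain ⟨G, hGm, hG⟩ := hNfun
  -- Stationarity enters here: the initial state `Y_{t-m}` stays tight as `m` grows.
  have hNid : ∀ t (L : ℝ), μ {ω | L < N t ω} = μ {ω | L < N 0 ω} := by
    intro t L
    have h1 := ((hX.stationary t).comp hGm).measure_mem_eq (s := Set.Ioi L) measurableSet_Ioi
    have h2 : ∀ ω, N 0 ω = G (fun u => (X u ω, σ u ω)) := fun ω => by simpa using hG 0 ω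
    simp only [hG t]
    simp only [h2]
    exact h1
  have hNm : Measurable (N 0) := by
    have : N 0 = fun ω => G (fun u => (X (u + 0) ω, σ (u + 0) ω)) := funext fun ω => hG 0 ω
    rw [this]
    exact hGm.comp (measurable_pi_lambda _ fun u =>
      (hX.measurable_X _).prodMk (hX.measurable_vol _))
  have hU0 : Tendsto (prodMoment μ θ ε s) atTop (nhds 0) := ENNReal.tendsto_atTop_zero_of_tsum_ne_top hU
  have hupper : ∀ η : ℝ, 0 < η → ∀ᵐ ω ∂μ, ENNReal.ofReal (Y t ω i) ≤
      stateSeries θ (past ε t ω) i + ENNReal.ofReal η := by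
    intro η hη
    rw [ae_iff]
    refine le_antisymm ?_ zero_le
    refine ge_of_tendsto' ((tendsto_measure_lt_atTop (μ := μ) hNm).comp (tendsto_add_atTop_nat 1))
      fun L => ?_
    have hL : (0:ℝ) < ((L + 1 : ℕ) : ℝ) := by positivity
    -- The remainder after `m` steps exceeds `η` only if the matrix product is at least `η / (L +
    -- 1)` or the state `Y_{t-m}` exceeds `L + 1`. The first probability vanishes as `m` grows, then
    -- the second as `L` grows.
    have hb : ∀ m : ℕ, μ {ω | ¬ ENNReal.ofReal (Y t ω i) ≤
        stateSeries θ (past ε t ω) i + ENNReal.ofReal η} ≤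
        prodMoment μ θ ε s m / ENNReal.ofReal (η / ((L + 1 : ℕ) : ℝ)) ^ s +
          μ {ω | (((L + 1 : ℕ) : ℕ) : ℝ) < N 0 ω} := by
      intro m
      have hc0 : ENNReal.ofReal (η / ((L + 1 : ℕ) : ℝ)) ^ s ≠ 0 :=
        (ENNReal.rpow_pos (ENNReal.ofReal_pos.2 (by positivity)) ENNReal.ofReal_ne_top).ne'
      have hct : ENNReal.ofReal (η / ((L + 1 : ℕ) : ℝ)) ^ s ≠ ⊤ :=
        ENNReal.rpow_ne_top_of_nonneg hs.le ENNReal.ofReal_ne_top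
      have hmarkov : μ {ω | ENNReal.ofReal (η / ((L + 1 : ℕ) : ℝ)) ^ s ≤
          ENNReal.ofReal (entryNorm (backProd θ (past ε t ω) m)) ^ s} ≤
          prodMoment μ θ ε s m / ENNReal.ofReal (η / ((L + 1 : ℕ) : ℝ)) ^ s := by
        rw [← lintegral_entryNorm_backProd hε.measurable hε.indep hε.identDistrib θ s m t]
        exact meas_ge_le_lintegral_div ((measurable_entryNorm_backProd θ m
          fun i _ => hε.measurable _).ennreal_ofReal.pow_const s).aemeasurable hc0 hct
      rw [← hNid (t - m)]
      refine le_trans ?_ ((measure_union_le _ _).trans (add_le_add hmarkov le_rfl))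
      refine measure_mono_ae ?_
      filter_upwards [hsplit] with ω h hω
      by_contra hcon
      have h0 : ¬ ENNReal.ofReal (Y t ω i) ≤
        stateSeries θ (past ε t ω) i + ENNReal.ofReal η := hω
      have h1 : ¬ ENNReal.ofReal (η / ((L + 1 : ℕ) : ℝ)) ^ s ≤
        ENNReal.ofReal (entryNorm (backProd θ (past ε t ω) m)) ^ s := fun hh => hcon (Or.inl hh)
      have h2 : ¬ ((L + 1 : ℕ) : ℝ) < N (t - m) ω := fun hh => hcon (Or.inr hh)
      rw [not_le] at h1
      rw [not_lt] at h2
      rw [ENNReal.rpow_lt_rpow_iff hs] at h1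
      have h3 := (ENNReal.ofReal_lt_ofReal_iff (by positivity)).1 h1
      refine h0 ?_
      rw [h m]
      refine add_le_add (ENNReal.sum_le_tsum _) (ENNReal.ofReal_le_ofReal ?_)
      refine (mulVec_le_entryNorm_mul (hY0 _ _) i).trans ?_
      calc _ ≤ η / ((L + 1 : ℕ) : ℝ) * ((L + 1 : ℕ) : ℝ) :=
            mul_le_mul h3.le h2 (Finset.sum_nonneg fun j _ => hY0 _ _ j) (by positivity)
        _ = η := by field_simp
    have hlim : Tendsto (fun m => prodMoment μ θ ε s m / ENNReal.ofReal (η / ((L + 1 : ℕ) : ℝ)) ^ s +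
          μ {ω | (((L + 1 : ℕ) : ℕ) : ℝ) < N 0 ω}) atTop
        (nhds (0 / ENNReal.ofReal (η / ((L + 1 : ℕ) : ℝ)) ^ s +
          μ {ω | (((L + 1 : ℕ) : ℕ) : ℝ) < N 0 ω})) := by
      refine Tendsto.add_const _ ?_
      refine ENNReal.Tendsto.div_const hU0 (Or.inr ?_)
      exact (ENNReal.rpow_pos (ENNReal.ofReal_pos.2 (by positivity)) ENNReal.ofReal_ne_top).ne'
    rw [ENNReal.zero_div, zero_add] at hlim
    exact ge_of_tendsto' hlim hb
  have hup : ∀ᵐ ω ∂μ, ∀ n : ℕ, ENNReal.ofReal (Y t ω i) ≤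
      stateSeries θ (past ε t ω) i + ENNReal.ofReal (1 / ((n : ℝ) + 1)) :=
    ae_all_iff.2 fun n => hupper _ (by positivity)
  filter_upwards [hlower, hup] with ω h1 h2
  refine le_antisymm ?_ h1
  have h3 : Tendsto (fun n : ℕ => stateSeries θ (past ε t ω) i + ENNReal.ofReal (1 / ((n : ℝ) + 1)))
      atTop (nhds (stateSeries θ (past ε t ω) i + ENNReal.ofReal 0)) :=
    Tendsto.const_add _ (ENNReal.tendsto_ofReal tendsto_one_div_add_atTop_nhds_zero_nat)
  rw [ENNReal.ofReal_zero, add_zero] at h3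
  exact ge_of_tendsto' h3 h2

end StationarySolution

/-! ### Calculus of `o_P` and `O_P`. -/

section StochasticOrder

variable {Ω : Type*} [mΩ : MeasurableSpace Ω] {μ : Measure Ω}

theorem isLittleOP_iff {Y : ℕ → Ω → ℝ} :
    IsLittleOP μ Y ↔ ∀ η : ℝ, 0 < η → Tendsto (fun n => μ {ω | η < |Y n ω|}) atTop (nhds 0) := by
  constructor
  · intro h η hη
    refine tendsto_of_tendsto_of_tendsto_of_le_of_le tendsto_const_nhds
      (h (ENNReal.ofReal η) (ENNReal.ofReal_pos.2 hη)) (fun _ => zero_le)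
      (fun n => measure_mono fun ω (hω : η < |Y n ω|) => ?_)
    change ENNReal.ofReal η ≤ edist (Y n ω) 0
    rw [edist_dist, Real.dist_eq, sub_zero]
    exact ENNReal.ofReal_le_ofReal hω.le
  · intro h ε hε
    -- Convergence in measure quantifies over extended levels; a real deviation never reaches `⊤`.
    by_cases hT : ε = ⊤
    · have : ∀ n, {x | ε ≤ edist (Y n x) 0} = (∅ : Set Ω) := by
        intro n
        refine Set.eq_empty_of_forall_notMem fun x (hx : ε ≤ edist (Y n x) 0) => ?_
        rw [hT, top_le_iff] at hx
        exact edist_ne_top _ _ hx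
      simp only [this, measure_empty]
      exact tendsto_const_nhds
    · have hr : 0 < ε.toReal := ENNReal.toReal_pos hε.ne' hT
      refine tendsto_of_tendsto_of_tendsto_of_le_of_le tendsto_const_nhds
        (h (ε.toReal / 2) (by positivity)) (fun _ => zero_le)
        (fun n => measure_mono fun ω (hω : ε ≤ edist (Y n ω) 0) => ?_)
      change ε.toReal / 2 < |Y n ω|
      rw [edist_dist, Real.dist_eq, sub_zero] at hω
      have := (ENNReal.toReal_le_toReal hT ENNReal.ofReal_ne_top).2 hω
      rw [ENNReal.toReal_ofReal (abs_nonneg _)] at this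
      linarith

theorem isLittleOP_iff_eventually {Y : ℕ → Ω → ℝ} :
    IsLittleOP μ Y ↔ ∀ η : ℝ, 0 < η → ∀ τ : ENNReal, 0 < τ →
      ∀ᶠ n in atTop, μ {ω | η < |Y n ω|} ≤ τ := by
  simp only [isLittleOP_iff, ENNReal.tendsto_nhds_zero, gt_iff_lt]

theorem IsLittleOP.add {Y W : ℕ → Ω → ℝ} (hY : IsLittleOP μ Y) (hW : IsLittleOP μ W) :
    IsLittleOP μ fun n ω => Y n ω + W n ω := by
  rw [isLittleOP_iff_eventually] at *
  intro η hη τ hτ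
  filter_upwards [hY (η / 2) (half_pos hη) (τ / 2) (ENNReal.half_pos hτ.ne'),
    hW (η / 2) (half_pos hη) (τ / 2) (ENNReal.half_pos hτ.ne')] with n h1 h2
  calc μ {ω | η < |Y n ω + W n ω|} ≤ μ ({ω | η / 2 < |Y n ω|} ∪ {ω | η / 2 < |W n ω|}) := by
        refine measure_mono fun ω (hω : η < |Y n ω + W n ω|) => ?_
        by_contra hcon
        have e1 : ¬ η / 2 < |Y n ω| := fun h => hcon (Or.inl h)
        have e2 : ¬ η / 2 < |W n ω| := fun h => hcon (Or.inr h)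
        linarith [abs_add_le (Y n ω) (W n ω)]
    _ ≤ τ / 2 + τ / 2 := (measure_union_le _ _).trans (add_le_add h1 h2)
    _ = τ := ENNReal.add_halves τ

theorem isLittleOP_zero : IsLittleOP μ fun _ _ => 0 := by
  rw [isLittleOP_iff]
  intro η hη
  simp [not_lt.2 hη.le]

theorem IsLittleOP.sum {ι : Type*} (s : Finset ι) {Y : ι → ℕ → Ω → ℝ}
    (hY : ∀ i ∈ s, IsLittleOP μ (Y i)) : IsLittleOP μ fun n ω => ∑ i ∈ s, Y i n ω := by
  classical
  induction s using Finset.induction_on with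
  | empty => simpa using isLittleOP_zero
  | insert i s hi ih =>
    simp only [Finset.sum_insert hi]
    exact (hY i (Finset.mem_insert_self i s)).add
      (ih fun j hj => hY j (Finset.mem_insert_of_mem hj))

/-- Domination outside of events of vanishing probability. -/
theorem IsLittleOP.of_le {Y W : ℕ → Ω → ℝ} (hW : IsLittleOP μ W)
    (h : Tendsto (fun n => μ {ω | ¬ |Y n ω| ≤ |W n ω|}) atTop (nhds 0)) : IsLittleOP μ Y := by
  rw [isLittleOP_iff] at *
  intro η hη
  have := (hW η hη).add h
  rw [add_zero] at this
  refine tendsto_of_tendsto_of_tendsto_of_le_of_le tendsto_const_nhds this (fun _ => zero_le)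
    (fun n => le_trans (measure_mono fun ω (hω : η < |Y n ω|) => ?_) (measure_union_le _ _))
  by_cases hle : |Y n ω| ≤ |W n ω|
  · exact Or.inl (hω.trans_le hle)
  · exact Or.inr hle

theorem IsLittleOP.mono {Y W : ℕ → Ω → ℝ} (hW : IsLittleOP μ W) (h : ∀ n ω, |Y n ω| ≤ |W n ω|) :
    IsLittleOP μ Y := hW.of_le (by simp [h])

theorem IsBigOP.mul {Y W : ℕ → Ω → ℝ} (hY : IsBigOP μ Y) (hW : IsBigOP μ W) :
    IsBigOP μ fun n ω => Y n ω * W n ω := by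
  intro τ hτ
  obtain ⟨M₁, h1⟩ := hY (τ / 2) (ENNReal.half_pos hτ.ne')
  obtain ⟨M₂, h2⟩ := hW (τ / 2) (ENNReal.half_pos hτ.ne')
  refine ⟨|M₁| * |M₂|, ?_⟩
  filter_upwards [h1, h2] with n h1 h2
  calc _ ≤ μ ({ω | M₁ < |Y n ω|} ∪ {ω | M₂ < |W n ω|}) := by
        refine measure_mono fun ω (hω : _ < |Y n ω * W n ω|) => ?_
        by_contra hcon
        have e1 : ¬ M₁ < |Y n ω| := fun h => hcon (Or.inl h)
        have e2 : ¬ M₂ < |W n ω| := fun h => hcon (Or.inr h)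
        rw [abs_mul] at hω
        refine absurd hω (not_lt.2 ?_)
        exact mul_le_mul ((not_lt.1 e1).trans (le_abs_self _)) ((not_lt.1 e2).trans (le_abs_self _))
          (abs_nonneg _) (abs_nonneg _)
    _ ≤ τ / 2 + τ / 2 := (measure_union_le _ _).trans (add_le_add h1 h2)
    _ = τ := ENNReal.add_halves τ

theorem IsBigOP.add {Y W : ℕ → Ω → ℝ} (hY : IsBigOP μ Y) (hW : IsBigOP μ W) :
    IsBigOP μ fun n ω => Y n ω + W n ω := by
  intro τ hτ
  obtain ⟨M₁, h1⟩ := hY (τ / 2) (ENNReal.half_pos hτ.ne')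
  obtain ⟨M₂, h2⟩ := hW (τ / 2) (ENNReal.half_pos hτ.ne')
  refine ⟨M₁ + M₂, ?_⟩
  filter_upwards [h1, h2] with n h1 h2
  calc _ ≤ μ ({ω | M₁ < |Y n ω|} ∪ {ω | M₂ < |W n ω|}) := by
        refine measure_mono fun ω (hω : _ < |Y n ω + W n ω|) => ?_
        by_contra hcon
        have e1 : ¬ M₁ < |Y n ω| := fun h => hcon (Or.inl h)
        have e2 : ¬ M₂ < |W n ω| := fun h => hcon (Or.inr h)
        linarith [abs_add_le (Y n ω) (W n ω)]
    _ ≤ τ / 2 + τ / 2 := (measure_union_le _ _).trans (add_le_add h1 h2)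
    _ = τ := ENNReal.add_halves τ

theorem IsBigOP.mul_littleOP {Y W : ℕ → Ω → ℝ} (hY : IsBigOP μ Y) (hW : IsLittleOP μ W) :
    IsLittleOP μ fun n ω => Y n ω * W n ω := by
  rw [isLittleOP_iff_eventually] at *
  intro η hη τ hτ
  obtain ⟨M, h1⟩ := hY (τ / 2) (ENNReal.half_pos hτ.ne')
  have hM : 0 < |M| + 1 := by positivity
  filter_upwards [h1, hW (η / (|M| + 1)) (by positivity) (τ / 2) (ENNReal.half_pos hτ.ne')]
    with n h1 h2
  calc _ ≤ μ ({ω | M < |Y n ω|} ∪ {ω | η / (|M| + 1) < |W n ω|}) := by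
        refine measure_mono fun ω (hω : _ < |Y n ω * W n ω|) => ?_
        by_contra hcon
        have e1 : ¬ M < |Y n ω| := fun h => hcon (Or.inl h)
        have e2 : ¬ η / (|M| + 1) < |W n ω| := fun h => hcon (Or.inr h)
        rw [abs_mul] at hω
        refine absurd hω (not_lt.2 ?_)
        have e3 : |Y n ω| ≤ |M| + 1 := by linarith [le_abs_self M]
        calc _ ≤ (|M| + 1) * (η / (|M| + 1)) :=
              mul_le_mul e3 (not_lt.1 e2) (abs_nonneg _) hM.le
          _ = η := by field_simp
    _ ≤ τ / 2 + τ / 2 := (measure_union_le _ _).trans (add_le_add h1 h2)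
    _ = τ := ENNReal.add_halves τ

theorem isLittleOP_of_tendsto {a : ℕ → ℝ} (ha : Tendsto a atTop (nhds 0)) :
    IsLittleOP μ fun n (_ : Ω) => a n := by
  rw [isLittleOP_iff_eventually]
  intro η hη τ _
  have := (Metric.tendsto_nhds.1 ha) η hη
  filter_upwards [this] with n hn
  rw [Real.dist_eq, sub_zero] at hn
  simp [not_lt.2 hn.le]

theorem isBigOP_const [IsFiniteMeasure μ] {N : Ω → ℝ} (hN : Measurable N) :
    IsBigOP μ fun _ => N := by
  intro τ hτ
  obtain ⟨L, hL⟩ := ((tendsto_measure_lt_atTop (μ := μ) hN.abs).eventually (ge_mem_nhds hτ)).exists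
  exact ⟨L, Eventually.of_forall fun n => hL⟩

theorem isBigOP_of_lintegral_le {Y : ℕ → Ω → ℝ} {C : ENNReal} (hC : C ≠ ⊤)
    (hY : ∀ n, AEMeasurable (Y n) μ) (h : ∀ᶠ n in atTop, ∫⁻ ω, ENNReal.ofReal |Y n ω| ∂μ ≤ C) :
    IsBigOP μ Y := by
  intro τ hτ
  by_cases hT : τ = ⊤
  · exact ⟨0, by simp [hT]⟩
  -- The level at which Markov's inequality gives `τ`; the added `1` keeps it positive when `C = 0`.
  set M : ℝ := (C / τ).toReal + 1 with hM
  have hM0 : 0 < M := by positivity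
  have hCτ : C / τ ≠ ⊤ := ENNReal.div_ne_top hC hτ.ne'
  refine ⟨M, ?_⟩
  filter_upwards [h] with n hn
  have hMne : ENNReal.ofReal M ≠ 0 := (ENNReal.ofReal_pos.2 hM0).ne'
  calc μ {ω | M < |Y n ω|} ≤ μ {ω | ENNReal.ofReal M ≤ ENNReal.ofReal |Y n ω|} :=
        measure_mono fun ω (hω : M < |Y n ω|) => ENNReal.ofReal_le_ofReal hω.le
    _ ≤ (∫⁻ ω, ENNReal.ofReal |Y n ω| ∂μ) / ENNReal.ofReal M := by
        refine meas_ge_le_lintegral_div ?_ hMne ENNReal.ofReal_ne_top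
        exact ((measurable_id.abs.comp_aemeasurable (hY n))).ennreal_ofReal
    _ ≤ C / ENNReal.ofReal M := by gcongr
    _ ≤ τ := by
        refine ENNReal.div_le_of_le_mul ?_
        have h1 : C / τ ≤ ENNReal.ofReal M := by
          rw [← ENNReal.ofReal_toReal hCτ]
          exact ENNReal.ofReal_le_ofReal (by linarith)
        calc C = τ * (C / τ) := (ENNReal.mul_div_cancel hτ.ne' hT).symm
          _ ≤ _ := by gcongr

end StochasticOrder

/-! ### Moments of the stationary solution and the series form of its volatility. -/

section StationaryFacts

variable {Ω : Type*} [mΩ : MeasurableSpace Ω] {μ : Measure Ω} [IsProbabilityMeasure μ] {p q : ℕ}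

/-- The stationary solution has a small moment, its squares are functionals of the past of the
innovations, and its volatility is given by the series `σ_t²(θ)`. -/
theorem stationary_facts (hp : 1 ≤ p) {ε X σ : ℤ → Ω → ℝ}
    (hε : IsInnovation μ ε) {θ : Param p q} (hθ : ∀ j, 0 ≤ θ j)
    (hsum : ∑ j : Fin q, θ (Sum.inr j) < 1) (hγ : topLyapunov μ θ ε < 0)
    (hX : IsStationarySolution μ θ ε X σ) :
    ∃ s : ℝ, 0 < s ∧ s ≤ 1 ∧
      (∃ C : ENNReal, C ≠ ⊤ ∧ ∀ t, ∫⁻ ω, ENNReal.ofReal (X t ω ^ 2) ^ s ∂μ ≤ C) ∧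
      (∃ f : (ℕ → ℝ) → ℝ, Measurable f ∧ ∀ t, ∀ᵐ ω ∂μ, X t ω ^ 2 = f (past ε t ω)) ∧
      ∀ t, ∀ᵐ ω ∂μ, σ t ω ^ 2 = volSq (fun u => X u ω) θ t := by
  obtain ⟨s, hs, hs1, hU⟩ := exists_tsum_prodMoment_ne_top hε hγ
  obtain ⟨C, hC, hCb⟩ := lintegral_stateSeries_ne_top hε hθ hs hs1 hU
  have hstate := state_eq_stateSeries hε hθ hs hU hX
  have hmom : ∀ i t, ∫⁻ ω, ENNReal.ofReal
      (state (p := p) (q := q) (fun u => X u ω) (fun u => σ u ω) t i) ^ s ∂μ ≤ C := by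
    intro i t
    refine le_trans (le_of_eq (lintegral_congr_ae ?_)) (hCb i t)
    filter_upwards [hstate t i] with ω h
    rw [h]
  have hX0 : ∀ t ω, state (p := p) (q := q) (fun u => X u ω) (fun u => σ u ω) t
      (Sum.inl ⟨0, hp⟩) = X t ω ^ 2 := fun t ω => by simp [state]
  have hXmom : ∀ t, ∫⁻ ω, ENNReal.ofReal (X t ω ^ 2) ^ s ∂μ ≤ C := fun t => by
    simpa only [hX0] using hmom (Sum.inl ⟨0, hp⟩) t
  have hstm : ∀ t i, Measurable fun ω =>
      state (p := p) (q := q) (fun u => X u ω) (fun u => σ u ω) t i := by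
    intro t i
    rcases i with i | i
    · exact (hX.measurable_X _).pow_const 2
    · exact (hX.measurable_vol _).pow_const 2
  -- moments of the volatility
  have hσmom : ∃ C' : ENNReal, C' ≠ ⊤ ∧ ∀ t, ∫⁻ ω, ENNReal.ofReal (σ t ω ^ 2) ^ s ∂μ ≤ C' := by
    refine ⟨ENNReal.ofReal (θ (Sum.inl 0)) ^ s + ∑ i, ENNReal.ofReal (lagCoef θ i) ^ s * C,
      ENNReal.add_ne_top.2 ⟨ENNReal.rpow_ne_top_of_nonneg hs.le ENNReal.ofReal_ne_top,
        ENNReal.sum_ne_top.2 fun i _ => ENNReal.mul_ne_top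
          (ENNReal.rpow_ne_top_of_nonneg hs.le ENNReal.ofReal_ne_top) hC⟩, fun t => ?_⟩
    -- If `q = 0` the state has no volatility coordinate, so the moment is taken from the volatility
    -- equation.
    calc ∫⁻ ω, ENNReal.ofReal (σ t ω ^ 2) ^ s ∂μ ≤
        ∫⁻ ω, (ENNReal.ofReal (θ (Sum.inl 0)) ^ s + ∑ i, ENNReal.ofReal (lagCoef θ i) ^ s *
          ENNReal.ofReal (state (fun u => X u ω) (fun u => σ u ω) (t - 1) i) ^ s) ∂μ := by
          refine lintegral_mono_ae ?_
          filter_upwards [hX.vol_eq t] with ω h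
          rw [volatility_eq_lagCoef (x := fun u => X u ω) (s := fun u => σ u ω) h,
            ENNReal.ofReal_add (hθ _) (Finset.sum_nonneg fun i _ =>
              mul_nonneg (lagCoef_nonneg hθ i) (state_nonneg _ _ _ _)),
            ENNReal.ofReal_sum_of_nonneg fun i _ =>
              mul_nonneg (lagCoef_nonneg hθ i) (state_nonneg _ _ _ _)]
          refine (ENNReal.rpow_add_le_add_rpow _ _ hs.le hs1).trans (add_le_add le_rfl ?_)
          have := rpow_tsum_le_tsum_rpow (fun i => ENNReal.ofReal
            (lagCoef θ i * state (fun u => X u ω) (fun u => σ u ω) (t - 1) i)) hs hs1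
          rw [tsum_fintype, tsum_fintype] at this
          refine this.trans (Finset.sum_le_sum fun i _ => ?_)
          rw [ENNReal.ofReal_mul (lagCoef_nonneg hθ i), ENNReal.mul_rpow_of_nonneg _ _ hs.le]
      _ = ENNReal.ofReal (θ (Sum.inl 0)) ^ s + ∑ i, ENNReal.ofReal (lagCoef θ i) ^ s *
          ∫⁻ ω, ENNReal.ofReal (state (fun u => X u ω) (fun u => σ u ω) (t - 1) i) ^ s ∂μ := by
          have hm : ∀ i, Measurable fun ω =>
              ENNReal.ofReal (state (fun u => X u ω) (fun u => σ u ω) (t - 1) i) ^ s :=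
            fun i => (hstm (t - 1) i).ennreal_ofReal.pow_const s
          rw [lintegral_add_left measurable_const, lintegral_const, measure_univ, mul_one,
            lintegral_finsetSum _ fun i _ => (hm i).const_mul _]
          simp only [lintegral_const_mul _ (hm _)]
      _ ≤ _ := by
          gcongr with i
          exact hmom i (t - 1)
  obtain ⟨C', hC', hσb⟩ := hσmom
  refine ⟨s, hs, hs1, ⟨C, hC, hXmom⟩, ?_, ?_⟩
  · refine ⟨fun e => (stateSeries θ e (Sum.inl ⟨0, hp⟩)).toReal,
      (measurable_stateSeries θ _).ennreal_toReal, fun t => ?_⟩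
    filter_upwards [hstate t (Sum.inl ⟨0, hp⟩)] with ω h
    rw [← h, hX0, ENNReal.toReal_ofReal (sq_nonneg _)]
  · intro t
    obtain ⟨ρ, hρ, hρ1, τ, hτ0, hτ1, hτ⟩ := exists_rate hθ hsum
    obtain ⟨K, hK, hcK⟩ := exists_coef_le hθ hρ hτ1 hτ
    have hsX : ∀ᵐ ω ∂μ, ∀ t : ℤ, Summable fun n : ℕ => ρ ^ n * X (t - n) ω ^ 2 :=
      ae_all_iff.2 fun t => ae_summable_of_moment (W := fun n ω => X (t - n) ω ^ 2)
        (fun n => (hX.measurable_X _).pow_const 2) (fun n ω => sq_nonneg _) hs hs1 hρ hρ1 hC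
        (fun n => hXmom _)
    have hsσ : ∀ᵐ ω ∂μ, Summable fun n : ℕ => ρ ^ n * σ (t - n) ω ^ 2 :=
      ae_summable_of_moment (W := fun n ω => σ (t - n) ω ^ 2)
        (fun n => (hX.measurable_vol _).pow_const 2) (fun n ω => sq_nonneg _) hs hs1 hρ hρ1 hC'
        (fun n => hσb _)
    filter_upwards [hsX, hsσ, ae_all_iff.2 hX.vol_eq] with ω h1 h2 h3
    set x : ℤ → ℝ := fun u => X u ω with hx
    have hc := coef_nonneg hθ
    have hterm : ∀ (t : ℤ) (n i : ℕ), ρ ^ n * (coef θ (i + 1) * x (t - n - ((i : ℤ) + 1)) ^ 2) ≤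
        K * (ρ ^ (i + (n + 1)) * x (t - ((i + (n + 1) : ℕ) : ℤ)) ^ 2) := by
      intro t n i
      have : t - n - ((i : ℤ) + 1) = t - ((i + (n + 1) : ℕ) : ℤ) := by push_cast; ring
      rw [this]
      have h4 := mul_le_mul_of_nonneg_right (hcK i) (sq_nonneg (x (t - ((i + (n + 1) : ℕ) : ℤ))))
      calc _ ≤ ρ ^ n * (K * ρ ^ (i + 1) * x (t - ((i + (n + 1) : ℕ) : ℤ)) ^ 2) :=
            mul_le_mul_of_nonneg_left h4 (by positivity)
        _ = _ := by rw [show i + (n + 1) = n + (i + 1) by ring, pow_add]; ring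
    have hsc : ∀ t : ℤ, Summable fun i : ℕ => coef θ (i + 1) * x (t - ((i : ℤ) + 1)) ^ 2 := by
      intro t
      refine Summable.of_nonneg_of_le (fun i => mul_nonneg (hc i) (sq_nonneg _)) (fun i => ?_)
        (((summable_nat_add_iff 1).2 (h1 t)).mul_left K)
      simpa using hterm t 0 i
    have hrec := volSq_recursion hsum.ne hsc
    -- Both processes solve the same equation with the same observations, so their difference is
    -- homogeneous; the weighted series bound its growth into the past.
    have hw : ∀ u, (fun u => σ u ω ^ 2 - volSq x θ u) u = ∑ j : Fin q, θ (Sum.inr j) *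
        (fun u => σ u ω ^ 2 - volSq x θ u) (u - ((j.val : ℤ) + 1)) := by
      intro u
      simp only [mul_sub, Finset.sum_sub_distrib]
      rw [h3 u, hrec u]
      ring
    have hzero := eq_zero_of_recursion (fun j => hθ (Sum.inr j)) hρ hτ0 hτ1 hτ hw (t := t)
      (B := (∑' n : ℕ, ρ ^ n * σ (t - n) ω ^ 2) +
        (|coef θ 0| + K * ∑' n : ℕ, ρ ^ n * x (t - n) ^ 2)) (fun n => ?_)
    · exact sub_eq_zero.1 hzero
    · have e1 : ρ ^ n * σ (t - n) ω ^ 2 ≤ ∑' n : ℕ, ρ ^ n * σ (t - n) ω ^ 2 :=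
        h2.le_tsum n fun j _ => by positivity
      have e2 : ρ ^ n * ∑' i : ℕ, coef θ (i + 1) * x (t - n - ((i : ℤ) + 1)) ^ 2 ≤
          K * ∑' n : ℕ, ρ ^ n * x (t - n) ^ 2 := by
        rw [← tsum_mul_left, ← tsum_mul_left]
        refine (Summable.tsum_le_tsum (hterm t n) ((hsc (t - n)).mul_left _)
          (((summable_nat_add_iff (n + 1)).2 (h1 t)).mul_left K)).trans ?_
        exact tsum_comp_le_tsum_of_inj ((h1 t).mul_left K) (fun i => by positivity)
          (add_left_injective (n + 1))
      have e3 : 0 ≤ ∑' i : ℕ, coef θ (i + 1) * x (t - n - ((i : ℤ) + 1)) ^ 2 :=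
        tsum_nonneg fun i => mul_nonneg (hc i) (sq_nonneg _)
      have hρn : ρ ^ n ≤ 1 := pow_le_one₀ hρ.le hρ1.le
      have e4 : |volSq x θ (t - n)| ≤ |coef θ 0| +
          ∑' i : ℕ, coef θ (i + 1) * x (t - n - ((i : ℤ) + 1)) ^ 2 := by
        refine (abs_add_le _ _).trans (add_le_add le_rfl (le_of_eq (abs_of_nonneg e3)))
      calc ρ ^ n * |σ (t - n) ω ^ 2 - volSq x θ (t - n)| ≤
          ρ ^ n * (σ (t - n) ω ^ 2 + (|coef θ 0| +
            ∑' i : ℕ, coef θ (i + 1) * x (t - n - ((i : ℤ) + 1)) ^ 2)) := by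
            refine mul_le_mul_of_nonneg_left ?_ (by positivity)
            refine (abs_sub _ _).trans (add_le_add (le_of_eq (abs_of_nonneg (sq_nonneg _))) e4)
        _ = ρ ^ n * σ (t - n) ω ^ 2 + (ρ ^ n * |coef θ 0| +
            ρ ^ n * ∑' i : ℕ, coef θ (i + 1) * x (t - n - ((i : ℤ) + 1)) ^ 2) := by ring
        _ ≤ _ := add_le_add e1 (add_le_add (mul_le_of_le_one_left (abs_nonneg _) hρn) e2)

end StationaryFacts

/-! ### Measurability, convergence and means of the moving sums. -/

section MovingSums

variable {Ω : Type*} [mΩ : MeasurableSpace Ω] {μ : Measure Ω} {X : ℤ → Ω → ℝ}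

theorem measurable_powSum (hX : ∀ t, Measurable (X t)) (r s : ℝ) (t : ℤ) :
    Measurable fun ω => powSum r s (fun u => X u ω) t :=
  Measurable.tsum fun _ => (((hX _).pow_const 2).pow_const s).const_mul _

theorem powSum_nonneg {r : ℝ} (hr : 0 < r) (s : ℝ) (x : ℤ → ℝ) (t : ℤ) : 0 ≤ powSum r s x t :=
  tsum_nonneg fun _ => mul_nonneg (by positivity) (Real.rpow_nonneg (sq_nonneg _) _)

theorem measurable_dLogVolSq (hX : ∀ t, Measurable (X t)) {p q : ℕ} (θ : Param p q) (t : ℤ)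
    (j : Fin (p + 1) ⊕ Fin q) : Measurable fun ω => dLogVolSq (fun u => X u ω) θ t j :=
  ((Measurable.tsum fun _ => ((hX _).pow_const 2).const_mul _).const_add _).div
    ((Measurable.tsum fun _ => ((hX _).pow_const 2).const_mul _).const_add _)

theorem ae_summable_powSum (hX : ∀ t, Measurable (X t)) {s : ℝ} {C : ENNReal} (hC : C ≠ ⊤)
    (hm : ∀ t, ∫⁻ ω, ENNReal.ofReal (X t ω ^ 2) ^ s ∂μ ≤ C) (hs : 0 < s) {r : ℝ} (hr : 0 < r)
    (hr1 : r < 1) (t : ℤ) :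
    ∀ᵐ ω ∂μ, Summable fun i : ℕ => r ^ (i + 1) * (X (t - ((i : ℤ) + 1)) ω ^ 2) ^ s := by
  have h := ae_summable_of_moment (μ := μ)
    (W := fun n ω => (X (t - ((n : ℤ) + 1)) ω ^ 2) ^ s)
    (fun n => ((hX _).pow_const 2).pow_const s) (fun n ω => Real.rpow_nonneg (sq_nonneg _) _)
    one_pos le_rfl hr hr1 hC (fun n => by
      simp only [ENNReal.rpow_one, ← ENNReal.ofReal_rpow_of_nonneg (sq_nonneg _) hs.le]
      exact hm _)
  filter_upwards [h] with ω h
  refine (h.mul_left r).congr fun i => ?_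
  ring

theorem ae_summable_sq (hX : ∀ t, Measurable (X t)) {s : ℝ} {C : ENNReal} (hC : C ≠ ⊤)
    (hm : ∀ t, ∫⁻ ω, ENNReal.ofReal (X t ω ^ 2) ^ s ∂μ ≤ C) (hs : 0 < s) (hs1 : s ≤ 1) {ρ : ℝ}
    (hρ : 0 < ρ) (hρ1 : ρ < 1) (t : ℤ) :
    ∀ᵐ ω ∂μ, Summable fun i : ℕ => ρ ^ (i + 1) * X (t - ((i : ℤ) + 1)) ω ^ 2 := by
  have h := ae_summable_of_moment (μ := μ) (W := fun n ω => X (t - ((n : ℤ) + 1)) ω ^ 2)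
    (fun n => (hX _).pow_const 2) (fun n ω => sq_nonneg _) hs hs1 hρ hρ1 hC (fun n => hm _)
  filter_upwards [h] with ω h
  refine (h.mul_left ρ).congr fun i => ?_
  ring

theorem exists_lintegral_powSum_le (hX : ∀ t, Measurable (X t)) {s : ℝ} {C : ENNReal} (hC : C ≠ ⊤)
    (hm : ∀ t, ∫⁻ ω, ENNReal.ofReal (X t ω ^ 2) ^ s ∂μ ≤ C) (hs : 0 < s) {r : ℝ} (hr : 0 < r)
    (hr1 : r < 1) :
    ∃ C' : ENNReal, C' ≠ ⊤ ∧
      ∀ t, ∫⁻ ω, ENNReal.ofReal (powSum r s (fun u => X u ω) t) ∂μ ≤ C' := by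
  have hgeo : ∑' i : ℕ, ENNReal.ofReal (r ^ (i + 1)) ≠ ⊤ := by
    rw [← ENNReal.ofReal_tsum_of_nonneg (fun i => by positivity)
      ((summable_nat_add_iff 1).2 (summable_geometric_of_lt_one hr.le hr1))]
    exact ENNReal.ofReal_ne_top
  refine ⟨(∑' i : ℕ, ENNReal.ofReal (r ^ (i + 1))) * C, ENNReal.mul_ne_top hgeo hC, fun t => ?_⟩
  have h0 : ∀ (i : ℕ) ω, 0 ≤ (X (t - ((i : ℤ) + 1)) ω ^ 2) ^ s :=
    fun i ω => Real.rpow_nonneg (sq_nonneg _) _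
  calc ∫⁻ ω, ENNReal.ofReal (powSum r s (fun u => X u ω) t) ∂μ =
      ∫⁻ ω, ∑' i : ℕ, ENNReal.ofReal (r ^ (i + 1)) *
        ENNReal.ofReal (X (t - ((i : ℤ) + 1)) ω ^ 2) ^ s ∂μ := by
        refine lintegral_congr_ae ?_
        filter_upwards [ae_summable_powSum hX hC hm hs hr hr1 t] with ω h
        rw [powSum, ENNReal.ofReal_tsum_of_nonneg (fun i => mul_nonneg (by positivity) (h0 i ω)) h]
        refine tsum_congr fun i => ?_
        rw [ENNReal.ofReal_mul (by positivity), ENNReal.ofReal_rpow_of_nonneg (sq_nonneg _) hs.le]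
    _ = ∑' i : ℕ, ENNReal.ofReal (r ^ (i + 1)) *
        ∫⁻ ω, ENNReal.ofReal (X (t - ((i : ℤ) + 1)) ω ^ 2) ^ s ∂μ := by
        have hms : ∀ i : ℕ, Measurable fun ω => ENNReal.ofReal (X (t - ((i : ℤ) + 1)) ω ^ 2) ^ s :=
          fun i => ((hX _).pow_const 2).ennreal_ofReal.pow_const s
        rw [lintegral_tsum fun i => ((hms i).const_mul _).aemeasurable]
        exact tsum_congr fun i => lintegral_const_mul _ (hms i)
    _ ≤ ∑' i : ℕ, ENNReal.ofReal (r ^ (i + 1)) * C :=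
        ENNReal.tsum_le_tsum fun i => mul_le_mul_right (hm _) _
    _ = _ := ENNReal.tsum_mul_right

end MovingSums

/-! ### An innovation times a functional of the earlier innovations. -/

section Functionals

theorem measurable_past_Iio {Ω : Type*} (ε : ℤ → Ω → ℝ) (t : ℤ) :
    Measurable[sigmaOn ε (Set.Iio t)] (past ε (t - 1)) :=
  measurable_past_sigmaOn ε fun i => by simp only [Set.mem_Iio]; omega

theorem disjoint_singleton_Iio (t : ℤ) : Disjoint ({t} : Set ℤ) (Set.Iio t) := by simp

variable {Ω : Type*} [mΩ : MeasurableSpace Ω] {μ : Measure Ω} {ε X : ℤ → Ω → ℝ}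

/-- A functional of the squares of the past observations is a functional of the past
innovations. -/
theorem exists_functional_past {f : (ℕ → ℝ) → ℝ} (hf : Measurable f)
    (hXf : ∀ t, ∀ᵐ ω ∂μ, X t ω ^ 2 = f (past ε t ω)) {Φ : (ℕ → ℝ) → ℝ} (hΦ : Measurable Φ) :
    ∃ Ψ : (ℕ → ℝ) → ℝ, Measurable Ψ ∧ ∀ᵐ ω ∂μ, ∀ t : ℤ,
      Φ (fun i => X (t - ((i : ℤ) + 1)) ω ^ 2) = Ψ (past ε (t - 1) ω) := by
  refine ⟨fun e => Φ fun i => f fun n => e (n + i), hΦ.comp (measurable_pi_lambda _ fun i =>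
    hf.comp (measurable_pi_lambda _ fun n => measurable_pi_apply _)), ?_⟩
  filter_upwards [ae_all_iff.2 hXf] with ω h t
  congr 1
  ext i
  rw [h]
  congr 1
  ext n
  simp only [past]
  congr 1
  push_cast
  ring

/-- Because `ε_t` is independent of its past, a mean of `Ψ` and a `k`th moment of `ε_0` suffice; no
Hölder inequality is needed. -/
theorem lintegral_pow_mul_past (hε : IsInnovation μ ε) {Ψ : (ℕ → ℝ) → ℝ} (hΨ : Measurable Ψ)
    (k : ℕ) (t : ℤ) :
    ∫⁻ ω, ENNReal.ofReal (|ε t ω| ^ k) * ENNReal.ofReal (Ψ (past ε (t - 1) ω)) ∂μ =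
      (∫⁻ ω, ENNReal.ofReal (|ε 0 ω| ^ k) ∂μ) *
        ∫⁻ ω, ENNReal.ofReal (Ψ (past ε (t - 1) ω)) ∂μ := by
  have hφ : Measurable fun y : ℝ => ENNReal.ofReal (|y| ^ k) := by fun_prop
  rw [lintegral_mul_sigmaOn (f := fun ω => ENNReal.ofReal (|ε t ω| ^ k))
    (g := fun ω => ENNReal.ofReal (Ψ (past ε (t - 1) ω))) hε.measurable hε.indep
    (disjoint_singleton_Iio t)
    (hφ.comp (measurable_sigmaOn ε (Set.mem_singleton t)))
    ((ENNReal.measurable_ofReal.comp hΨ).comp (measurable_past_Iio ε t))]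
  congr 1
  exact ((hε.identDistrib t).comp hφ).lintegral_eq

theorem indepFun_pow_past (hε : IsInnovation μ ε) {Ψ : (ℕ → ℝ) → ℝ} (hΨ : Measurable Ψ)
    (k : ℕ) (t : ℤ) :
    IndepFun (fun ω => ε t ω ^ k) (fun ω => Ψ (past ε (t - 1) ω)) μ := by
  refine (IndepFun_iff_Indep _ _ _).2 ?_
  refine indep_of_indep_of_le_left (indep_of_indep_of_le_right
    (indep_sigmaOn hε.measurable hε.indep (disjoint_singleton_Iio t)) ?_) ?_
  · exact (hΨ.comp (measurable_past_Iio ε t)).comap_le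
  · exact ((measurable_sigmaOn ε (Set.mem_singleton t)).pow_const k).comap_le

/-- The weak law for `ε_t^k Ψ(ε_{t-1}, ε_{t-2}, …)`. -/
theorem tendsto_measure_sum_pow_mul_past [IsProbabilityMeasure μ] (hε : IsInnovation μ ε) {Ψ : (ℕ → ℝ) → ℝ}
    (hΨ : Measurable Ψ) {k : ℕ} (hmom : Integrable (fun ω => |ε 0 ω| ^ k) μ)
    (hint : Integrable (fun ω => Ψ (past ε (-1) ω)) μ) {η : ℝ} (hη : 0 < η) :
    Tendsto (fun n : ℕ => μ {ω | ∃ N ≤ n, η * n <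
      |∑ i ∈ Finset.range N, (ε ((i : ℤ) + 1) ω ^ k * Ψ (past ε i ω) -
        (∫ ω', ε 0 ω' ^ k ∂μ) * ∫ ω', Ψ (past ε (-1) ω') ∂μ)|}) atTop (nhds 0) := by
  set F : (ℕ → ℝ) → ℝ := fun e => e 0 ^ k * Ψ fun n => e (n + 1) with hF
  have hFm : Measurable F := ((measurable_pi_apply 0).pow_const k).mul
    (hΨ.comp (measurable_pi_lambda _ fun n => measurable_pi_apply _))
  have hFp : ∀ (t : ℤ) ω, F (past ε t ω) = ε t ω ^ k * Ψ (past ε (t - 1) ω) := by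
    intro t ω
    simp only [hF, past]
    congr 2
    · simp
    · ext n
      congr 1
      push_cast
      ring
  have hmom' : Integrable (fun ω => ε 0 ω ^ k) μ := by
    refine hmom.mono' ((hε.measurable 0).pow_const k).aestronglyMeasurable (Eventually.of_forall
      fun ω => ?_)
    rw [Real.norm_eq_abs, abs_pow]
  have hind := indepFun_pow_past hε hΨ k 0
  have hFint : Integrable (fun ω => F (past ε 0 ω)) μ := by
    simp only [hFp]
    exact hind.integrable_mul hmom' hint
  have hFI : ∫ ω, F (past ε 0 ω) ∂μ =
      (∫ ω', ε 0 ω' ^ k ∂μ) * ∫ ω', Ψ (past ε (-1) ω') ∂μ := by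
    simp only [hFp]
    exact hind.integral_fun_mul_eq_mul_integral hmom'.aestronglyMeasurable
      hint.aestronglyMeasurable
  have h := tendsto_measure_sum_past hε.measurable hε.indep hε.identDistrib hFm hFint hη
  rw [hFI] at h
  simpa only [hFp, add_sub_cancel_right] using h

end Functionals

/-! ### The expansion of the residuals with random bounds. -/

section StochasticExpansion

variable {Ω : Type*} [mΩ : MeasurableSpace Ω] {μ : Measure Ω} [IsProbabilityMeasure μ] {p q : ℕ}

/-- The existence of `ψ(θ)`, the law of large numbers for `ε_t^k ∂ log σ_t²(θ)`, and the expansion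
of the powers of the residuals with a remainder of bounded moment. -/
theorem exists_stochastic_expansion (hp : 1 ≤ p) {ε X σ : ℤ → Ω → ℝ}
    (hε : IsInnovation μ ε) {θ : Param p q} (hθ : ∀ j, 0 < θ j)
    (hsum : ∑ j : Fin q, θ (Sum.inr j) < 1) (hγ : topLyapunov μ θ ε < 0)
    (hX : IsStationarySolution μ θ ε X σ) {k : ℕ}
    (hmom : Integrable (fun ω => |ε 0 ω| ^ k) μ) :
    PsiExists μ X θ ∧
    (∀ j, ∀ η : ℝ, 0 < η → Tendsto (fun n : ℕ => μ {ω | ∃ N ≤ n, η * n <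
      |∑ i ∈ Finset.range N, (ε ((i : ℤ) + 1) ω ^ k *
        dLogVolSq (fun u => X u ω) θ ((i : ℤ) + 1) j - (∫ ω', ε 0 ω' ^ k ∂μ) * psi μ X θ j)|})
      atTop (nhds 0)) ∧
    ∃ (g δ : ℝ) (V : Ω → ℝ) (Z : ℤ → Ω → ℝ), 0 < g ∧ g < 1 ∧ 0 < δ ∧ Measurable V ∧
      (∀ t, Measurable (Z t)) ∧ (∀ t ω, 0 ≤ Z t ω) ∧
      (∃ C : ENNReal, C ≠ ⊤ ∧ ∀ t, ∫⁻ ω, ENNReal.ofReal (|ε t ω| ^ k * Z t ω) ∂μ ≤ C) ∧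
      ∀ᵐ ω ∂μ, ∀ (n : ℕ) (v : Param p q), ‖v - θ‖ ≤ δ → ∃ y : ℝ,
        residual (fun u => X u ω) v n = ε n ω * y ∧
        |y ^ k - 1 + k / 2 * ∑ j, dLogVolSq (fun u => X u ω) θ n j * (v j - θ j)| ≤
          V ω * Z n ω * (‖v - θ‖ ^ 2 + g ^ n) := by
  obtain ⟨s, hs, hs1, ⟨C₁, hC₁, hm⟩, ⟨f, hf, hXf⟩, hvol⟩ :=
    stationary_facts hp hε (fun j => (hθ j).le) hsum hγ hX
  obtain ⟨ρ, r, g, δ, C, hρ, hρ1, hr, hr1, hg, hg1, hδ, -, hexp⟩ :=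
    exists_path_expansion hθ hsum hs hs1 k
  have hXm := hX.measurable_X
  have hS1 := ae_all_iff.2 (ae_summable_powSum hXm hC₁ hm hs hr hr1)
  have hS2 := ae_all_iff.2 (ae_summable_sq hXm hC₁ hm hs hs1 hρ hρ1)
  obtain ⟨C₂, hC₂, hps⟩ := exists_lintegral_powSum_le hXm hC₁ hm hs hr hr1
  have hDint : ∀ j, Integrable (fun ω => dLogVolSq (fun t => X t ω) θ 0 j) μ := by
    intro j
    have hpi : Integrable (fun ω => powSum r s (fun u => X u ω) 0) μ := by
      refine ⟨(measurable_powSum hXm r s 0).aestronglyMeasurable, ?_⟩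
      rw [hasFiniteIntegral_iff_ofReal (Eventually.of_forall fun ω => powSum_nonneg hr s _ 0)]
      exact (hps 0).trans_lt hC₂.lt_top
    refine Integrable.mono' (((integrable_const (1:ℝ)).add hpi).const_mul C)
      (measurable_dLogVolSq hXm θ 0 j).aestronglyMeasurable ?_
    filter_upwards [hS1, hS2] with ω h1 h2
    exact (hexp (fun u => X u ω) 0 (h1 0) (h2 0)).2.2.2.1 j
  refine ⟨⟨?_, fun j => ?_, hDint⟩, fun j η hη => ?_,
    g, δ, fun ω => C * (1 + ∑' i : ℕ, ρ ^ (i + 1) * X (0 - ((i : ℤ) + 1)) ω ^ 2) ^ (k + 2),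
    fun t ω => 1 + powSum r s (fun u => X u ω) t, hg, hg1, hδ, ?_, ?_, ?_, ?_, ?_⟩
  · filter_upwards [hS1, hS2] with ω h1 h2
    exact (hexp (fun u => X u ω) 0 (h1 0) (h2 0)).1
  · filter_upwards [hS1, hS2] with ω h1 h2
    exact (hexp (fun u => X u ω) 0 (h1 0) (h2 0)).2.1 j
  · have hΦ : Measurable fun y : ℕ → ℝ => (coefDeriv θ 0 j + ∑' i : ℕ, coefDeriv θ (i + 1) j * y i) /
        (coef θ 0 + ∑' i : ℕ, coef θ (i + 1) * y i) :=
      ((Measurable.tsum fun i => (measurable_pi_apply i).const_mul _).const_add _).div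
        ((Measurable.tsum fun i => (measurable_pi_apply i).const_mul _).const_add _)
    obtain ⟨Ψ, hΨ, hΨe⟩ := exists_functional_past hf hXf hΦ
    have hΨe' : ∀ᵐ ω ∂μ, ∀ t : ℤ,
        dLogVolSq (fun u => X u ω) θ t j = Ψ (past ε (t - 1) ω) := hΨe
    have h0 : (fun ω => dLogVolSq (fun u => X u ω) θ 0 j) =ᵐ[μ] fun ω => Ψ (past ε (-1) ω) := by
      filter_upwards [hΨe'] with ω h using h 0
    have hψ : psi μ X θ j = ∫ ω, Ψ (past ε (-1) ω) ∂μ := integral_congr_ae h0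
    have := tendsto_measure_sum_pow_mul_past hε hΨ hmom ((hDint j).congr h0) hη
    refine this.congr fun n => measure_congr ?_
    filter_upwards [hΨe'] with ω h
    have : ∀ i : ℕ, dLogVolSq (fun u => X u ω) θ ((i : ℤ) + 1) j = Ψ (past ε i ω) := fun i => by
      rw [h, add_sub_cancel_right]
    refine propext ?_
    change (∃ N ≤ n, _) ↔ (∃ N ≤ n, _)
    simp only [this, hψ]
  · exact ((Measurable.tsum fun _ => ((hXm _).pow_const 2).const_mul _).const_add 1).pow_const _
      |>.const_mul C
  · exact fun t => (measurable_powSum hXm r s t).const_add 1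
  · exact fun t ω => add_nonneg zero_le_one (powSum_nonneg hr s _ t)
  · have hΦ : Measurable fun y : ℕ → ℝ => 1 + ∑' i : ℕ, r ^ (i + 1) * y i ^ s :=
      (Measurable.tsum fun i => ((measurable_pi_apply i).pow_const s).const_mul _).const_add 1
    obtain ⟨Ψ, hΨ, hΨe⟩ := exists_functional_past hf hXf hΦ
    have hΨe' : ∀ᵐ ω ∂μ, ∀ t : ℤ,
        1 + powSum r s (fun u => X u ω) t = Ψ (past ε (t - 1) ω) := hΨe
    have hE : ∫⁻ ω, ENNReal.ofReal (|ε 0 ω| ^ k) ∂μ ≠ ⊤ := hmom.lintegral_lt_top.ne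
    refine ⟨(∫⁻ ω, ENNReal.ofReal (|ε 0 ω| ^ k) ∂μ) * (1 + C₂),
      ENNReal.mul_ne_top hE (ENNReal.add_ne_top.2 ⟨ENNReal.one_ne_top, hC₂⟩), fun t => ?_⟩
    calc _ = ∫⁻ ω, ENNReal.ofReal (|ε t ω| ^ k) * ENNReal.ofReal (Ψ (past ε (t - 1) ω)) ∂μ := by
          refine lintegral_congr_ae ?_
          filter_upwards [hΨe'] with ω h
          rw [ENNReal.ofReal_mul (by positivity), h]
      _ = (∫⁻ ω, ENNReal.ofReal (|ε 0 ω| ^ k) ∂μ) *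
          ∫⁻ ω, ENNReal.ofReal (Ψ (past ε (t - 1) ω)) ∂μ := lintegral_pow_mul_past hε hΨ k t
      _ = (∫⁻ ω, ENNReal.ofReal (|ε 0 ω| ^ k) ∂μ) *
          ∫⁻ ω, (1 + ENNReal.ofReal (powSum r s (fun u => X u ω) t)) ∂μ := by
          congr 1
          refine lintegral_congr_ae ?_
          filter_upwards [hΨe'] with ω h
          rw [← h, ENNReal.ofReal_add zero_le_one (powSum_nonneg hr s _ t), ENNReal.ofReal_one]
      _ ≤ _ := by
          rw [lintegral_add_left measurable_const, lintegral_const, measure_univ, mul_one]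
          gcongr
          exact hps t
  · filter_upwards [hS1, hS2, ae_all_iff.2 hvol, ae_all_iff.2 hX.obs_eq,
      ae_all_iff.2 hX.vol_nonneg] with ω h1 h2 h3 h4 h5 n v hv
    obtain ⟨-, -, hpos, -, h6⟩ := hexp (fun u => X u ω) n (h1 n) (h2 n)
    obtain ⟨h7, h8⟩ := h6 n rfl v hv
    refine ⟨_, ?_, h8.trans (le_of_eq (by ring))⟩
    -- The factor `y` is the square root of `σ_n²(θ) / σ̂_n²`; nonnegativity of `σ_n` identifies it
    -- with the root of `σ_n²(θ)`.
    rw [residual, h4 n, Real.sqrt_div hpos.le, ← h3 n, Real.sqrt_sq (h5 n)]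
    ring

end StochasticExpansion

/-! ### Weighted sums and maximal partial sums in probability. -/

section WeightedSums

variable {Ω : Type*} [mΩ : MeasurableSpace Ω] {μ : Measure Ω}

theorem isBigOP_weighted_sum {Y : ℕ → Ω → ℝ} (hY : ∀ t, Measurable (Y t)) (hY0 : ∀ t ω, 0 ≤ Y t ω)
    {C : ENNReal} (hC : C ≠ ⊤) (hYC : ∀ t, ∫⁻ ω, ENNReal.ofReal (Y t ω) ∂μ ≤ C) {w : ℕ → ℕ → ℝ}
    (hw : ∀ n t, 0 ≤ w n t) {c : ℝ} (hwc : ∀ n, ∑ t ∈ Finset.Icc 1 n, w n t ≤ c) :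
    IsBigOP μ fun n ω => ∑ t ∈ Finset.Icc 1 n, w n t * Y t ω := by
  refine isBigOP_of_lintegral_le (C := ENNReal.ofReal c * C) (ENNReal.mul_ne_top
    ENNReal.ofReal_ne_top hC) (fun n => (Finset.measurable_fun_sum _ fun t _ =>
      (hY t).const_mul _).aemeasurable) (Eventually.of_forall fun n => ?_)
  calc _ = ∫⁻ ω, ∑ t ∈ Finset.Icc 1 n, ENNReal.ofReal (w n t) * ENNReal.ofReal (Y t ω) ∂μ := by
        refine lintegral_congr fun ω => ?_
        rw [abs_of_nonneg (Finset.sum_nonneg fun t _ => mul_nonneg (hw n t) (hY0 t ω)),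
          ENNReal.ofReal_sum_of_nonneg fun t _ => mul_nonneg (hw n t) (hY0 t ω)]
        exact Finset.sum_congr rfl fun t _ => ENNReal.ofReal_mul (hw n t)
    _ = ∑ t ∈ Finset.Icc 1 n, ENNReal.ofReal (w n t) * ∫⁻ ω, ENNReal.ofReal (Y t ω) ∂μ := by
        rw [lintegral_finsetSum _ fun t _ => (hY t).ennreal_ofReal.const_mul _]
        exact Finset.sum_congr rfl fun t _ => lintegral_const_mul _ (hY t).ennreal_ofReal
    _ ≤ ∑ t ∈ Finset.Icc 1 n, ENNReal.ofReal (w n t) * C := by gcongr with t; exact hYC t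
    _ = ENNReal.ofReal (∑ t ∈ Finset.Icc 1 n, w n t) * C := by
        rw [ENNReal.ofReal_sum_of_nonneg fun t _ => hw n t, Finset.sum_mul]
    _ ≤ _ := by gcongr; exact hwc n

/-- The largest partial sum in absolute value. -/
noncomputable def maxPartialSum (a : ℕ → ℝ) (n : ℕ) : ℝ :=
  (Finset.range (n + 1)).sup' ⟨0, by simp⟩ fun N => |∑ i ∈ Finset.range N, a i|

theorem abs_sum_le_maxPartialSum (a : ℕ → ℝ) {N n : ℕ} (h : N ≤ n) :
    |∑ i ∈ Finset.range N, a i| ≤ maxPartialSum a n :=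
  Finset.le_sup' (fun N => |∑ i ∈ Finset.range N, a i|) (by simp; omega)

theorem maxPartialSum_nonneg (a : ℕ → ℝ) (n : ℕ) : 0 ≤ maxPartialSum a n :=
  (abs_nonneg _).trans (abs_sum_le_maxPartialSum a (Nat.zero_le n))

theorem isLittleOP_maxPartialSum {a : ℕ → Ω → ℝ} (h : ∀ η : ℝ, 0 < η → Tendsto (fun n : ℕ =>
      μ {ω | ∃ N ≤ n, η * n < |∑ i ∈ Finset.range N, a i ω|}) atTop (nhds 0)) :
    IsLittleOP μ fun n ω => maxPartialSum (fun i => a i ω) n / n := by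
  rw [isLittleOP_iff]
  intro η hη
  refine tendsto_of_tendsto_of_tendsto_of_le_of_le tendsto_const_nhds (h η hη)
    (fun _ => zero_le) (fun n => measure_mono fun ω hω => ?_)
  have hω' : η < |maxPartialSum (fun i => a i ω) n / n| := hω
  obtain ⟨N, hN, hNe⟩ := Finset.exists_mem_eq_sup' (s := Finset.range (n + 1)) ⟨0, by simp⟩
    fun N => |∑ i ∈ Finset.range N, a i ω|
  refine ⟨N, by simp at hN; omega, ?_⟩
  have hn : 0 < n := by
    rcases Nat.eq_zero_or_pos n with rfl | hn
    · simp at hω'; linarith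
    · exact hn
  have hn' : (0:ℝ) < n := by exact_mod_cast hn
  rw [abs_of_nonneg (div_nonneg (maxPartialSum_nonneg _ _) hn'.le), lt_div_iff₀ hn'] at hω'
  rw [← hNe]
  exact hω'

end WeightedSums

/-! ### The algebra of the scaled partial sums. -/

section Deterministic

/-- The deviation of a partial sum of perturbed powers from its linearization. -/
theorem abs_scaled_sum_sub_add_le {ι : Type*} [Fintype ι] {k n : ℕ} (hn : 0 < n) {e y R : ℕ → ℝ}
    {D : ℕ → ι → ℝ} {h ψ : ι → ℝ} {m d : ℝ} (hd : ∀ j, |h j| ≤ d)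
    (hR : ∀ t ∈ Finset.Icc 1 n, |y t ^ k - 1 + k / 2 * ∑ j, D t j * h j| ≤ R t)
    {u : ℝ} (hu : u ∈ Set.Icc (0 : ℝ) 1) :
    |1 / √n * (∑ t ∈ Finset.Icc 1 ⌊n * u⌋₊, (e t * y t) ^ k - ∑ t ∈ Finset.Icc 1 ⌊n * u⌋₊, e t ^ k)
      + k * u * m / 2 * ∑ j, ψ j * (√n * h j)| ≤
    1 / √n * ∑ t ∈ Finset.Icc 1 n, |e t| ^ k * R t +
      k / 2 * ∑ j, √n * d * (maxPartialSum (fun i => e (i + 1) ^ k * D (i + 1) j - m * ψ j) n / n +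
        |m * ψ j| / n) := by
  have hn0 : (0:ℝ) < n := by exact_mod_cast hn
  have hs : 0 < √(n:ℝ) := Real.sqrt_pos.2 hn0
  have hss : √(n:ℝ) * √n = n := Real.mul_self_sqrt hn0.le
  set N := ⌊n * u⌋₊ with hN
  have hNn : N ≤ n := by
    refine Nat.floor_le_of_le ?_
    exact mul_le_of_le_one_right hn0.le hu.2
  have hNu : (N:ℝ) ≤ n * u := Nat.floor_le (mul_nonneg hn0.le hu.1)
  have hNu' : (n * u : ℝ) < N + 1 := Nat.lt_floor_add_one _
  have hshift : ∀ a : ℕ → ℝ, ∑ t ∈ Finset.Icc 1 N, a t = ∑ i ∈ Finset.range N, a (i + 1) := by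
    intro a
    rw [Finset.sum_bij' (fun t _ => t - 1) (fun i _ => i + 1)]
    all_goals simp only [Finset.mem_Icc, Finset.mem_range]
    · intro t ht; omega
    · intro t ht; omega
    · intro t ht; omega
    · intro t ht; omega
    · intro t ht; rw [Nat.sub_add_cancel ht.1]
  -- An exact identity: the expansion remainders, minus the centred sums of `e^k D`, minus the
  -- rounding error `N / n - u` in the drift.
  have hkey : 1 / √n * (∑ t ∈ Finset.Icc 1 N, (e t * y t) ^ k - ∑ t ∈ Finset.Icc 1 N, e t ^ k)
      + k * u * m / 2 * ∑ j, ψ j * (√n * h j) =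
      1 / √n * ∑ t ∈ Finset.Icc 1 N, e t ^ k * (y t ^ k - 1 + k / 2 * ∑ j, D t j * h j) -
      k / 2 * ∑ j, √n * h j * ((∑ i ∈ Finset.range N,
        (e (i + 1) ^ k * D (i + 1) j - m * ψ j)) / n + (N / n - u) * (m * ψ j)) := by
    have e1 : ∑ t ∈ Finset.Icc 1 N, e t ^ k * (y t ^ k - 1 + k / 2 * ∑ j, D t j * h j) =
        (∑ t ∈ Finset.Icc 1 N, (e t * y t) ^ k - ∑ t ∈ Finset.Icc 1 N, e t ^ k) +
        k / 2 * ∑ j, h j * ∑ i ∈ Finset.range N, e (i + 1) ^ k * D (i + 1) j := by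
      have e2 : ∑ j, h j * ∑ i ∈ Finset.range N, e (i + 1) ^ k * D (i + 1) j =
          ∑ t ∈ Finset.Icc 1 N, e t ^ k * ∑ j, D t j * h j := by
        rw [hshift]
        simp only [Finset.mul_sum]
        rw [Finset.sum_comm]
        refine Finset.sum_congr rfl fun i _ => Finset.sum_congr rfl fun j _ => by ring
      rw [e2, Finset.mul_sum, ← Finset.sum_sub_distrib, ← Finset.sum_add_distrib]
      refine Finset.sum_congr rfl fun t _ => ?_
      rw [mul_pow]
      ring
    have e3 : ∀ j, √n * h j * ((∑ i ∈ Finset.range N,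
        (e (i + 1) ^ k * D (i + 1) j - m * ψ j)) / n + (N / n - u) * (m * ψ j)) =
        1 / √n * (h j * ∑ i ∈ Finset.range N, e (i + 1) ^ k * D (i + 1) j) -
          u * m * (ψ j * (√n * h j)) := by
      intro j
      rw [Finset.sum_sub_distrib, Finset.sum_const, Finset.card_range, nsmul_eq_mul]
      have e4 : 1 / √(n:ℝ) = √n / n := by rw [div_eq_div_iff hs.ne' hn0.ne', hss, one_mul]
      rw [e4]
      field_simp
      ring
    rw [Finset.sum_congr rfl fun j _ => e3 j, e1, Finset.sum_sub_distrib, ← Finset.mul_sum,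
      ← Finset.mul_sum]
    ring
  rw [hkey]
  refine (abs_sub _ _).trans (add_le_add ?_ ?_)
  · rw [abs_mul, abs_of_nonneg (by positivity : 0 ≤ 1 / √(n:ℝ))]
    refine mul_le_mul_of_nonneg_left ?_ (by positivity)
    refine (Finset.abs_sum_le_sum_abs _ _).trans ?_
    have hsub : Finset.Icc 1 N ⊆ Finset.Icc 1 n := Finset.Icc_subset_Icc_right hNn
    refine (Finset.sum_le_sum fun t ht => ?_).trans (Finset.sum_le_sum_of_subset_of_nonneg hsub
      fun t ht _ => mul_nonneg (by positivity) ((abs_nonneg _).trans (hR t ht)))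
    rw [abs_mul, abs_pow]
    exact mul_le_mul_of_nonneg_left (hR t (hsub ht)) (by positivity)
  · rw [abs_mul, abs_of_nonneg (by positivity : (0:ℝ) ≤ k / 2)]
    refine mul_le_mul_of_nonneg_left ?_ (by positivity)
    refine (Finset.abs_sum_le_sum_abs _ _).trans (Finset.sum_le_sum fun j _ => ?_)
    rw [abs_mul, abs_mul, abs_of_pos hs]
    refine mul_le_mul (mul_le_mul_of_nonneg_left (hd j) hs.le) ?_ (abs_nonneg _)
      (mul_nonneg hs.le ((abs_nonneg _).trans (hd j)))
    refine (abs_add_le _ _).trans (add_le_add ?_ ?_)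
    · rw [abs_div, abs_of_pos hn0]
      exact div_le_div_of_nonneg_right (abs_sum_le_maxPartialSum _ hNn) hn0.le
    · rw [abs_mul, div_eq_inv_mul |m * ψ j|]
      refine mul_le_mul_of_nonneg_right ?_ (abs_nonneg _)
      rw [abs_le, ← one_div, div_sub' hn0.ne', ← neg_div,
        div_le_div_iff_of_pos_right hn0, div_le_div_iff_of_pos_right hn0]
      constructor <;> linarith

theorem abs_iSup_abs {ι : Type*} (f : ι → ℝ) : |(⨆ i, |f i|)| = ⨆ i, |f i| :=
  abs_of_nonneg (Real.iSup_nonneg fun _ => abs_nonneg _)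

theorem bddAbove_abs_powerSum (k n : ℕ) (e : ℕ → ℝ) :
    ∃ B, ∀ u ∈ Set.Icc (0 : ℝ) 1, |powerSum k n e u| ≤ B := by
  refine ⟨∑ t ∈ Finset.Icc 1 n, |e t ^ k|, fun u hu => ?_⟩
  refine (Finset.abs_sum_le_sum_abs _ _).trans (Finset.sum_le_sum_of_subset_of_nonneg
    (Finset.Icc_subset_Icc_right ?_) fun t _ _ => abs_nonneg _)
  exact Nat.floor_le_of_le (mul_le_of_le_one_right n.cast_nonneg hu.2)

end Deterministic

/-! ### The residual partial sums and their asymptotic drift. -/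

section ResidualSums

variable {Ω : Type*} [mΩ : MeasurableSpace Ω] {μ : Measure Ω} [IsProbabilityMeasure μ] {p q : ℕ}

theorem tendsto_one_div_sqrt : Tendsto (fun n : ℕ => 1 / √(n:ℝ)) atTop (nhds 0) := by
  simp only [one_div]
  exact (Real.tendsto_sqrt_atTop.comp tendsto_natCast_atTop_atTop).inv_tendsto_atTop

/-- The partial sums of powers of the residuals deviate from those of the innovations by a
linear drift. -/
theorem isLittleOP_iSup_scaledDiff_add (hp : 1 ≤ p) {ε X σ : ℤ → Ω → ℝ}
    (hε : IsInnovation μ ε) {θ : Param p q} (hθ : ∀ j, 0 < θ j)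
    (hsum : ∑ j : Fin q, θ (Sum.inr j) < 1) (hγ : topLyapunov μ θ ε < 0)
    (hX : IsStationarySolution μ θ ε X σ) {k : ℕ}
    (hmom : Integrable (fun ω => |ε 0 ω| ^ k) μ)
    {est : ∀ n : ℕ, (Fin (n + 1) → ℝ) → Param p q}
    (hroot : IsBigOP μ fun n ω => √n * ‖estimate est X n ω - θ‖) :
    IsLittleOP μ (fun n ω => ⨆ u : Set.Icc (0 : ℝ) 1, |scaledDiff est ε X k n u ω +
        (k * u * ∫ ω', ε 0 ω' ^ k ∂μ) / 2 * psiInner μ est X θ n ω|) := by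
  obtain ⟨-, hlaw, g, δ, V, Z, hg, hg1, hδ, hV, hZ, hZ0, ⟨C, hC, hZC⟩, hexp⟩ :=
    exists_stochastic_expansion hp hε hθ hsum hγ hX hmom
  set m := ∫ ω', ε 0 ω' ^ k ∂μ with hm
  set d : ℕ → Ω → ℝ := fun n ω => ‖estimate est X n ω - θ‖ with hd
  set A : ℕ → Ω → ℝ := fun n ω => ∑ t ∈ Finset.Icc 1 n, 1 / (n:ℝ) * (|ε t ω| ^ k * Z t ω) with hA
  set B : ℕ → Ω → ℝ := fun n ω => ∑ t ∈ Finset.Icc 1 n, g ^ t * (|ε t ω| ^ k * Z t ω) with hB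
  set T : Fin (p + 1) ⊕ Fin q → ℕ → Ω → ℝ := fun j n ω =>
    maxPartialSum (fun i : ℕ => ε ((i : ℤ) + 1) ω ^ k * dLogVolSq (fun u => X u ω) θ ((i : ℤ) + 1) j
      - m * psi μ X θ j) n with hT
  have hYm : ∀ t : ℕ, Measurable fun ω => |ε t ω| ^ k * Z t ω :=
    fun t => ((hε.measurable t).abs.pow_const k).mul (hZ t)
  have hY0 : ∀ (t : ℕ) ω, 0 ≤ |ε t ω| ^ k * Z t ω := fun t ω =>
    mul_nonneg (by positivity) (hZ0 t ω)
  have hAO : IsBigOP μ A := by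
    refine isBigOP_weighted_sum (Y := fun t ω => |ε t ω| ^ k * Z t ω)
      (w := fun n _ => 1 / (n:ℝ)) hYm hY0 hC (fun t => hZC t) (fun n t => by positivity)
      (c := 1) fun n => ?_
    rw [Finset.sum_const, Nat.card_Icc, nsmul_eq_mul, Nat.add_sub_cancel]
    rw [mul_one_div]
    exact div_self_le_one _
  have hBO : IsBigOP μ B := by
    refine isBigOP_weighted_sum (Y := fun t ω => |ε t ω| ^ k * Z t ω)
      (w := fun _ t => g ^ t) hYm hY0 hC (fun t => hZC t) (fun n t => by positivity)
      (c := (1 - g)⁻¹) fun n => ?_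
    rw [← tsum_geometric_of_lt_one hg.le hg1]
    exact (summable_geometric_of_lt_one hg.le hg1).sum_le_tsum _ fun t _ => by positivity
  have hroot' : IsBigOP μ fun n ω => √n * d n ω := hroot
  have hTo : ∀ j, IsLittleOP μ fun n ω => √n * d n ω * (T j n ω / n + |m * psi μ X θ j| / n) :=
    fun j => hroot'.mul_littleOP ((isLittleOP_maxPartialSum (hlaw j)).add
      (isLittleOP_of_tendsto (tendsto_const_div_atTop_nhds_zero_nat _)))
  -- The dominating variable. `A` is an average and `B` a geometrically weighted sum, so the bracket
  -- is `O_P(1)` and the factor `1 / √n` makes the first part negligible; the law of large numbers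
  -- handles the second.
  have hW : IsLittleOP μ fun n ω => V ω * (√n * d n ω * (√n * d n ω) * A n ω + B n ω) * (1 / √n) +
      k / 2 * ∑ j, √n * d n ω * (T j n ω / n + |m * psi μ X θ j| / n) :=
    (((isBigOP_const hV).mul (((hroot'.mul hroot').mul hAO).add hBO)).mul_littleOP
      (isLittleOP_of_tendsto tendsto_one_div_sqrt)).add
      ((isBigOP_const (N := fun _ => (k:ℝ) / 2) measurable_const).mul_littleOP
        (IsLittleOP.sum Finset.univ fun j _ => hTo j))
  -- Consistency: outside an event of vanishing probability the estimate lies in the ball of radius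
  -- `δ` where the expansion holds.
  have hdo : IsLittleOP μ d := by
    refine (hroot'.mul_littleOP (isLittleOP_of_tendsto tendsto_one_div_sqrt)).of_le ?_
    refine tendsto_const_nhds.congr' ?_
    filter_upwards [eventually_gt_atTop 0] with n hn
    have hs : √(n:ℝ) ≠ 0 := (Real.sqrt_pos.2 (by exact_mod_cast hn)).ne'
    have : ∀ ω, √n * d n ω * (1 / √n) = d n ω := fun ω => by field_simp
    simp only [this, le_refl, not_true_eq_false]
    exact measure_empty.symm
  refine hW.of_le ?_
  refine tendsto_of_tendsto_of_tendsto_of_le_of_le' tendsto_const_nhds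
    (isLittleOP_iff.1 hdo δ hδ) (Eventually.of_forall fun _ => zero_le) ?_
  filter_upwards [eventually_gt_atTop 0] with n hn
  refine measure_mono_ae ?_
  filter_upwards [hexp] with ω hω hbad
  change δ < |d n ω|
  by_contra hlt
  refine hbad ?_
  rw [hd, abs_norm, not_lt] at hlt
  choose y hy1 hy2 using fun t => hω t _ hlt
  rw [abs_iSup_abs]
  refine (ciSup_le fun u => ?_).trans (le_abs_self _)
  have hbound := abs_scaled_sum_sub_add_le (k := k) (n := n) hn
    (e := fun t => ε t ω) (y := y) (D := fun t j => dLogVolSq (fun u => X u ω) θ t j)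
    (R := fun t => V ω * Z t ω * (d n ω ^ 2 + g ^ t)) (h := fun j => estimate est X n ω j - θ j)
    (ψ := psi μ X θ) (m := m) (d := d n ω)
    (fun j => norm_le_pi_norm (estimate est X n ω - θ) j) (fun t _ => hy2 t) u.2
  refine (le_of_eq ?_).trans (hbound.trans (le_of_eq ?_))
  · simp only [scaledDiff, powerSum, psiInner, hy1]
  · congr 1
    have hn0 : (0:ℝ) < n := by exact_mod_cast hn
    have hss : √(n:ℝ) * √n = n := Real.mul_self_sqrt hn0.le
    have e1 : √n * d n ω * (√n * d n ω) * A n ω =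
        ∑ t ∈ Finset.Icc 1 n, d n ω ^ 2 * (|ε t ω| ^ k * Z t ω) := by
      rw [hA, Finset.mul_sum]
      refine Finset.sum_congr rfl fun t _ => ?_
      calc _ = (√n * √n) * (d n ω ^ 2 * (|ε t ω| ^ k * Z t ω)) * (1 / n) := by ring
        _ = _ := by rw [hss]; field_simp
    rw [e1, hB, ← Finset.sum_add_distrib, mul_comm _ (1 / √(n:ℝ)), Finset.mul_sum _ _ (V ω)]
    congr 1
    refine Finset.sum_congr rfl fun t _ => by ring

/-- The residual partial sums are asymptotically equivalent to those of the innovations exactly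
when the drift vanishes. -/
theorem isLittleOP_iSup_scaledDiff_iff {ε X : ℤ → Ω → ℝ} {θ : Param p q} {k : ℕ} (hk : 1 ≤ k)
    {est : ∀ n : ℕ, (Fin (n + 1) → ℝ) → Param p q} {m : ℝ}
    (h : IsLittleOP μ (fun n ω => ⨆ u : Set.Icc (0 : ℝ) 1, |scaledDiff est ε X k n u ω +
        (k * u * m) / 2 * psiInner μ est X θ n ω|)) :
    IsLittleOP μ (fun n ω => ⨆ u : Set.Icc (0 : ℝ) 1, |scaledDiff est ε X k n u ω|) ↔
      m = 0 ∨ IsLittleOP μ (fun n ω => psiInner μ est X θ n ω) := by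
  have hk0 : (0:ℝ) < k := by exact_mod_cast hk
  -- Boundedness must be checked: the real supremum of an unbounded family is `0` by convention and
  -- would bound nothing.
  have hB : ∀ n ω, BddAbove (Set.range fun u : Set.Icc (0 : ℝ) 1 => |scaledDiff est ε X k n u ω|) := by
    intro n ω
    obtain ⟨B₁, h1⟩ := bddAbove_abs_powerSum k n
      fun t => residual (fun s => X s ω) (estimate est X n ω) t
    obtain ⟨B₂, h2⟩ := bddAbove_abs_powerSum k n fun t => ε (t : ℤ) ω
    refine ⟨1 / √n * (B₁ + B₂), ?_⟩
    rintro _ ⟨u, rfl⟩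
    simp only [scaledDiff]
    rw [abs_mul, abs_of_nonneg (by positivity : 0 ≤ 1 / √(n:ℝ))]
    exact mul_le_mul_of_nonneg_left ((abs_sub _ _).trans (add_le_add (h1 u u.2) (h2 u u.2)))
      (by positivity)
  have hle : ∀ n ω (u : Set.Icc (0 : ℝ) 1), |(k * (u : ℝ) * m) / 2 * psiInner μ est X θ n ω| ≤
      k / 2 * |m * psiInner μ est X θ n ω| := by
    intro n ω u
    have : (k * (u : ℝ) * m) / 2 * psiInner μ est X θ n ω =
        k / 2 * (u : ℝ) * (m * psiInner μ est X θ n ω) := by ring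
    rw [this, abs_mul, abs_of_nonneg (mul_nonneg (by positivity) u.2.1)]
    refine mul_le_mul_of_nonneg_right ?_ (abs_nonneg _)
    exact mul_le_of_le_one_right (by positivity) u.2.2
  have hB' : ∀ n ω, BddAbove (Set.range fun u : Set.Icc (0 : ℝ) 1 => |scaledDiff est ε X k n u ω +
      (k * u * m) / 2 * psiInner μ est X θ n ω|) := by
    intro n ω
    obtain ⟨B, hB⟩ := hB n ω
    refine ⟨B + k / 2 * |m * psiInner μ est X θ n ω|, ?_⟩
    rintro _ ⟨u, rfl⟩
    exact (abs_add_le _ _).trans (add_le_add (hB ⟨u, rfl⟩) (hle n ω u))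
  constructor
  · intro h'
    by_cases hm : m = 0
    · exact Or.inl hm
    right
    have hc := (isBigOP_const (μ := μ) (N := fun _ => 2 / (k * m)) measurable_const).mul_littleOP
      (h.add h')
    refine hc.mono fun n ω => ?_
    have h1 : (1:ℝ) ∈ Set.Icc (0:ℝ) 1 := by simp
    have e1 := le_ciSup (hB n ω) ⟨1, h1⟩
    have e2 := le_ciSup (hB' n ω) ⟨1, h1⟩
    set a := scaledDiff est ε X k n (1:ℝ) ω
    set P := psiInner μ est X θ n ω
    -- At `u = 1` the inner product is a fixed multiple of the difference of the two processes, each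
    -- bounded by its supremum.
    have e3 : P = 2 / (k * m) * ((a + k * 1 * m / 2 * P) - a) := by field_simp; ring
    rw [abs_mul]
    nth_rw 1 [e3]
    rw [abs_mul]
    refine mul_le_mul_of_nonneg_left ?_ (abs_nonneg _)
    exact (abs_sub _ _).trans ((add_le_add e2 e1).trans (le_abs_self _))
  · intro h'
    have hc : IsLittleOP μ fun n ω => m * psiInner μ est X θ n ω := by
      rcases h' with rfl | h'
      · simpa using isLittleOP_zero
      · exact (isBigOP_const (N := fun _ => m) measurable_const).mul_littleOP h'
    have hc2 := (isBigOP_const (μ := μ) (N := fun _ => (k:ℝ) / 2) measurable_const).mul_littleOP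
      (hc.mono (Y := fun n ω => |m * psiInner μ est X θ n ω|) fun n ω => by rw [abs_abs])
    refine (h.add hc2).mono fun n ω => ?_
    rw [abs_iSup_abs]
    refine (ciSup_le fun u => ?_).trans (le_abs_self _)
    calc _ = |scaledDiff est ε X k n u ω + (k * u * m) / 2 * psiInner μ est X θ n ω -
          (k * u * m) / 2 * psiInner μ est X θ n ω| := by rw [add_sub_cancel_right]
      _ ≤ _ := (abs_sub _ _).trans (add_le_add (le_ciSup (hB' n ω) u) (hle n ω u))

end ResidualSums

end GARCH

theorem theorem1p1 {Ω : Type*} [MeasurableSpace Ω] (μ : MeasureTheory.Measure Ω)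
    [MeasureTheory.IsProbabilityMeasure μ] (p q : ℕ) (hp : 1 ≤ p)
    (ρ₀ uLow uHigh : ℝ) (huLow : 0 < uLow) (huHigh : uLow < uHigh)
    (hρ₀ : 0 < ρ₀) (hρ₀' : ρ₀ < 1) (hq : (q : ℝ) * uLow < ρ₀)
    (θ : GARCH.Param p q) (hθ : θ ∈ interior (GARCH.paramSpace p q ρ₀ uLow uHigh))
    (ε X σ : ℤ → Ω → ℝ) (hε : GARCH.IsInnovation μ ε)
    (hγ : GARCH.topLyapunov μ θ ε < 0)
    (hX : GARCH.IsStationarySolution μ θ ε X σ)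
    (est : ∀ n : ℕ, (Fin (n + 1) → ℝ) → GARCH.Param p q) (hest : ∀ n, Measurable (est n))
    (hroot : GARCH.IsBigOP μ fun n ω => Real.sqrt n * ‖GARCH.estimate est X n ω - θ‖)
    (hsmall : ∃ ζ : ℝ, 0 < ζ ∧
      Filter.Tendsto (fun x : ℝ => x ^ (-ζ) * μ.real {ω | |ε 0 ω| ≤ x})
        (nhdsWithin 0 (Set.Ioi 0)) (nhds 0))
    (k : ℕ) (hk : 1 ≤ k)
    (hmom : MeasureTheory.Integrable (fun ω => |ε 0 ω| ^ k) μ) :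
    GARCH.PsiExists μ X θ ∧
    GARCH.IsLittleOP μ (fun n ω => ⨆ u : Set.Icc (0 : ℝ) 1,
      |GARCH.scaledDiff est ε X k n u ω +
        (k * u * ∫ ω', ε 0 ω' ^ k ∂μ) / 2 * GARCH.psiInner μ est X θ n ω|) ∧
    (GARCH.IsLittleOP μ (fun n ω => ⨆ u : Set.Icc (0 : ℝ) 1,
        |GARCH.scaledDiff est ε X k n u ω|) ↔
      (∫ ω', ε 0 ω' ^ k ∂μ) = 0 ∨
        GARCH.IsLittleOP μ (fun n ω => GARCH.psiInner μ est X θ n ω)) := by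
  have hmem := interior_subset hθ
  have hpos : ∀ j, 0 < θ j := fun j => huLow.trans_le (hmem.2 j).1
  have hsum : ∑ j : Fin q, θ (Sum.inr j) < 1 := lt_of_le_of_lt hmem.1 hρ₀'
  have hmain := GARCH.isLittleOP_iSup_scaledDiff_add hp hε hpos hsum hγ hX hmom hroot
  exact ⟨(GARCH.exists_stochastic_expansion hp hε hpos hsum hγ hX hmom).1, hmain,
    GARCH.isLittleOP_iSup_scaledDiff_iff hk hmain⟩
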